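/- **Theorem.** Let $\Omega\subseteq\mathbb{R}^d$ ($d\ge1$) be a bounded open set (for instance a bounded Lipschitz domain), let $T>0$, $0<\alpha<1$, $\eta>0$, and let $\omega_\alpha(t)=t^{\alpha-1}/\Gamma(\alpha)$. Write $\langle\cdot,\cdot\rangle$ and $\|\cdot\|$ for the inner product and norm of the real spaces $L_2(\Omega)$ and $L_2(\Omega)^d$. Suppose that the coefficients satisfy $$\kappa\in L_\infty(\Omega)^{d\times d},\qquad \vec F,\vec G\in C^2\bigl([0,T];W^1_\infty(\Omega)^d\bigr),\qquad a,b\in C^1\bigl([0,T];L_\infty(\Omega)\bigr),$$ where $\kappa=\kappa(x)$ is real and symmetric, and its smallest eigenvalue is bounded below by a positive constant, uniformly for (almost every) $x\in\Omega$. For $0\le s\le t\le T$ define $K(t,s):H^1_0(\Omega)\to H^{-1}(\Omega)$ by $$K(t,s)=\omega_\alpha(t-s)K_1(t)+K_2(s)-\int_s^t\omega_\alpha(z-s)K_1'(z)\,dz,$$ where, for $v,w\in H^1_0(\Omega)$, $$\langle K_1(t)v,w\rangle=\langle\kappa\nabla v,\nabla w\rangle-\langle\vec F(t)v,\nabla w\rangle+\langle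 a(t)v,w\rangle,\qquad \langle K_2(t)v,w\rangle=\langle b(t)v,w\rangle-\langle\vec G(t)v,\nabla w\rangle,$$ $$\langle K_1'(t)v,w\rangle=-\langle\vec F'(t)v,\nabla w\rangle+\langle a'(t)v,w\rangle .$$ Then there is a constant $C$, depending only on $\Omega$, $T$, $\alpha$, $\eta$ and the coefficients $\kappa,\vec F,\vec G,a,b$, such that the following holds. Let $M>0$, let $u_0\in L_2(\Omega)$, let $g:(0,T]\to L_2(\Omega)$ be measurable with $\|g(t)\|\le Mt^{\eta-1}$ for $0<t\le T$, and put $f(t)=u_0+\int_0^tg(s)\,ds$. Let $X$ be any finite-dimensional subspace of $H^1_0(\Omega)$, define $K_X(t,s):X\to X$ and $f_X(t)\in X$ by $$\langle K_X(t,s)v,w\rangle=\langle K(t,s)v,w\rangle\quad\text{and}\quad\langle f_X(t),w\rangle=\langle f(t),w\rangle\qquad\text{for all }v,w\in X,$$ and let $u_X\in C([0,T];X)$ be the solution of the projected Volterra equation $$u_X(t)+\int_0^tK_X(t,s)u_X(s)\,ds=f_X(t)\qquad\text{for }0\le t\le T.$$ Then $$\|u_X(t)\|^2+t^\alpha\|\nabla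 u_X(t)\|^2\le C\bigl(\|u_0\|^2+M^2t^{2\eta}\bigr)\qquad\text{for }0\le t\le T.$$ In particular, $C$ is independent of $X$ (and of $u_0$, $g$, $M$). -/

import Mathlib

open MeasureTheory Set
open scoped ENNReal Distributions

noncomputable section

namespace FracADR

/-! ### Function spaces on an open set `Ω ⊆ ℝᵈ` -/

/-- The space `ℝᵈ` with its Euclidean norm. -/
abbrev Rd (d : ℕ) : Type := EuclideanSpace ℝ (Fin d)

variable {d : ℕ}

/-- Lebesgue measure on `Ω`. -/
abbrev vol (Ω : TopologicalSpace.Opens (Rd d)) : Measure (Rd d) :=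
  (volume : Measure (Rd d)).restrict (Ω : Set (Rd d))

/-- The space `L₂(Ω)` of real-valued functions. -/
abbrev L2 (Ω : TopologicalSpace.Opens (Rd d)) : Type := Lp ℝ 2 (vol Ω)

/-- The space `L₂(Ω)ᵈ`. -/
abbrev L2vec (Ω : TopologicalSpace.Opens (Rd d)) : Type := Lp (Rd d) 2 (vol Ω)

/-- The space `L∞(Ω)`. -/
abbrev Linf (Ω : TopologicalSpace.Opens (Rd d)) : Type := Lp ℝ ∞ (vol Ω)

/-- The space `L∞(Ω)ᵈ`. -/
abbrev LinfVec (Ω : TopologicalSpace.Opens (Rd d)) : Type := Lp (Rd d) ∞ (vol Ω)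

/-- The space `L∞(Ω)^{d×d}`; a `d × d` matrix is identified with the linear map on `ℝᵈ` that it
represents in the standard basis. -/
abbrev LinfMat (Ω : TopologicalSpace.Opens (Rd d)) : Type := Lp (Rd d →L[ℝ] Rd d) ∞ (vol Ω)

/-- `G` is the weak gradient of `v` on `Ω`:
`∫_Ω v ∂_y φ = - ∫_Ω φ (G · y)` for all `φ ∈ C_c^∞(Ω)` and all directions `y`. -/
def HasWeakGradient (Ω : TopologicalSpace.Opens (Rd d)) (v : Rd d → ℝ) (G : Rd d → Rd d) : Prop :=
  ∀ (φ : 𝓓(Ω, ℝ)) (y : Rd d),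
    ∫ x, fderiv ℝ φ x y * v x ∂(vol Ω) = -∫ x, φ x * inner ℝ (G x) y ∂(vol Ω)

/-- `D` is the weak Jacobian of the vector field `F` on `Ω`:
`∫_Ω (∂_y φ) F = - ∫_Ω φ (D y)` for all `φ ∈ C_c^∞(Ω)` and all directions `y`. -/
def HasWeakJacobian (Ω : TopologicalSpace.Opens (Rd d)) (F : Rd d → Rd d)
    (D : Rd d → (Rd d →L[ℝ] Rd d)) : Prop :=
  ∀ (φ : 𝓓(Ω, ℝ)) (y : Rd d),
    ∫ x, fderiv ℝ φ x y • F x ∂(vol Ω) = -∫ x, φ x • D x y ∂(vol Ω)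

theorem integrable_test_smul {V : Type*} [NormedAddCommGroup V] [NormedSpace ℝ V]
    {Ω : TopologicalSpace.Opens (Rd d)} (φ : 𝓓(Ω, ℝ)) {p : ℝ≥0∞} (hp : 1 ≤ p) {v : Rd d → V}
    (hv : MemLp v p (vol Ω)) : Integrable (fun x => φ x • v x) (vol Ω) :=
  (hv.locallyIntegrable hp).integrable_smul_left_of_hasCompactSupport φ.continuous
    φ.hasCompactSupport

theorem integrable_fderiv_test_smul {V : Type*} [NormedAddCommGroup V] [NormedSpace ℝ V]
    {Ω : TopologicalSpace.Opens (Rd d)} (φ : 𝓓(Ω, ℝ)) (y : Rd d) {p : ℝ≥0∞} (hp : 1 ≤ p)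
    {v : Rd d → V} (hv : MemLp v p (vol Ω)) :
    Integrable (fun x => fderiv ℝ φ x y • v x) (vol Ω) := by
  refine (hv.locallyIntegrable hp).integrable_smul_left_of_hasCompactSupport ?_ ?_
  · exact (φ.contDiff.continuous_fderiv (by simp)).clm_apply continuous_const
  · exact φ.hasCompactSupport.fderiv_apply (𝕜 := ℝ) y

/-- The Sobolev space `H¹(Ω)`, as the space of pairs `(v, ∇v)` of an `L₂` function and its weak
gradient in `L₂`, with `‖(v, ∇v)‖² = ‖v‖² + ‖∇v‖²`. -/
def H1 (Ω : TopologicalSpace.Opens (Rd d)) : Submodule ℝ (WithLp 2 (L2 Ω × L2vec Ω)) where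
  carrier := {p | HasWeakGradient Ω p.fst p.snd}
  zero_mem' := by
    intro φ y
    have h1 : (fun x => fderiv ℝ φ x y * (0 : L2 Ω) x) =ᵐ[vol Ω] fun _ => 0 := by
      filter_upwards [Lp.coeFn_zero ℝ 2 (vol Ω)] with x hx
      rw [hx]
      simp
    have h2 : (fun x => φ x * inner ℝ ((0 : L2vec Ω) x) y) =ᵐ[vol Ω] fun _ => 0 := by
      filter_upwards [Lp.coeFn_zero (Rd d) 2 (vol Ω)] with x hx
      rw [hx]
      simp
    simp only [WithLp.zero_fst, WithLp.zero_snd]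
    rw [integral_congr_ae h1, integral_congr_ae h2]
    simp
  add_mem' := by
    intro p q hp hq φ y
    have h1 : (fun x => fderiv ℝ φ x y * (p.fst + q.fst) x) =ᵐ[vol Ω]
        fun x => fderiv ℝ φ x y * p.fst x + fderiv ℝ φ x y * q.fst x := by
      filter_upwards [Lp.coeFn_add p.fst q.fst] with x hx
      rw [hx]
      simp [mul_add]
    have h2 : (fun x => φ x * inner ℝ ((p.snd + q.snd) x) y) =ᵐ[vol Ω]
        fun x => φ x * inner ℝ (p.snd x) y + φ x * inner ℝ (q.snd x) y := by
      filter_upwards [Lp.coeFn_add p.snd q.snd] with x hx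
      rw [hx]
      simp [mul_add, inner_add_left]
    simp only [WithLp.add_fst, WithLp.add_snd]
    rw [integral_congr_ae h1, integral_congr_ae h2, integral_add, integral_add, hp φ y, hq φ y]
    · ring
    · exact integrable_test_smul φ one_le_two ((Lp.memLp p.snd).inner_const y)
    · exact integrable_test_smul φ one_le_two ((Lp.memLp q.snd).inner_const y)
    · exact integrable_fderiv_test_smul φ y one_le_two (Lp.memLp p.fst)
    · exact integrable_fderiv_test_smul φ y one_le_two (Lp.memLp q.fst)
  smul_mem' := by
    intro c p hp φ y
    have h1 : (fun x => fderiv ℝ φ x y * (c • p.fst) x) =ᵐ[vol Ω]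
        fun x => c * (fderiv ℝ φ x y * p.fst x) := by
      filter_upwards [Lp.coeFn_smul c p.fst] with x hx
      simp only [hx, Pi.smul_apply, smul_eq_mul]
      ring
    have h2 : (fun x => φ x * inner ℝ ((c • p.snd) x) y) =ᵐ[vol Ω]
        fun x => c * (φ x * inner ℝ (p.snd x) y) := by
      filter_upwards [Lp.coeFn_smul c p.snd] with x hx
      simp only [hx, Pi.smul_apply, real_inner_smul_left]
      ring
    simp only [WithLp.smul_fst, WithLp.smul_snd]
    rw [integral_congr_ae h1, integral_congr_ae h2, integral_const_mul, integral_const_mul, hp φ y]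
    ring

/-- The pairs `(φ, ∇φ)` with `φ ∈ C_c^∞(Ω)`. -/
def testPairs (Ω : TopologicalSpace.Opens (Rd d)) : Set (WithLp 2 (L2 Ω × L2vec Ω)) :=
  {p | ∃ φ : 𝓓(Ω, ℝ), p.fst =ᵐ[vol Ω] φ ∧ p.snd =ᵐ[vol Ω] gradient φ}

/-- The subspace `H¹₀(Ω)` of `H¹(Ω)`: the closure of `C_c^∞(Ω)` in `H¹(Ω)`. -/
def H10sub (Ω : TopologicalSpace.Opens (Rd d)) : Submodule ℝ (WithLp 2 (L2 Ω × L2vec Ω)) :=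
  H1 Ω ⊓ (Submodule.span ℝ (testPairs Ω)).topologicalClosure

/-- The Sobolev space `H¹₀(Ω)`, with the norm of `H¹(Ω)`. -/
def H10 (Ω : TopologicalSpace.Opens (Rd d)) : Type := H10sub Ω

instance (Ω : TopologicalSpace.Opens (Rd d)) : NormedAddCommGroup (H10 Ω) :=
  inferInstanceAs (NormedAddCommGroup (H10sub Ω))

instance (Ω : TopologicalSpace.Opens (Rd d)) : InnerProductSpace ℝ (H10 Ω) :=
  inferInstanceAs (InnerProductSpace ℝ (H10sub Ω))

/-- The inclusion of `H¹₀(Ω)` into `L₂(Ω) × L₂(Ω)ᵈ`, `v ↦ (v, ∇v)`. -/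
def H10incl (Ω : TopologicalSpace.Opens (Rd d)) : H10 Ω →L[ℝ] WithLp 2 (L2 Ω × L2vec Ω) :=
  (H10sub Ω).subtypeL

/-- The inclusion `H¹₀(Ω) → L₂(Ω)`. -/
def toL2 (Ω : TopologicalSpace.Opens (Rd d)) : H10 Ω →L[ℝ] L2 Ω :=
  WithLp.fstL 2 ℝ (L2 Ω) (L2vec Ω) ∘L H10incl Ω

/-- The gradient `∇ : H¹₀(Ω) → L₂(Ω)ᵈ`. -/
def grad (Ω : TopologicalSpace.Opens (Rd d)) : H10 Ω →L[ℝ] L2vec Ω :=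
  WithLp.sndL 2 ℝ (L2 Ω) (L2vec Ω) ∘L H10incl Ω

/-- The space `H⁻¹(Ω)`, the dual of `H¹₀(Ω)`. -/
abbrev Hneg1 (Ω : TopologicalSpace.Opens (Rd d)) : Type := StrongDual ℝ (H10 Ω)

/-- The pairs `(F, DF)` of a bounded vector field on `Ω` and its bounded weak Jacobian. -/
def W1infSub (Ω : TopologicalSpace.Opens (Rd d)) : Submodule ℝ (LinfVec Ω × LinfMat Ω) where
  carrier := {p | HasWeakJacobian Ω p.1 p.2}
  zero_mem' := by
    intro φ y
    have h1 : (fun x => fderiv ℝ φ x y • (0 : LinfVec Ω) x) =ᵐ[vol Ω] fun _ => 0 := by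
      filter_upwards [Lp.coeFn_zero (Rd d) ∞ (vol Ω)] with x hx
      rw [hx]
      simp
    have h2 : (fun x => φ x • (0 : LinfMat Ω) x y) =ᵐ[vol Ω] fun _ => 0 := by
      filter_upwards [Lp.coeFn_zero (Rd d →L[ℝ] Rd d) ∞ (vol Ω)] with x hx
      rw [hx]
      simp
    simp only [Prod.fst_zero, Prod.snd_zero]
    rw [integral_congr_ae h1, integral_congr_ae h2]
    simp
  add_mem' := by
    intro p q hp hq φ y
    have h1 : (fun x => fderiv ℝ φ x y • (p.1 + q.1) x) =ᵐ[vol Ω]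
        fun x => fderiv ℝ φ x y • p.1 x + fderiv ℝ φ x y • q.1 x := by
      filter_upwards [Lp.coeFn_add p.1 q.1] with x hx
      rw [hx]
      simp
    have h2 : (fun x => φ x • (p.2 + q.2) x y) =ᵐ[vol Ω]
        fun x => φ x • p.2 x y + φ x • q.2 x y := by
      filter_upwards [Lp.coeFn_add p.2 q.2] with x hx
      rw [hx]
      simp
    simp only [Prod.fst_add, Prod.snd_add]
    rw [integral_congr_ae h1, integral_congr_ae h2, integral_add, integral_add, hp φ y, hq φ y]
    · abel
    · exact integrable_test_smul φ le_top
        ((ContinuousLinearMap.apply ℝ (Rd d) y).comp_memLp' (Lp.memLp p.2))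
    · exact integrable_test_smul φ le_top
        ((ContinuousLinearMap.apply ℝ (Rd d) y).comp_memLp' (Lp.memLp q.2))
    · exact integrable_fderiv_test_smul φ y le_top (Lp.memLp p.1)
    · exact integrable_fderiv_test_smul φ y le_top (Lp.memLp q.1)
  smul_mem' := by
    intro c p hp φ y
    have h1 : (fun x => fderiv ℝ φ x y • (c • p.1) x) =ᵐ[vol Ω]
        fun x => c • (fderiv ℝ φ x y • p.1 x) := by
      filter_upwards [Lp.coeFn_smul c p.1] with x hx
      simp only [hx, Pi.smul_apply]
      rw [smul_comm]
    have h2 : (fun x => φ x • (c • p.2) x y) =ᵐ[vol Ω] fun x => c • (φ x • p.2 x y) := by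
      filter_upwards [Lp.coeFn_smul c p.2] with x hx
      simp only [hx, Pi.smul_apply, smul_apply]
      rw [smul_comm]
    simp only [Prod.smul_fst, Prod.smul_snd]
    rw [integral_congr_ae h1, integral_congr_ae h2, integral_smul, integral_smul, hp φ y, smul_neg]

/-- The Sobolev space `W¹_∞(Ω)ᵈ` of bounded vector fields `F` with a bounded weak Jacobian `DF`; its
norm is the maximum of the `L∞` norms of `F` and `DF`. -/
def W1inf (Ω : TopologicalSpace.Opens (Rd d)) : Type := W1infSub Ω

instance (Ω : TopologicalSpace.Opens (Rd d)) : NormedAddCommGroup (W1inf Ω) :=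
  inferInstanceAs (NormedAddCommGroup (W1infSub Ω))

instance (Ω : TopologicalSpace.Opens (Rd d)) : NormedSpace ℝ (W1inf Ω) :=
  inferInstanceAs (NormedSpace ℝ (W1infSub Ω))

/-- The inclusion `W¹_∞(Ω)ᵈ → L∞(Ω)ᵈ`. -/
def toLinf (Ω : TopologicalSpace.Opens (Rd d)) : W1inf Ω →L[ℝ] LinfVec Ω :=
  ContinuousLinearMap.fst ℝ (LinfVec Ω) (LinfMat Ω) ∘L (W1infSub Ω).subtypeL

/-! ### Pointwise products and `L₂` pairings -/

/-- Multiplication `L₂(Ω)ᵈ → L₂(Ω)ᵈ` by a matrix-valued function, `(κ ξ)(x) = κ(x) ξ(x)`. -/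
def mulMat {Ω : TopologicalSpace.Opens (Rd d)} (κ : LinfMat Ω) : L2vec Ω →L[ℝ] L2vec Ω :=
  (ContinuousLinearMap.id ℝ (Rd d →L[ℝ] Rd d)).holderL (vol Ω) ∞ 2 2 κ

/-- Multiplication `L₂(Ω) → L₂(Ω)ᵈ` by a vector field, `(F v)(x) = v(x) F(x)`. -/
def mulVec {Ω : TopologicalSpace.Opens (Rd d)} (F : LinfVec Ω) : L2 Ω →L[ℝ] L2vec Ω :=
  (ContinuousLinearMap.lsmul ℝ ℝ : ℝ →L[ℝ] Rd d →L[ℝ] Rd d).flip.holderL (vol Ω) ∞ 2 2 F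

/-- Multiplication `L₂(Ω) → L₂(Ω)` by a scalar function, `(a v)(x) = a(x) v(x)`. -/
def mulScal {Ω : TopologicalSpace.Opens (Rd d)} (a : Linf Ω) : L2 Ω →L[ℝ] L2 Ω :=
  (ContinuousLinearMap.mul ℝ ℝ).holderL (vol Ω) ∞ 2 2 a

/-- The embedding `L₂(Ω) → H⁻¹(Ω)`, `v ↦ (w ↦ ⟨v, w⟩)`. -/
def pairL2 (Ω : TopologicalSpace.Opens (Rd d)) : L2 Ω →L[ℝ] Hneg1 Ω :=
  LinearMap.mkContinuous₂ ((innerₗ (L2 Ω)).compl₂ (toL2 Ω).toLinearMap) ‖toL2 Ω‖ (by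
    intro v w
    have h1 : ‖inner ℝ v (toL2 Ω w)‖ ≤ ‖v‖ * ‖toL2 Ω w‖ := norm_inner_le_norm _ _
    have h2 : ‖v‖ * ‖toL2 Ω w‖ ≤ ‖v‖ * (‖toL2 Ω‖ * ‖w‖) :=
      mul_le_mul_of_nonneg_left ((toL2 Ω).le_opNorm w) (norm_nonneg v)
    calc _ ≤ _ := h1.trans h2
      _ = _ := by ring)

/-- The map `L₂(Ω)ᵈ → H⁻¹(Ω)`, `ξ ↦ (w ↦ ⟨ξ, ∇w⟩)`. -/
def pairGrad (Ω : TopologicalSpace.Opens (Rd d)) : L2vec Ω →L[ℝ] Hneg1 Ω :=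
  LinearMap.mkContinuous₂ ((innerₗ (L2vec Ω)).compl₂ (grad Ω).toLinearMap) ‖grad Ω‖ (by
    intro v w
    have h1 : ‖inner ℝ v (grad Ω w)‖ ≤ ‖v‖ * ‖grad Ω w‖ := norm_inner_le_norm _ _
    have h2 : ‖v‖ * ‖grad Ω w‖ ≤ ‖v‖ * (‖grad Ω‖ * ‖w‖) :=
      mul_le_mul_of_nonneg_left ((grad Ω).le_opNorm w) (norm_nonneg v)
    calc _ ≤ _ := h1.trans h2
      _ = _ := by ring)

/-! ### The coefficients -/

/-- The coefficients of the equation: the diffusivity `κ = κ(x)` and the time-dependent `F`, `G`,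
`a`, `b`. Only the values at times `t ∈ [0,T]` matter. -/
structure Coefficients (Ω : TopologicalSpace.Opens (Rd d)) where
  /-- The generalized diffusivity. -/
  κ : LinfMat Ω
  /-- The vector field multiplying the fractional derivative. -/
  F : ℝ → W1inf Ω
  /-- The vector field multiplying `u`. -/
  G : ℝ → W1inf Ω
  /-- The reaction coefficient of the fractional derivative. -/
  a : ℝ → Linf Ω
  /-- The reaction coefficient of `u`. -/
  b : ℝ → Linf Ω

namespace Coefficients

variable {Ω : TopologicalSpace.Opens (Rd d)}

/-- `F, G ∈ C²([0,T]; W¹_∞(Ω)ᵈ)` and `a, b ∈ C¹([0,T]; L∞(Ω))`. -/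
structure Regular (c : Coefficients Ω) (T : ℝ) : Prop where
  F_mem : ContDiffOn ℝ 2 c.F (Icc 0 T)
  G_mem : ContDiffOn ℝ 2 c.G (Icc 0 T)
  a_mem : ContDiffOn ℝ 1 c.a (Icc 0 T)
  b_mem : ContDiffOn ℝ 1 c.b (Icc 0 T)

/-- `κ(x)` is symmetric, with all its eigenvalues bounded away from zero uniformly in `x ∈ Ω`. -/
def Elliptic (c : Coefficients Ω) : Prop :=
  ∃ c₀ : ℝ, 0 < c₀ ∧ ∀ᵐ x ∂(vol Ω),
    (c.κ x : Rd d →ₗ[ℝ] Rd d).IsSymmetric ∧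
      ∀ lam : ℝ, Module.End.HasEigenvalue (c.κ x : Rd d →ₗ[ℝ] Rd d) lam → c₀ ≤ lam

/-- `⟨K₁(t)v, w⟩ = ⟨κ∇v, ∇w⟩ - ⟨F(t)v, ∇w⟩ + ⟨a(t)v, w⟩`. -/
def K₁ (c : Coefficients Ω) (t : ℝ) : H10 Ω →L[ℝ] Hneg1 Ω :=
  pairGrad Ω ∘L mulMat c.κ ∘L grad Ω - pairGrad Ω ∘L mulVec (toLinf Ω (c.F t)) ∘L toL2 Ω
    + pairL2 Ω ∘L mulScal (c.a t) ∘L toL2 Ω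

/-- `⟨K₂(t)v, w⟩ = ⟨b(t)v, w⟩ - ⟨G(t)v, ∇w⟩`. -/
def K₂ (c : Coefficients Ω) (t : ℝ) : L2 Ω →L[ℝ] Hneg1 Ω :=
  pairL2 Ω ∘L mulScal (c.b t) - pairGrad Ω ∘L mulVec (toLinf Ω (c.G t))

/-- `⟨K₁'(t)v, w⟩ = - ⟨F'(t)v, ∇w⟩ + ⟨a'(t)v, w⟩`, with one-sided time derivatives at the end
points of `[0,T]`. -/
def K₁' (c : Coefficients Ω) (T t : ℝ) : H10 Ω →L[ℝ] Hneg1 Ω :=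
  -(pairGrad Ω ∘L mulVec (toLinf Ω (derivWithin c.F (Icc 0 T) t)) ∘L toL2 Ω)
    + pairL2 Ω ∘L mulScal (derivWithin c.a (Icc 0 T) t) ∘L toL2 Ω

end Coefficients

/-- `ω_α(t) = t^{α-1} / Γ(α)`. -/
def omega (α t : ℝ) : ℝ := t ^ (α - 1) / Real.Gamma α

/-- The kernel `K(t,s) = ω_α(t-s) K₁(t) + K₂(s) - ∫_s^t ω_α(z-s) K₁'(z) dz`, for
`0 ≤ s ≤ t ≤ T`. -/
def Coefficients.K {Ω : TopologicalSpace.Opens (Rd d)} (c : Coefficients Ω) (T α t s : ℝ) :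
    H10 Ω →L[ℝ] Hneg1 Ω :=
  omega α (t - s) • c.K₁ t + c.K₂ s ∘L toL2 Ω - ∫ z in s..t, omega α (z - s) • c.K₁' T z

/-- `f(t) = u₀ + ∫₀ᵗ g(s) ds`. -/
def source {Ω : TopologicalSpace.Opens (Rd d)} (u₀ : L2 Ω) (g : ℝ → L2 Ω) (t : ℝ) : L2 Ω :=
  u₀ + ∫ s in (0 : ℝ)..t, g s

/-! ### The projected equation -/

variable {Ω : TopologicalSpace.Opens (Rd d)}

theorem eq_zero_of_toL2_eq_zero (v : H10 Ω) (hv : toL2 Ω v = 0) : v = 0 := by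
  have hfst : (H10incl Ω v).fst = 0 := hv
  have hw : HasWeakGradient Ω (H10incl Ω v).fst
      (H10incl Ω v).snd := v.2.1
  rw [hfst] at hw
  have hcomp : ∀ y : Rd d, ∀ᵐ x ∂(vol Ω),
      inner ℝ ((H10incl Ω v).snd x) y = 0 := by
    intro y
    have hmem := (Lp.memLp (H10incl Ω v).snd).inner_const (𝕜 := ℝ) y
    have hae := Ω.isOpen.ae_eq_zero_of_integral_contDiff_smul_eq_zero
      ((hmem.locallyIntegrable one_le_two).locallyIntegrableOn _) (by
        intro φ h1 h2 h3
        have h := hw ⟨φ, h1, h2, h3⟩ y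
        have h0 : (fun x => fderiv ℝ φ x y * (0 : L2 Ω) x) =ᵐ[vol Ω] fun _ => 0 := by
          filter_upwards [Lp.coeFn_zero ℝ 2 (vol Ω)] with x hx
          rw [hx]
          simp
        have h' := (integral_congr_ae h0).symm.trans h
        simpa using h')
    filter_upwards [hae, ae_restrict_mem Ω.isOpen.measurableSet] with x hx hx'
    exact hx hx'
  have hsnd : (H10incl Ω v).snd = 0 := by
    rw [Lp.eq_zero_iff_ae_eq_zero]
    have hall := ae_all_iff.2 fun i : Fin d => hcomp (EuclideanSpace.single i 1)
    filter_upwards [hall] with x hx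
    ext i
    have hi := hx i
    rw [EuclideanSpace.inner_single_right] at hi
    simpa using hi
  apply Subtype.ext
  apply (WithLp.ofLp_injective 2)
  exact Prod.ext hfst hsnd

/-- The `L₂(Ω)` inner product on a subspace `X` of `H¹₀(Ω)`. -/
def l2Form (X : Submodule ℝ (H10 Ω)) : LinearMap.BilinForm ℝ X :=
  (innerₗ (L2 Ω)).compl₁₂ ((toL2 Ω).toLinearMap ∘ₗ X.subtype)
    ((toL2 Ω).toLinearMap ∘ₗ X.subtype)

theorem l2Form_nondegenerate (X : Submodule ℝ (H10 Ω)) : (l2Form X).Nondegenerate := by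
  have key : ∀ v : X, l2Form X v v = 0 → v = 0 := fun v hv =>
    Subtype.ext (eq_zero_of_toL2_eq_zero _ (inner_self_eq_zero.1 hv))
  exact ⟨fun v hv => key v (hv v), fun v hv => key v (hv v)⟩

/-- For a functional `ℓ ∈ H⁻¹(Ω)`, the unique element `P_X ℓ` of the finite-dimensional space
`X ⊆ H¹₀(Ω)` with `⟨P_X ℓ, w⟩ = ℓ(w)` for all `w ∈ X`, where `⟨·, ·⟩` is the inner product
of `L₂(Ω)`. -/
def proj (X : Submodule ℝ (H10 Ω)) [FiniteDimensional ℝ X] : Hneg1 Ω →ₗ[ℝ] X where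
  toFun ℓ := ((l2Form X).toDual (l2Form_nondegenerate X)).symm (ℓ.toLinearMap ∘ₗ X.subtype)
  map_add' ℓ₁ ℓ₂ := by
    rw [← map_add]
    rfl
  map_smul' r ℓ := by
    rw [RingHom.id_apply, ← map_smul]
    rfl

theorem inner_proj (X : Submodule ℝ (H10 Ω)) [FiniteDimensional ℝ X] (ℓ : Hneg1 Ω) (w : X) :
    inner ℝ (toL2 Ω (proj X ℓ)) (toL2 Ω w) = ℓ w :=
  LinearMap.BilinForm.apply_toDual_symm_apply (B := l2Form X) (hB := l2Form_nondegenerate X)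
    (ℓ.toLinearMap ∘ₗ X.subtype) w

/-- The operator `K_X(t,s) : X → X` with `⟨K_X(t,s)v, w⟩ = ⟨K(t,s)v, w⟩` for `v, w ∈ X`. -/
def KX (c : Coefficients Ω) (T α : ℝ) (X : Submodule ℝ (H10 Ω)) [FiniteDimensional ℝ X]
    (t s : ℝ) : X →ₗ[ℝ] X :=
  proj X ∘ₗ (c.K T α t s).toLinearMap ∘ₗ X.subtype

/-- The `L₂` projection `f_X(t) ∈ X` of `f(t)`: `⟨f_X(t), w⟩ = ⟨f(t), w⟩` for `w ∈ X`. -/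
def fX (u₀ : L2 Ω) (g : ℝ → L2 Ω) (X : Submodule ℝ (H10 Ω)) [FiniteDimensional ℝ X]
    (t : ℝ) : X :=
  proj X (pairL2 Ω (source u₀ g t))

/-- `u ∈ C([0,T]; X)` solves the projected Volterra equation
`u(t) + ∫₀ᵗ K_X(t,s) u(s) ds = f_X(t)` for `0 ≤ t ≤ T`. -/
structure IsGalerkinSolution (c : Coefficients Ω) (T α : ℝ) (u₀ : L2 Ω) (g : ℝ → L2 Ω)
    (X : Submodule ℝ (H10 Ω)) [FiniteDimensional ℝ X] (u : ℝ → X) : Prop where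
  continuousOn : ContinuousOn u (Icc 0 T)
  equation : ∀ t ∈ Icc 0 T, u t + ∫ s in (0 : ℝ)..t, KX c T α X t s (u s) = fX u₀ g X t

end FracADR

end

noncomputable section

namespace FracADR

section

/-! ### Power kernels -/

theorem integral_rpow_mul_rpow {p q t : ℝ} (hp : 0 < p) (hq : 0 < q) (ht : 0 < t) :
    ∫ s in (0 : ℝ)..t, (t - s) ^ (p - 1) * s ^ (q - 1)
      = t ^ (p + q - 1) * ProbabilityTheory.beta p q := by
  have h := Complex.betaIntegral_scaled (q : ℂ) (p : ℂ) ht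
  rw [Complex.betaIntegral_symm] at h
  have h1 : ∫ x in (0 : ℝ)..t, (x : ℂ) ^ ((q : ℂ) - 1) * ((t : ℂ) - x) ^ ((p : ℂ) - 1)
      = ((∫ s in (0 : ℝ)..t, (t - s) ^ (p - 1) * s ^ (q - 1) : ℝ) : ℂ) := by
    rw [← intervalIntegral.integral_ofReal]
    apply intervalIntegral.integral_congr
    intro x hx
    rw [uIcc_of_le ht.le] at hx
    simp only
    rw [Complex.ofReal_mul, Complex.ofReal_cpow (sub_nonneg.2 hx.2), Complex.ofReal_cpow hx.1]
    push_cast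
    ring
  rw [h1] at h
  have h2 := congrArg Complex.re h
  rw [Complex.ofReal_re] at h2
  rw [h2, ProbabilityTheory.beta_eq_betaIntegralReal p q hp hq, add_comm p q,
    show ((q : ℂ) + p - 1) = ((q + p - 1 : ℝ) : ℂ) by push_cast; ring,
    ← Complex.ofReal_cpow ht.le, Complex.re_ofReal_mul]

theorem intervalIntegrable_rpow_mul_rpow {p q t : ℝ} (hp : 0 < p) (hq : 0 < q) (ht : 0 ≤ t) :
    IntervalIntegrable (fun s => (t - s) ^ (p - 1) * s ^ (q - 1)) volume 0 t := by
  rcases ht.eq_or_lt with rfl | ht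
  · exact IntervalIntegrable.refl
  · apply intervalIntegral.intervalIntegrable_of_integral_ne_zero
    rw [integral_rpow_mul_rpow hp hq ht]
    exact (mul_pos (Real.rpow_pos_of_pos ht _) (ProbabilityTheory.beta_pos hp hq)).ne'

theorem intervalIntegrable_rpow_sub_one {p : ℝ} (hp : 0 < p) (a b : ℝ) :
    IntervalIntegrable (fun s : ℝ => s ^ (p - 1)) volume a b :=
  intervalIntegral.intervalIntegrable_rpow' (by linarith)

theorem intervalIntegrable_sub_rpow_sub_one {p : ℝ} (hp : 0 < p) (t a b : ℝ) :
    IntervalIntegrable (fun s : ℝ => (t - s) ^ (p - 1)) volume a b := by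
  have := (intervalIntegrable_rpow_sub_one hp (t - a) (t - b)).comp_sub_left t
  simpa using this

theorem integral_sub_rpow_sub_one {p : ℝ} (hp : 0 < p) (a t : ℝ) :
    ∫ s in a..t, (t - s) ^ (p - 1) = (t - a) ^ p / p := by
  rw [intervalIntegral.integral_comp_sub_left (fun x => x ^ (p - 1)), sub_self,
    integral_rpow (Or.inl (by linarith))]
  simp [Real.zero_rpow hp.ne']

theorem omega_nonneg {α t : ℝ} (hα : 0 < α) (ht : 0 ≤ t) : 0 ≤ omega α t :=
  div_nonneg (Real.rpow_nonneg ht _) (Real.Gamma_pos_of_pos hα).le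

theorem omega_pos {α t : ℝ} (hα : 0 < α) (ht : 0 < t) : 0 < omega α t :=
  div_pos (Real.rpow_pos_of_pos ht _) (Real.Gamma_pos_of_pos hα)

theorem intervalIntegrable_omega {α : ℝ} (hα : 0 < α) (a b : ℝ) :
    IntervalIntegrable (omega α) volume a b :=
  (intervalIntegrable_rpow_sub_one hα a b).div_const _

/-! ### Fubini on a triangle -/

/-- The measure `dr ds` on the square `(0,t]²`. -/
abbrev sqMeasure (t : ℝ) : Measure (ℝ × ℝ) :=
  (volume.restrict (Ioc 0 t)).prod (volume.restrict (Ioc 0 t))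

/-- The triangle `r < s` in the plane of points `(s, r)`. -/
def tri : Set (ℝ × ℝ) := {x | x.2 < x.1}

theorem measurableSet_tri : MeasurableSet tri := measurableSet_lt measurable_snd measurable_fst

section Triangle

variable {E : Type*} [NormedAddCommGroup E] [NormedSpace ℝ E] {F : ℝ → ℝ → E} {t : ℝ}

theorem setIntegral_tri_fst {s : ℝ} (hs : s ∈ Ioc 0 t) :
    ∫ r in Ioc 0 t, tri.indicator (Function.uncurry F) (s, r) = ∫ r in (0 : ℝ)..s, F s r := by
  have h : (fun r => tri.indicator (Function.uncurry F) (s, r)) =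
      (Iio s).indicator (fun r => F s r) := by
    ext r
    by_cases hr : r < s <;> simp [tri, hr]
  rw [h, setIntegral_indicator measurableSet_Iio, intervalIntegral.integral_of_le hs.1.le,
    integral_Ioc_eq_integral_Ioo (y := s)]
  congr 2
  ext r
  simp only [mem_inter_iff, mem_Ioc, mem_Iio, mem_Ioo]
  exact ⟨fun h => ⟨h.1.1, h.2⟩, fun h => ⟨⟨h.1, h.2.le.trans hs.2⟩, h.2⟩⟩

theorem setIntegral_tri_snd {r : ℝ} (hr : r ∈ Ioc 0 t) :
    ∫ s in Ioc 0 t, tri.indicator (Function.uncurry F) (s, r) = ∫ s in r..t, F s r := by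
  have h : (fun s => tri.indicator (Function.uncurry F) (s, r)) =
      (Ioi r).indicator (fun s => F s r) := by
    ext s
    by_cases hs : r < s <;> simp [tri, hs]
  rw [h, setIntegral_indicator measurableSet_Ioi, intervalIntegral.integral_of_le hr.2]
  congr 2
  ext s
  simp only [mem_inter_iff, mem_Ioc, mem_Ioi]
  exact ⟨fun h => ⟨h.2, h.1.2⟩, fun h => ⟨⟨hr.1.trans h.1, h.2⟩, h.1⟩⟩

theorem intervalIntegrable_tri_fst (ht : 0 ≤ t)
    (hF : Integrable (tri.indicator (Function.uncurry F)) (sqMeasure t)) :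
    IntervalIntegrable (fun s => ∫ r in (0 : ℝ)..s, F s r) volume 0 t := by
  rw [intervalIntegrable_iff_integrableOn_Ioc_of_le ht]
  refine hF.integral_prod_left.congr ?_
  filter_upwards [ae_restrict_mem measurableSet_Ioc] with s hs
  exact setIntegral_tri_fst hs

theorem intervalIntegrable_tri_snd (ht : 0 ≤ t)
    (hF : Integrable (tri.indicator (Function.uncurry F)) (sqMeasure t)) :
    IntervalIntegrable (fun r => ∫ s in r..t, F s r) volume 0 t := by
  rw [intervalIntegrable_iff_integrableOn_Ioc_of_le ht]
  refine hF.integral_prod_right.congr ?_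
  filter_upwards [ae_restrict_mem measurableSet_Ioc] with s hs
  exact setIntegral_tri_snd hs

theorem integral_tri_swap (ht : 0 ≤ t)
    (hF : Integrable (tri.indicator (Function.uncurry F)) (sqMeasure t)) :
    ∫ s in (0 : ℝ)..t, ∫ r in (0 : ℝ)..s, F s r = ∫ r in (0 : ℝ)..t, ∫ s in r..t, F s r := by
  rw [intervalIntegral.integral_of_le ht, intervalIntegral.integral_of_le ht]
  have h := integral_integral_swap (f := fun s r => tri.indicator (Function.uncurry F) (s, r)) hF
  rw [setIntegral_congr_fun measurableSet_Ioc (fun s hs => setIntegral_tri_fst hs),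
    setIntegral_congr_fun measurableSet_Ioc (fun s hs => setIntegral_tri_snd hs)] at h
  exact h

end Triangle

/-! ### Convolution on the half line -/

/-- The convolution `∫₀ᵗ k(t-s) h(s) ds`. -/
def vconv (k h : ℝ → ℝ) (t : ℝ) : ℝ := ∫ s in (0 : ℝ)..t, k (t - s) * h s

theorem vconv_comm (k h : ℝ → ℝ) (t : ℝ) : vconv k h t = vconv h k t := by
  have := intervalIntegral.integral_comp_sub_left (a := 0) (b := t)
    (fun x => k (t - x) * h x) t
  simp only [sub_sub_cancel, sub_self, sub_zero] at this
  rw [vconv, vconv, ← this]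
  exact intervalIntegral.integral_congr fun s _ => mul_comm _ _

theorem vconv_omega_omega {p q t : ℝ} (hp : 0 < p) (hq : 0 < q) (ht : 0 < t) :
    vconv (omega p) (omega q) t = omega (p + q) t := by
  have h := integral_rpow_mul_rpow hp hq ht
  have : ∀ s, omega p (t - s) * omega q s
      = (Real.Gamma p * Real.Gamma q)⁻¹ * ((t - s) ^ (p - 1) * s ^ (q - 1)) := by
    intro s
    unfold omega
    field_simp
  simp only [vconv, this]
  rw [intervalIntegral.integral_const_mul, h, omega, ProbabilityTheory.beta]
  have h1 := (Real.Gamma_pos_of_pos hp).ne'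
  have h2 := (Real.Gamma_pos_of_pos hq).ne'
  field_simp

theorem vconv_assoc {k₁ k₂ h : ℝ → ℝ} {t : ℝ} (ht : 0 ≤ t)
    (hF : Integrable (tri.indicator (Function.uncurry fun s r => k₁ (t - s) * (k₂ (s - r) * h r)))
      (sqMeasure t)) :
    vconv k₁ (vconv k₂ h) t = vconv (vconv k₁ k₂) h t := by
  have h1 := integral_tri_swap ht hF
  simp only [intervalIntegral.integral_const_mul] at h1
  rw [vconv]
  refine h1.trans ?_
  rw [vconv]
  refine intervalIntegral.integral_congr fun r _ => ?_
  have h2 : ∀ s, k₁ (t - s) * (k₂ (s - r) * h r) = k₁ (t - s) * k₂ (s - r) * h r := fun s => by ring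
  simp only [h2]
  rw [intervalIntegral.integral_mul_const]
  congr 1
  have := intervalIntegral.integral_comp_sub_right (a := r) (b := t)
    (fun x => k₁ (t - r - x) * k₂ x) r
  rw [sub_self] at this
  rw [vconv, ← this]
  refine intervalIntegral.integral_congr fun s _ => ?_
  simp only [sub_sub, add_sub_cancel]

theorem integrable_indicator_Ioc {f : ℝ → ℝ} {t : ℝ} (ht : 0 ≤ t)
    (hf : IntervalIntegrable f volume 0 t) : Integrable ((Ioc 0 t).indicator f) := by
  rw [integrable_indicator_iff measurableSet_Ioc]
  exact (intervalIntegrable_iff_integrableOn_Ioc_of_le ht).1 hf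

theorem intervalIntegrable_comp_sub {f : ℝ → ℝ} {t : ℝ}
    (hf : IntervalIntegrable f volume 0 t) :
    IntervalIntegrable (fun s => f (t - s)) volume 0 t := by
  have := (hf.comp_sub_left t).symm
  simpa using this

/-- `f(s) k(s-r)` is integrable on the triangle. -/
theorem integrable_tri_left {f k : ℝ → ℝ} {t : ℝ} (ht : 0 ≤ t)
    (hf : IntervalIntegrable f volume 0 t) (hk : IntervalIntegrable k volume 0 t) :
    Integrable (tri.indicator (Function.uncurry fun s r => f s * k (s - r))) (sqMeasure t) := by
  set k₀ := (Ioc 0 t).indicator k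
  have hk₀ : Integrable k₀ := integrable_indicator_Ioc ht hk
  have hf' : Integrable f (volume.restrict (Ioc 0 t)) :=
    (intervalIntegrable_iff_integrableOn_Ioc_of_le ht).1 hf
  have hmeas : AEStronglyMeasurable (fun x : ℝ × ℝ => f x.1 * k₀ (x.1 - x.2))
      ((volume.restrict (Ioc 0 t)).prod volume) := by
    refine hf'.aestronglyMeasurable.comp_fst.mul ?_
    have h := hk₀.aestronglyMeasurable.comp_quasiMeasurePreserving
      (quasiMeasurePreserving_sub_of_right_invariant (volume : Measure ℝ) volume)
    refine h.mono_ac (Measure.AbsolutelyContinuous.prod Measure.absolutelyContinuous_restrict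
      Measure.AbsolutelyContinuous.rfl)
  have hint : Integrable (fun x : ℝ × ℝ => f x.1 * k₀ (x.1 - x.2))
      ((volume.restrict (Ioc 0 t)).prod volume) := by
    rw [integrable_prod_iff hmeas]
    refine ⟨Filter.Eventually.of_forall fun s => (hk₀.comp_sub_left s).const_mul (f s), ?_⟩
    have : ∀ s, ∫ r, ‖f s * k₀ (s - r)‖ = ‖f s‖ * ∫ r, ‖k₀ r‖ := by
      intro s
      simp only [norm_mul]
      rw [integral_const_mul, integral_sub_left_eq_self (fun x => ‖k₀ x‖)]
    simp only [this]
    exact hf'.norm.mul_const _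
  have hint' : Integrable (fun x : ℝ × ℝ => f x.1 * k₀ (x.1 - x.2)) (sqMeasure t) :=
    hint.mono_measure (Measure.prod_mono le_rfl Measure.restrict_le_self)
  refine (hint'.indicator measurableSet_tri).congr ?_
  rw [Filter.EventuallyEq, sqMeasure, Measure.prod_restrict]
  filter_upwards [ae_restrict_mem (measurableSet_Ioc.prod measurableSet_Ioc)] with x hx
  by_cases hxt : x ∈ tri
  · rw [indicator_of_mem hxt, indicator_of_mem hxt]
    have : x.1 - x.2 ∈ Ioc 0 t := ⟨sub_pos.2 hxt, by linarith [hx.1.2, hx.2.1]⟩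
    simp [Function.uncurry, k₀, indicator_of_mem this]
  · rw [indicator_of_notMem hxt, indicator_of_notMem hxt]

/-- `k(s-r) h(r)` is integrable on the triangle. -/
theorem integrable_tri_right {h k : ℝ → ℝ} {t : ℝ} (ht : 0 ≤ t)
    (hh : IntervalIntegrable h volume 0 t) (hk : IntervalIntegrable k volume 0 t) :
    Integrable (tri.indicator (Function.uncurry fun s r => k (s - r) * h r)) (sqMeasure t) := by
  set k₀ := (Ioc 0 t).indicator k
  have hk₀ : Integrable k₀ := integrable_indicator_Ioc ht hk
  have hh' : Integrable h (volume.restrict (Ioc 0 t)) :=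
    (intervalIntegrable_iff_integrableOn_Ioc_of_le ht).1 hh
  have hint := hh'.convolution_integrand (ContinuousLinearMap.mul ℝ ℝ).flip hk₀
  have hint' : Integrable (fun x : ℝ × ℝ => k₀ (x.1 - x.2) * h x.2) (sqMeasure t) :=
    hint.mono_measure (Measure.prod_mono Measure.restrict_le_self le_rfl)
  refine (hint'.indicator measurableSet_tri).congr ?_
  rw [Filter.EventuallyEq, sqMeasure, Measure.prod_restrict]
  filter_upwards [ae_restrict_mem (measurableSet_Ioc.prod measurableSet_Ioc)] with x hx
  by_cases hxt : x ∈ tri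
  · rw [indicator_of_mem hxt, indicator_of_mem hxt]
    have : x.1 - x.2 ∈ Ioc 0 t := ⟨sub_pos.2 hxt, by linarith [hx.1.2, hx.2.1]⟩
    simp [Function.uncurry, k₀, indicator_of_mem this]
  · rw [indicator_of_notMem hxt, indicator_of_notMem hxt]

/-- A bounded measurable factor preserves integrability on the triangle. -/
theorem integrable_tri_bdd_mul {f g : ℝ → ℝ → ℝ} {t : ℝ} {C : ℝ}
    (hg : Integrable (tri.indicator (Function.uncurry g)) (sqMeasure t))
    (hf : AEStronglyMeasurable (Function.uncurry f) (sqMeasure t))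
    (hC : ∀ s r, 0 < r → r < s → s ≤ t → |f s r| ≤ C) :
    Integrable (tri.indicator (Function.uncurry fun s r => f s r * g s r)) (sqMeasure t) := by
  have h : (tri.indicator (Function.uncurry fun s r => f s r * g s r))
      = fun x => tri.indicator (Function.uncurry f) x * tri.indicator (Function.uncurry g) x := by
    ext x
    by_cases hx : x ∈ tri <;> simp [hx, Function.uncurry]
  rw [h]
  refine hg.bdd_mul (c := max C 0) (hf.indicator measurableSet_tri) ?_
  rw [sqMeasure, Measure.prod_restrict]
  filter_upwards [ae_restrict_mem (measurableSet_Ioc.prod measurableSet_Ioc)] with x hx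
  by_cases hxt : x ∈ tri
  · rw [indicator_of_mem hxt]
    exact (hC x.1 x.2 hx.2.1 hxt hx.1.2).trans (le_max_left _ _)
  · simp [indicator_of_notMem hxt]

theorem aestronglyMeasurable_of_intervalIntegrable {f : ℝ → ℝ} {t : ℝ} (ht : 0 ≤ t)
    (hf : IntervalIntegrable f volume 0 t) :
    AEStronglyMeasurable f (volume.restrict (Ioc 0 t)) :=
  ((intervalIntegrable_iff_integrableOn_Ioc_of_le ht).1 hf).aestronglyMeasurable

theorem vconv_assoc_of_bdd_right {k₁ k₂ h : ℝ → ℝ} {t C : ℝ} (ht : 0 ≤ t)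
    (h₁ : IntervalIntegrable k₁ volume 0 t) (h₂ : IntervalIntegrable k₂ volume 0 t)
    (hh : IntervalIntegrable h volume 0 t) (hC : ∀ s ∈ Ioc 0 t, |h s| ≤ C) :
    vconv k₁ (vconv k₂ h) t = vconv (vconv k₁ k₂) h t := by
  refine vconv_assoc ht ?_
  have := integrable_tri_bdd_mul (f := fun _ r => h r) (C := C)
    (integrable_tri_left ht (intervalIntegrable_comp_sub h₁) h₂)
    (aestronglyMeasurable_of_intervalIntegrable ht hh).comp_snd
    (fun s r h1 h2 h3 => hC r ⟨h1, h2.le.trans h3⟩)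
  convert this using 5
  ring

theorem vconv_assoc_one {k₁ h : ℝ → ℝ} {t : ℝ} (ht : 0 ≤ t)
    (h₁ : IntervalIntegrable k₁ volume 0 t) (hh : IntervalIntegrable h volume 0 t) :
    vconv k₁ (vconv (fun _ => 1) h) t = vconv (vconv k₁ (fun _ => 1)) h t := by
  refine vconv_assoc ht ?_
  have h1 := (intervalIntegrable_iff_integrableOn_Ioc_of_le ht).1 (intervalIntegrable_comp_sub h₁)
  have h2 := (intervalIntegrable_iff_integrableOn_Ioc_of_le ht).1 hh
  have := (Integrable.mul_prod h1 h2).indicator measurableSet_tri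
  simpa [Function.uncurry_def] using this

theorem vconv_one_assoc {k₂ h : ℝ → ℝ} {t : ℝ} (ht : 0 ≤ t)
    (h₂ : IntervalIntegrable k₂ volume 0 t) (hh : IntervalIntegrable h volume 0 t) :
    vconv (fun _ => 1) (vconv k₂ h) t = vconv (vconv (fun _ => 1) k₂) h t := by
  refine vconv_assoc ht ?_
  simpa using integrable_tri_right ht hh h₂

end

section

/-! ### The Mittag-Leffler function -/

theorem rpow_mul_exp_le_Gamma {R b : ℝ} (hR : 0 < R) (hb : 0 < b) :
    R ^ b * Real.exp (-(R + 1)) ≤ Real.Gamma (b + 1) := by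
  rw [Real.Gamma_eq_integral (by linarith)]
  have hint := Real.GammaIntegral_convergent (s := b + 1) (by linarith)
  have h1 : ∫ x in Ioc R (R + 1), Real.exp (-x) * x ^ (b + 1 - 1)
      ≤ ∫ x in Ioi 0, Real.exp (-x) * x ^ (b + 1 - 1) := by
    refine setIntegral_mono_set hint ?_ ?_
    · filter_upwards [ae_restrict_mem measurableSet_Ioi] with x hx
      exact mul_nonneg (Real.exp_pos _).le (Real.rpow_nonneg (le_of_lt hx) _)
    · exact (show Ioc R (R + 1) ⊆ Ioi 0 from fun x hx => hR.trans hx.1).eventuallyLE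
  refine le_trans ?_ h1
  have h2 : ∫ _ in Ioc R (R + 1), R ^ b * Real.exp (-(R + 1)) = R ^ b * Real.exp (-(R + 1)) := by
    simp
  rw [← h2]
  refine setIntegral_mono_on (integrableOn_const (by simp)) (hint.mono_set fun x hx => hR.trans hx.1)
    measurableSet_Ioc fun x hx => ?_
  rw [add_sub_cancel_right, mul_comm]
  exact mul_le_mul (Real.exp_le_exp.2 (by linarith [hx.2]))
    (Real.rpow_le_rpow hR.le hx.1.le hb.le) (Real.rpow_nonneg hR.le _) (Real.exp_pos _).le

theorem summable_pow_div_Gamma {α : ℝ} (hα : 0 < α) (x : ℝ) :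
    Summable fun k : ℕ => |x| ^ k / Real.Gamma (α * (k + 1)) := by
  set R : ℝ := (2 * |x| + 1) ^ α⁻¹
  have hb : 0 < 2 * |x| + 1 := by positivity
  have hR : 0 < R := Real.rpow_pos_of_pos hb _
  have hRα : R ^ α = 2 * |x| + 1 := by
    rw [← Real.rpow_mul hb.le, inv_mul_cancel₀ hα.ne', Real.rpow_one]
  have hg : ∀ k : ℕ, 0 < Real.Gamma (α * (k + 1)) := fun k => Real.Gamma_pos_of_pos (by positivity)
  have hs1 : Summable fun k : ℕ => ((k : ℝ) ^ 1 * (1 / 2 : ℝ) ^ k) :=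
    summable_pow_mul_geometric_of_norm_lt_one 1 (by norm_num)
  have hs2 : Summable fun k : ℕ => (1 / 2 : ℝ) ^ k :=
    summable_geometric_of_lt_one (by norm_num) (by norm_num)
  refine Summable.of_nonneg_of_le (fun k => div_nonneg (by positivity) (hg k).le) (fun k => ?_)
    ((hs1.add hs2).mul_left (α * Real.exp (R + 1)))
  have hpos : 0 < α * ((k : ℝ) + 1) := by positivity
  have h1 := rpow_mul_exp_le_Gamma hR hpos
  rw [Real.Gamma_add_one hpos.ne', Real.rpow_mul hR.le, hRα,
    show ((k : ℝ) + 1) = ((k + 1 : ℕ) : ℝ) by push_cast; ring, Real.rpow_natCast,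
    Real.exp_neg] at h1
  rw [div_le_iff₀ (hg k)]
  have h2 : |x| ^ k ≤ (1 / 2 : ℝ) ^ k * (2 * |x| + 1) ^ (k + 1) := by
    calc |x| ^ k = (1 / 2 : ℝ) ^ k * (2 * |x|) ^ k := by rw [← mul_pow]; ring_nf
      _ ≤ (1 / 2 : ℝ) ^ k * (2 * |x| + 1) ^ k := by gcongr; linarith
      _ ≤ _ := by
        gcongr
        · linarith [abs_nonneg x]
        · omega
  have h3 : (2 * |x| + 1) ^ (k + 1)
      ≤ Real.exp (R + 1) * (α * ((k + 1 : ℕ) : ℝ) * Real.Gamma (α * ((k + 1 : ℕ) : ℝ))) := by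
    have := mul_le_mul_of_nonneg_left h1 (Real.exp_pos (R + 1)).le
    rwa [mul_left_comm, mul_inv_cancel₀ (Real.exp_pos _).ne', mul_one] at this
  push_cast at h3
  calc |x| ^ k ≤ (1 / 2 : ℝ) ^ k * (2 * |x| + 1) ^ (k + 1) := h2
    _ ≤ (1 / 2 : ℝ) ^ k *
        (Real.exp (R + 1) * (α * ((k : ℝ) + 1) * Real.Gamma (α * ((k : ℝ) + 1)))) := by gcongr
    _ = _ := by ring

/-- The Mittag-Leffler function `E_{α,α}(x) = ∑ xᵏ / Γ(αk + α)`. -/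
def mittagLeffler (α x : ℝ) : ℝ := ∑' k : ℕ, x ^ k / Real.Gamma (α * (k + 1))

theorem summable_mittagLeffler {α : ℝ} (hα : 0 < α) (x : ℝ) :
    Summable fun k : ℕ => x ^ k / Real.Gamma (α * (k + 1)) := by
  refine Summable.of_norm ?_
  refine (summable_pow_div_Gamma hα x).congr fun k => ?_
  have : 0 < Real.Gamma (α * (k + 1)) := Real.Gamma_pos_of_pos (by positivity)
  rw [norm_div, norm_pow, Real.norm_eq_abs, Real.norm_of_nonneg this.le]

theorem differentiable_mittagLeffler {α : ℝ} (hα : 0 < α) :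
    Differentiable ℝ (mittagLeffler α) := by
  intro x
  set E : ℂ → ℂ := fun z => ∑' k : ℕ, z ^ k / (Real.Gamma (α * (k + 1)) : ℂ)
  have hE : DifferentiableOn ℂ E (Metric.ball 0 (|x| + 1)) := by
    refine Complex.differentiableOn_tsum_of_summable_norm (summable_pow_div_Gamma hα (|x| + 1))
      (fun k => ?_) Metric.isOpen_ball (fun k w hw => ?_)
    · fun_prop
    · have : 0 < Real.Gamma (α * (k + 1)) := Real.Gamma_pos_of_pos (by positivity)
      rw [norm_div, norm_pow, Complex.norm_real, Real.norm_of_nonneg this.le]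
      gcongr
      rw [mem_ball_zero_iff] at hw
      exact hw.le.trans (le_abs_self _)
  have hx : (x : ℂ) ∈ Metric.ball (0 : ℂ) (|x| + 1) := by
    rw [mem_ball_zero_iff, Complex.norm_real, Real.norm_eq_abs]
    linarith
  have h := ((hE _ hx).differentiableAt (Metric.isOpen_ball.mem_nhds hx)).hasDerivAt.real_of_complex
  have heq : (fun y : ℝ => (E y).re) = mittagLeffler α := by
    ext y
    have : E y = ((mittagLeffler α y : ℝ) : ℂ) := by
      simp only [E, mittagLeffler]
      push_cast
      rfl
    rw [this, Complex.ofReal_re]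
  rw [heq] at h
  exact h.differentiableAt

/-! ### The resolvent kernels -/

/-- The kernel `t^{α-1} E_{α,α}(-λ t^α)`. -/
def resP (α lam t : ℝ) : ℝ := t ^ (α - 1) * mittagLeffler α (-lam * t ^ α)

/-- The kernel `1 - λ ∫₀ᵗ s^{α-1} E_{α,α}(-λ s^α) ds = E_α(-λ t^α)`. -/
def resE (α lam t : ℝ) : ℝ := 1 - lam * ∫ s in (0 : ℝ)..t, resP α lam s

variable {α lam : ℝ}

theorem continuous_mittagLeffler_comp (hα : 0 < α) :
    Continuous fun t : ℝ => mittagLeffler α (-lam * t ^ α) :=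
  (differentiable_mittagLeffler hα).continuous.comp
    (continuous_const.mul (Real.continuous_rpow_const hα.le))

theorem intervalIntegrable_resP (hα : 0 < α) (a b : ℝ) :
    IntervalIntegrable (resP α lam) volume a b :=
  (intervalIntegrable_rpow_sub_one hα a b).mul_continuousOn
    (continuous_mittagLeffler_comp hα).continuousOn

theorem differentiableAt_resP (hα : 0 < α) {t : ℝ} (ht : 0 < t) :
    DifferentiableAt ℝ (resP α lam) t := by
  have h1 : DifferentiableAt ℝ (fun t : ℝ => t ^ (α - 1)) t :=
    (Real.hasDerivAt_rpow_const (Or.inl ht.ne')).differentiableAt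
  have h2 : DifferentiableAt ℝ (fun t : ℝ => -lam * t ^ α) t :=
    (Real.hasDerivAt_rpow_const (Or.inl ht.ne')).differentiableAt.const_mul _
  exact h1.mul ((differentiable_mittagLeffler hα _).comp t h2)

theorem intervalIntegrable_omega_mul_resP (hα : 0 < α) {t : ℝ} (ht : 0 ≤ t) :
    IntervalIntegrable (fun s => omega α (t - s) * resP α lam s) volume 0 t := by
  have h := ((intervalIntegrable_rpow_mul_rpow hα hα ht).mul_continuousOn
    (continuous_mittagLeffler_comp (lam := lam) hα).continuousOn).div_const (Real.Gamma α)
  refine h.congr ?_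
  intro s _
  simp only [omega, resP]
  ring

theorem hasSum_resP (hα : 0 < α) {t : ℝ} (ht : 0 < t) :
    HasSum (fun k : ℕ => (-lam) ^ k * omega (α * (k + 1)) t) (resP α lam t) := by
  have h := (summable_mittagLeffler hα (-lam * t ^ α)).hasSum.mul_left (t ^ (α - 1))
  refine HasSum.congr_fun h fun k => ?_
  have h1 : t ^ (α * ((k : ℝ) + 1) - 1) = t ^ (α - 1) * (t ^ α) ^ k := by
    rw [← Real.rpow_natCast, ← Real.rpow_mul ht.le, ← Real.rpow_add ht]
    ring_nf
  rw [omega, h1, mul_pow]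
  ring

theorem hasSum_vconv_omega_resP (hα : 0 < α) {t : ℝ} (ht : 0 < t) :
    HasSum (fun k : ℕ => (-lam) ^ k * omega (α * (k + 2)) t)
      (vconv (omega α) (resP α lam) t) := by
  have hk : ∀ k : ℕ, 0 < α * ((k : ℝ) + 1) := fun k => by positivity
  have hconv : ∀ k : ℕ, ∫ s in (0 : ℝ)..t, omega α (t - s) * omega (α * (k + 1)) s
      = omega (α * (k + 2)) t := fun k => by
    have := vconv_omega_omega hα (hk k) ht
    rw [vconv] at this
    rw [this]
    congr 1
    ring
  have hint : ∀ k : ℕ, IntervalIntegrable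
      (fun s => omega α (t - s) * omega (α * (k + 1)) s) volume 0 t := fun k => by
    have := (intervalIntegrable_rpow_mul_rpow hα (hk k) ht.le).div_const
      (Real.Gamma α * Real.Gamma (α * (k + 1)))
    refine this.congr fun s _ => ?_
    simp only [omega]
    ring
  have hsum : Summable fun k : ℕ => |lam| ^ k * omega (α * (k + 2)) t := by
    have h := ((summable_nat_add_iff 1).2 (summable_pow_div_Gamma hα (lam * t ^ α))).mul_left
      (t ^ (α - 1))
    by_cases hl : lam = 0
    · refine summable_of_ne_finset_zero (s := {0}) fun k hk => ?_
      have : k ≠ 0 := by simpa using hk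
      simp [hl, this]
    · have h2 := h.mul_left |lam|⁻¹
      refine h2.congr fun k => ?_
      have h1 : t ^ (α * ((k : ℝ) + 2) - 1) = t ^ (α - 1) * (t ^ α) ^ (k + 1) := by
        rw [← Real.rpow_natCast, ← Real.rpow_mul ht.le, ← Real.rpow_add ht]
        push_cast
        ring_nf
      rw [omega, h1, abs_mul, abs_of_pos (Real.rpow_pos_of_pos ht α), mul_pow]
      push_cast
      have h3 : |lam| ≠ 0 := abs_ne_zero.2 hl
      rw [show (k : ℝ) + 1 + 1 = k + 2 by ring]
      field_simp
      ring
  have h := hasSum_integral_of_summable_integral_norm (μ := volume.restrict (Ioc 0 t))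
    (F := fun (k : ℕ) s => (-lam) ^ k * (omega α (t - s) * omega (α * (k + 1)) s))
    (fun k => ((intervalIntegrable_iff_integrableOn_Ioc_of_le ht.le).1 (hint k)).const_mul _) ?_
  · have h4 : ∫ s in Ioc 0 t, ∑' k : ℕ, (-lam) ^ k * (omega α (t - s) * omega (α * (k + 1)) s)
        = vconv (omega α) (resP α lam) t := by
      rw [vconv, intervalIntegral.integral_of_le ht.le]
      refine setIntegral_congr_fun measurableSet_Ioc fun s hs => ?_
      rw [← ((hasSum_resP hα hs.1).mul_left (omega α (t - s))).tsum_eq]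
      exact tsum_congr fun k => by ring
    rw [h4] at h
    refine h.congr_fun fun k => ?_
    rw [integral_const_mul, ← intervalIntegral.integral_of_le ht.le, hconv]
  · refine hsum.congr fun k => ?_
    rw [← hconv, ← intervalIntegral.integral_const_mul, intervalIntegral.integral_of_le ht.le]
    refine setIntegral_congr_fun measurableSet_Ioc fun s hs => ?_
    rw [norm_mul, norm_pow, norm_neg, Real.norm_eq_abs, Real.norm_of_nonneg
      (mul_nonneg (omega_nonneg hα (sub_nonneg.2 hs.2)) (omega_nonneg (hk k) hs.1.le))]

theorem resP_add_vconv (hα : 0 < α) {t : ℝ} (ht : 0 < t) :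
    resP α lam t + lam * vconv (omega α) (resP α lam) t = omega α t := by
  have h1 := hasSum_resP (lam := lam) hα ht
  have h2 := (hasSum_vconv_omega_resP (lam := lam) hα ht).mul_left (-lam)
  have h3 : HasSum (fun k : ℕ => (-lam) ^ (k + 1) * omega (α * ((k + 1 : ℕ) + 1)) t)
      (-lam * vconv (omega α) (resP α lam) t) := by
    refine h2.congr_fun fun k => ?_
    push_cast
    rw [show (k : ℝ) + 1 + 1 = k + 2 by ring]
    ring
  have h4 := (hasSum_nat_add_iff' 1).2 h1
  have h5 := h4.unique h3
  simp at h5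
  linarith

theorem vconv_one_left (h : ℝ → ℝ) (t : ℝ) : vconv (fun _ => 1) h t = ∫ s in (0 : ℝ)..t, h s := by
  simp [vconv]

theorem resE_eq_one_sub (t : ℝ) :
    resE α lam t = 1 - lam * vconv (fun _ => 1) (resP α lam) t := by
  rw [vconv_one_left, resE]

theorem continuous_resE (hα : 0 < α) : Continuous (resE α lam) :=
  continuous_const.sub (continuous_const.mul
    (intervalIntegral.continuous_primitive (intervalIntegrable_resP hα) 0))

theorem hasDerivAt_resE (hα : 0 < α) {t : ℝ} (ht : 0 < t) :
    HasDerivAt (resE α lam) (-(lam * resP α lam t)) t := by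
  have h : HasDerivAt (fun t => ∫ s in (0 : ℝ)..t, resP α lam s) (resP α lam t) t := by
    refine intervalIntegral.integral_hasDerivAt_right (intervalIntegrable_resP hα 0 t) ?_
      (differentiableAt_resP hα ht).continuousAt
    refine ContinuousOn.stronglyMeasurableAtFilter (s := Ioi 0) isOpen_Ioi (fun s hs =>
      (differentiableAt_resP hα hs).continuousAt.continuousWithinAt) t ht
  exact (h.const_mul lam).const_sub 1

theorem intervalIntegrable_vconv_omega_resP (hα : 0 < α) {t : ℝ} (ht : 0 ≤ t) :
    IntervalIntegrable (vconv (omega α) (resP α lam)) volume 0 t :=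
  intervalIntegrable_tri_fst ht
    (integrable_tri_right ht (intervalIntegrable_resP hα 0 t) (intervalIntegrable_omega hα 0 t))

theorem intervalIntegrable_vconv_right {k h : ℝ → ℝ} {t : ℝ}
    (hk : IntervalIntegrable k volume 0 t) (hh : ContinuousOn h (uIcc 0 t)) :
    IntervalIntegrable (fun s => k (t - s) * h s) volume 0 t :=
  (intervalIntegrable_comp_sub hk).mul_continuousOn hh

theorem intervalIntegrable_vconv_left {k h : ℝ → ℝ} {t : ℝ}
    (hk : Continuous k) (hh : IntervalIntegrable h volume 0 t) :
    IntervalIntegrable (fun s => k (t - s) * h s) volume 0 t :=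
  hh.continuousOn_mul (hk.comp (continuous_const.sub continuous_id)).continuousOn

theorem vconv_one_omega (hα : 0 < α) {t : ℝ} (ht : 0 < t) :
    vconv (fun _ => 1) (omega α) t = t ^ α / Real.Gamma (α + 1) := by
  have h1 : (fun _ : ℝ => (1 : ℝ)) = omega 1 := by
    ext
    simp [omega]
  rw [h1, vconv_omega_omega one_pos hα ht, omega, add_comm 1 α, add_sub_cancel_right]

theorem vconv_one_omega_eq (hα : 0 < α) {t : ℝ} (ht : 0 ≤ t) :
    vconv (fun _ => 1) (omega α) t = vconv (fun _ => 1) (resP α lam) t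
      + lam * vconv (fun _ => 1) (vconv (omega α) (resP α lam)) t := by
  rw [vconv_one_left, vconv_one_left, vconv_one_left, ← intervalIntegral.integral_const_mul,
    ← intervalIntegral.integral_add (intervalIntegrable_resP (lam := lam) hα 0 t)
      ((intervalIntegrable_vconv_omega_resP hα ht).const_mul _),
    intervalIntegral.integral_of_le ht, intervalIntegral.integral_of_le ht]
  exact setIntegral_congr_fun measurableSet_Ioc fun s hs => (resP_add_vconv hα hs.1).symm

theorem resE_add_vconv (hα : 0 < α) {t : ℝ} (ht : 0 ≤ t) :
    resE α lam t + lam * vconv (omega α) (resE α lam) t = 1 := by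
  have hω := intervalIntegrable_omega hα 0 t
  have hp := intervalIntegrable_resP (lam := lam) hα 0 t
  have hcont : Continuous (vconv (fun _ => 1) (resP α lam)) := by
    have := intervalIntegral.continuous_primitive (intervalIntegrable_resP (lam := lam) hα) 0
    rwa [show vconv (fun _ => 1) (resP α lam) = _ from funext (vconv_one_left _)]
  have h1 : vconv (omega α) (resE α lam) t
      = vconv (omega α) (fun _ => 1) t
        - lam * vconv (omega α) (vconv (fun _ => 1) (resP α lam)) t := by
    simp only [vconv, resE_eq_one_sub (α := α) (lam := lam)]
    rw [← intervalIntegral.integral_const_mul, ← intervalIntegral.integral_sub]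
    · exact intervalIntegral.integral_congr fun s _ => by ring
    · exact intervalIntegrable_vconv_right hω continuousOn_const
    · exact (intervalIntegrable_vconv_right hω hcont.continuousOn).const_mul _
  have h2 : vconv (omega α) (vconv (fun _ => 1) (resP α lam)) t
      = vconv (fun _ => 1) (vconv (omega α) (resP α lam)) t := by
    rw [vconv_assoc_one ht hω hp, vconv_one_assoc ht hω hp]
    congr 1
    ext s
    exact vconv_comm _ _ _
  rw [h1, h2, vconv_comm (omega α), vconv_one_omega_eq hα ht, resE_eq_one_sub]
  ring

end

section

/-! ### Positivity of the resolvent kernels -/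

open Filter Topology in
/-- A solution of `y + λ ω_α * y = ω_α + ε` that is positive near the origin remains positive,
because the kernel `ω_α` is log-convex. -/
theorem volterra_pos {α lam ε : ℝ} (hα : 0 < α) (hα₁ : α < 1) (hlam : 0 ≤ lam) (hε : 0 < ε)
    {y : ℝ → ℝ} (hdiff : ∀ t, 0 < t → DifferentiableAt ℝ y t)
    (hint : ∀ t, 0 < t → IntervalIntegrable (fun s => omega α (t - s) * y s) volume 0 t)
    (heq : ∀ t, 0 < t → y t + lam * vconv (omega α) y t = omega α t + ε)
    (hnear : ∀ᶠ t in 𝓝[>] 0, 0 < y t) {t : ℝ} (ht : 0 < t) : 0 < y t := by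
  by_contra! hyt
  obtain ⟨δ, hδ, hδy⟩ := mem_nhdsGT_iff_exists_Ioo_subset.1 hnear
  have hδ : 0 < δ := hδ
  have hδt : δ ≤ t := not_lt.1 fun h => hyt.not_gt (hδy ⟨ht, h⟩)
  have hclosed : IsClosed (Icc δ t ∩ y ⁻¹' Iic 0) :=
    ContinuousOn.preimage_isClosed_of_isClosed
      (fun s hs => (hdiff s (hδ.trans_le hs.1)).continuousAt.continuousWithinAt)
      isClosed_Icc isClosed_Iic
  obtain ⟨t₀, ht₀, hleast⟩ := (isCompact_Icc.of_isClosed_subset hclosed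
    inter_subset_left).exists_isLeast ⟨t, ⟨hδt, le_rfl⟩, hyt⟩
  have ht₀pos : 0 < t₀ := hδ.trans_le ht₀.1.1
  have hpos : ∀ s, 0 < s → s < t₀ → 0 < y s := by
    intro s hs hst
    by_contra! h
    have : δ ≤ s := not_lt.1 fun h' => h.not_gt (hδy ⟨hs, h'⟩)
    exact (hleast ⟨⟨this, hst.le.trans ht₀.1.2⟩, h⟩).not_gt hst
  have hev : ∀ᶠ s in 𝓝[<] t₀, 0 < y s := by
    filter_upwards [Ioo_mem_nhdsLT ht₀pos] with s hs using hpos s hs.1 hs.2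
  have hy0 : y t₀ = 0 := le_antisymm ht₀.2 (ge_of_tendsto
    ((hdiff t₀ ht₀pos).continuousAt.tendsto.mono_left nhdsWithin_le_nhds)
    (hev.mono fun s hs => hs.le))
  have hD := (hdiff t₀ ht₀pos).hasDerivAt
  have hD0 : deriv y t₀ ≤ 0 := by
    have hle : 𝓝[<] t₀ ≤ 𝓝[≠] t₀ := nhdsWithin_mono _ fun s hs => ne_of_lt hs
    refine le_of_tendsto (hD.tendsto_slope.mono_left hle) ?_
    filter_upwards [hev, self_mem_nhdsWithin] with s hs hs'
    rw [slope_def_field, hy0, sub_zero]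
    exact div_nonpos_of_nonneg_of_nonpos hs.le (sub_nonpos.2 (le_of_lt hs'))
  set A : ℝ := 1 / (α * Real.Gamma α)
  have hΓ := Real.Gamma_pos_of_pos hα
  have hA : 0 < A := by positivity
  set c₁ : ℝ := ε * (1 - α) / (t₀ + 1)
  have hc₁ : 0 < c₁ := div_pos (mul_pos hε (by linarith)) (by linarith)
  set ε' : ℝ := c₁ / (2 * (1 + lam * A))
  have hε' : 0 < ε' := by positivity
  have hε'c : ε' * (1 + lam * A) < c₁ := by
    have : 0 < 1 + lam * A := by positivity
    have : ε' * (1 + lam * A) = c₁ / 2 := by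
      simp only [ε']
      field_simp
    linarith
  have hbd := (hasDerivAt_iff_isLittleO.1 hD).bound hε'
  obtain ⟨r, hr, hball⟩ := Metric.eventually_nhds_iff.1 hbd
  have hupper : ∀ s, t₀ < s → s < t₀ + r → y s ≤ ε' * (s - t₀) := by
    intro s h1 h2
    have := hball (y := s) (by rw [Real.dist_eq, abs_of_pos] <;> linarith)
    rw [hy0, sub_zero, Real.norm_eq_abs, Real.norm_eq_abs, abs_of_pos (sub_pos.2 h1),
      smul_eq_mul] at this
    nlinarith [le_abs_self (y s - (s - t₀) * deriv y t₀)]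
  set T : ℝ := t₀ + min r 1 / 2
  have hm : 0 < min r 1 := lt_min hr one_pos
  have hT0 : t₀ < T := by simp only [T]; linarith
  have hTr : T < t₀ + r := by simp only [T]; linarith [min_le_left r 1]
  have hT1 : T < t₀ + 1 := by simp only [T]; linarith [min_le_right r 1]
  have hTpos : 0 < T := ht₀pos.trans hT0
  set ρ : ℝ := (T / t₀) ^ (α - 1)
  have hρ : ρ ≤ 1 - (1 - α) * (T - t₀) / T := by
    have h1 : ρ = (1 + -((T - t₀) / T)) ^ (1 - α) := by
      have : 1 + -((T - t₀) / T) = (T / t₀)⁻¹ := by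
        field_simp
        ring
      rw [this, Real.inv_rpow (by positivity), ← Real.rpow_neg (by positivity), neg_sub]
    rw [h1]
    have h2 : (T - t₀) / T ≤ 1 := by
      rw [div_le_one hTpos]
      linarith
    have := rpow_one_add_le_one_add_mul_self (s := -((T - t₀) / T)) (by linarith)
      (p := 1 - α) (by linarith) (by linarith)
    refine this.trans_eq ?_
    ring
  have hgain : c₁ * (T - t₀) ≤ ε * (1 - ρ) := by
    have h1 : (1 - α) * (T - t₀) / (t₀ + 1) ≤ (1 - α) * (T - t₀) / T := by
      apply div_le_div_of_nonneg_left _ hTpos hT1.le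
      exact mul_nonneg (by linarith) (by linarith)
    calc c₁ * (T - t₀) = ε * ((1 - α) * (T - t₀) / (t₀ + 1)) := by simp only [c₁]; ring
      _ ≤ ε * (1 - ρ) := by
        refine mul_le_mul_of_nonneg_left ?_ hε.le
        linarith
  have hω : omega α T = ρ * omega α t₀ := by
    simp only [omega, ρ]
    rw [Real.div_rpow hTpos.le ht₀pos.le]
    have := (Real.rpow_pos_of_pos ht₀pos (α - 1)).ne'
    field_simp
  have hintT := hint T hTpos
  have hi1 : IntervalIntegrable (fun s => omega α (T - s) * y s) volume 0 t₀ :=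
    hintT.mono_set (by rw [uIcc_of_le ht₀pos.le, uIcc_of_le hTpos.le]; exact Icc_subset_Icc_right hT0.le)
  have hi2 : IntervalIntegrable (fun s => omega α (T - s) * y s) volume t₀ T :=
    hintT.mono_set (by rw [uIcc_of_le hT0.le, uIcc_of_le hTpos.le]; exact Icc_subset_Icc_left ht₀pos.le)
  have hpart1 : ∫ s in (0 : ℝ)..t₀, omega α (T - s) * y s ≤ ρ * vconv (omega α) y t₀ := by
    rw [vconv, ← intervalIntegral.integral_const_mul]
    refine intervalIntegral.integral_mono_on_of_le_Ioo ht₀pos.le hi1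
      ((hint t₀ ht₀pos).const_mul _) fun s hs => ?_
    rw [← mul_assoc]
    refine mul_le_mul_of_nonneg_right ?_ (hpos s hs.1 hs.2).le
    simp only [omega, ρ]
    rw [← mul_div_assoc]
    refine div_le_div_of_nonneg_right ?_ hΓ.le
    have h1 : 0 < t₀ - s := sub_pos.2 hs.2
    rw [← Real.mul_rpow (by positivity) h1.le]
    refine Real.rpow_le_rpow_of_nonpos (by positivity) ?_ (by linarith)
    rw [mul_sub, div_mul_cancel₀ _ ht₀pos.ne']
    have : s ≤ T / t₀ * s := by
      have : 1 ≤ T / t₀ := (one_le_div ht₀pos).2 hT0.le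
      nlinarith [hs.1]
    linarith
  have hpart2 : ∫ s in t₀..T, omega α (T - s) * y s ≤ ε' * (T - t₀) * A := by
    have hii : IntervalIntegrable (fun s => omega α (T - s)) volume t₀ T :=
      (intervalIntegrable_sub_rpow_sub_one hα T t₀ T).div_const _
    calc ∫ s in t₀..T, omega α (T - s) * y s
        ≤ ∫ s in t₀..T, omega α (T - s) * (ε' * (T - t₀)) := by
          refine intervalIntegral.integral_mono_on_of_le_Ioo hT0.le hi2 (hii.mul_const _)
            fun s hs => ?_
          refine mul_le_mul_of_nonneg_left ?_ (omega_nonneg hα (sub_nonneg.2 hs.2.le))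
          exact (hupper s hs.1 (hs.2.trans hTr)).trans
            (mul_le_mul_of_nonneg_left (by linarith [hs.2]) hε'.le)
      _ = (T - t₀) ^ α / (α * Real.Gamma α) * (ε' * (T - t₀)) := by
          simp only [omega]
          rw [intervalIntegral.integral_mul_const, intervalIntegral.integral_div,
            integral_sub_rpow_sub_one hα, div_div]
      _ ≤ A * (ε' * (T - t₀)) := by
          refine mul_le_mul_of_nonneg_right ?_ (mul_nonneg hε'.le (by linarith))
          refine div_le_div_of_nonneg_right ?_ (by positivity)
          exact Real.rpow_le_one (by linarith) (by linarith) hα.le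
      _ = _ := by ring
  have hsplit : vconv (omega α) y T = (∫ s in (0 : ℝ)..t₀, omega α (T - s) * y s)
      + ∫ s in t₀..T, omega α (T - s) * y s :=
    (intervalIntegral.integral_add_adjacent_intervals hi1 hi2).symm
  have heqT := heq T hTpos
  have heq0 := heq t₀ ht₀pos
  rw [hy0, zero_add] at heq0
  have hyT := hupper T hT0 hTr
  have e1 : lam * vconv (omega α) y T ≤ ρ * (omega α t₀ + ε) + lam * (ε' * (T - t₀) * A) := by
    rw [hsplit, mul_add, ← heq0]
    have := mul_le_mul_of_nonneg_left hpart1 hlam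
    have := mul_le_mul_of_nonneg_left hpart2 hlam
    linarith
  have e2 : c₁ * (T - t₀) ≤ ε' * (1 + lam * A) * (T - t₀) := by
    have : ε * (1 - ρ) ≤ y T + lam * (ε' * (T - t₀) * A) := by linarith
    linarith
  have := lt_of_mul_lt_mul_right (e2.trans_lt (mul_lt_mul_of_pos_right hε'c (sub_pos.2 hT0)))
    (sub_pos.2 hT0).le
  exact lt_irrefl _ this

variable {α lam : ℝ}

open Filter Topology in
theorem resP_add_mul_resE_pos (hα : 0 < α) (hα₁ : α < 1) (hlam : 0 ≤ lam) {ε t : ℝ} (hε : 0 < ε)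
    (ht : 0 < t) : 0 < resP α lam t + ε * resE α lam t := by
  refine volterra_pos (y := fun t => resP α lam t + ε * resE α lam t) hα hα₁ hlam hε
    (fun t ht => (differentiableAt_resP hα ht).add
      ((hasDerivAt_resE hα ht).differentiableAt.const_mul ε)) ?_ ?_ ?_ ht
  · intro t ht
    have h1 := intervalIntegrable_omega_mul_resP (lam := lam) hα ht.le
    have h2 := (intervalIntegrable_vconv_right (intervalIntegrable_omega hα 0 t)
      (continuous_resE (lam := lam) hα).continuousOn).const_mul ε
    exact (h1.add h2).congr fun s _ => by ring
  · intro t ht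
    have h1 := intervalIntegrable_omega_mul_resP (lam := lam) hα ht.le
    have h2 := (intervalIntegrable_vconv_right (intervalIntegrable_omega hα 0 t)
      (continuous_resE (lam := lam) hα).continuousOn).const_mul ε
    have h3 : vconv (omega α) (fun t => resP α lam t + ε * resE α lam t) t
        = vconv (omega α) (resP α lam) t + ε * vconv (omega α) (resE α lam) t := by
      simp only [vconv]
      rw [← intervalIntegral.integral_const_mul, ← intervalIntegral.integral_add h1 h2]
      exact intervalIntegral.integral_congr fun s _ => by ring
    rw [h3]
    have h4 := resP_add_vconv (lam := lam) hα ht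
    have h5 := resE_add_vconv (lam := lam) hα ht.le
    linear_combination h4 + ε * h5
  · have h1 : ∀ᶠ t in 𝓝 (0 : ℝ), 0 < mittagLeffler α (-lam * t ^ α) := by
      refine (continuous_mittagLeffler_comp hα).continuousAt.eventually (lt_mem_nhds ?_)
      beta_reduce
      rw [Real.zero_rpow hα.ne', mul_zero, mittagLeffler, tsum_eq_single 0]
      · simpa using Real.Gamma_pos_of_pos hα
      · intro k hk
        simp [hk]
    have h2 : ∀ᶠ t in 𝓝 (0 : ℝ), 0 < resE α lam t := by
      refine (continuous_resE hα).continuousAt.eventually (lt_mem_nhds ?_)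
      simp [resE]
    filter_upwards [h1.filter_mono nhdsWithin_le_nhds, h2.filter_mono nhdsWithin_le_nhds,
      self_mem_nhdsWithin] with t h1 h2 h3
    have h3 : 0 < t := h3
    exact add_pos (mul_pos (Real.rpow_pos_of_pos h3 _) h1) (mul_pos hε h2)

theorem resP_nonneg (hα : 0 < α) (hα₁ : α < 1) (hlam : 0 ≤ lam) {t : ℝ} (ht : 0 < t) :
    0 ≤ resP α lam t := by
  by_contra! h
  have h1 := resP_add_mul_resE_pos hα hα₁ hlam
    (ε := -resP α lam t / (|resE α lam t| + 1)) (by apply div_pos <;> [linarith; positivity]) ht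
  have h2 : -resP α lam t / (|resE α lam t| + 1) * resE α lam t ≤ -resP α lam t := by
    rw [div_mul_eq_mul_div, div_le_iff₀ (by positivity)]
    have := le_abs_self (resE α lam t)
    exact mul_le_mul_of_nonneg_left (by linarith) (by linarith)
  linarith

theorem resE_nonneg (hα : 0 < α) (hα₁ : α < 1) (hlam : 0 ≤ lam) {t : ℝ} (ht : 0 < t) :
    0 ≤ resE α lam t := by
  by_contra! h
  have hp := resP_nonneg hα hα₁ hlam ht
  have h1 := resP_add_mul_resE_pos hα hα₁ hlam
    (ε := (resP α lam t + 1) / -resE α lam t) (by apply div_pos <;> linarith) ht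
  have h2 : (resP α lam t + 1) / -resE α lam t * resE α lam t = -(resP α lam t + 1) := by
    have := h.ne
    field_simp
  linarith

theorem resP_le_omega (hα : 0 < α) (hα₁ : α < 1) (hlam : 0 ≤ lam) {t : ℝ} (ht : 0 < t) :
    resP α lam t ≤ omega α t := by
  have h := resP_add_vconv (lam := lam) hα ht
  have : 0 ≤ vconv (omega α) (resP α lam) t := by
    rw [vconv, intervalIntegral.integral_of_le ht.le]
    exact setIntegral_nonneg measurableSet_Ioc fun s hs =>
      mul_nonneg (omega_nonneg hα (sub_nonneg.2 hs.2)) (resP_nonneg hα hα₁ hlam hs.1)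
  nlinarith

theorem antitoneOn_resE (hα : 0 < α) (hα₁ : α < 1) (hlam : 0 ≤ lam) :
    AntitoneOn (resE α lam) (Ici 0) := by
  intro s hs t _ hst
  have hs : 0 ≤ s := hs
  have h : ∫ x in (0 : ℝ)..s, resP α lam x ≤ ∫ x in (0 : ℝ)..t, resP α lam x := by
    rw [intervalIntegral.integral_of_le hs, intervalIntegral.integral_of_le (hs.trans hst)]
    refine setIntegral_mono_set
      ((intervalIntegrable_iff_integrableOn_Ioc_of_le (hs.trans hst)).1
        (intervalIntegrable_resP hα 0 t)) ?_ (Ioc_subset_Ioc_right hst).eventuallyLE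
    filter_upwards [ae_restrict_mem measurableSet_Ioc] with x hx
    exact resP_nonneg hα hα₁ hlam hx.1
  simp only [resE]
  nlinarith

theorem resE_le_one (hα : 0 < α) (hα₁ : α < 1) (hlam : 0 ≤ lam) {t : ℝ} (ht : 0 ≤ t) :
    resE α lam t ≤ 1 := by
  have := antitoneOn_resE hα hα₁ hlam (mem_Ici.2 le_rfl) ht ht
  simpa [resE] using this

theorem lam_mul_rpow_mul_resE_le (hα : 0 < α) (hα₁ : α < 1) (hlam : 0 ≤ lam) {t : ℝ}
    (ht : 0 < t) : lam * t ^ α * resE α lam t ≤ Real.Gamma (α + 1) := by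
  have h := resE_add_vconv (lam := lam) hα ht.le
  have he := resE_nonneg hα hα₁ hlam ht
  have h1 : vconv (fun _ => 1) (omega α) t * resE α lam t ≤ vconv (omega α) (resE α lam) t := by
    rw [vconv_comm, vconv, vconv, ← intervalIntegral.integral_mul_const]
    refine intervalIntegral.integral_mono_on_of_le_Ioo ht.le
      ((intervalIntegrable_vconv_right (intervalIntegrable_omega hα 0 t)
        continuousOn_const).mul_const _)
      (intervalIntegrable_vconv_right (intervalIntegrable_omega hα 0 t)
        (continuous_resE hα).continuousOn) fun s hs => ?_
    rw [mul_one]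
    exact mul_le_mul_of_nonneg_left
      (antitoneOn_resE hα hα₁ hlam hs.1.le (mem_Ici.2 ht.le) hs.2.le)
      (omega_nonneg hα (sub_nonneg.2 hs.2.le))
  rw [vconv_one_omega hα ht] at h1
  have hΓ := Real.Gamma_pos_of_pos (show 0 < α + 1 by linarith)
  have h2 := mul_le_mul_of_nonneg_left h1 hlam
  have h3 : lam * (t ^ α / Real.Gamma (α + 1) * resE α lam t) ≤ 1 := by linarith
  have h4 : lam * (t ^ α / Real.Gamma (α + 1) * resE α lam t)
      = lam * t ^ α * resE α lam t / Real.Gamma (α + 1) := by ring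
  rwa [h4, div_le_one hΓ] at h3

/-! ### The solution formula -/

/-- The solution of the scalar equation `y + λ ω_α * y = y₀ + ω_α * φ + 1 * χ`. -/
theorem volterra_solution (hα : 0 < α) {t y₀ : ℝ} (ht : 0 < t) {y φ χ : ℝ → ℝ}
    (hy : ContinuousOn y (Icc 0 t)) (hφ : ContinuousOn φ (Icc 0 t))
    (hχ : IntervalIntegrable χ volume 0 t)
    (heq : ∀ s ∈ Ioc 0 t, y s + lam * vconv (omega α) y s
      = y₀ + vconv (omega α) φ s + vconv (fun _ => 1) χ s) :
    y t = y₀ * resE α lam t + vconv (resP α lam) φ t + vconv (resE α lam) χ t := by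
  have hp := intervalIntegrable_resP (lam := lam) hα 0 t
  have hω := intervalIntegrable_omega hα 0 t
  have huIcc := uIcc_of_le ht.le
  have hassoc : ∀ z : ℝ → ℝ, ContinuousOn z (Icc 0 t) →
      lam * vconv (resP α lam) (vconv (omega α) z) t
        = vconv (omega α) z t - vconv (resP α lam) z t
      ∧ IntervalIntegrable (fun s => resP α lam (t - s) * vconv (omega α) z s) volume 0 t := by
    intro z hz
    obtain ⟨C, hC⟩ := isCompact_Icc.exists_bound_of_continuousOn hz
    have hz' : IntervalIntegrable z volume 0 t := (huIcc ▸ hz).intervalIntegrable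
    refine ⟨?_, ?_⟩
    · rw [vconv_assoc_of_bdd_right ht.le hp hω hz' (C := C) fun s hs => hC s ⟨hs.1.le, hs.2⟩]
      simp only [vconv.eq_1 (vconv (resP α lam) (omega α)), vconv.eq_1 (omega α) z,
        vconv.eq_1 (resP α lam) z]
      rw [← intervalIntegral.integral_const_mul, ← intervalIntegral.integral_sub
        (intervalIntegrable_vconv_right hω (huIcc ▸ hz))
        (intervalIntegrable_vconv_right hp (huIcc ▸ hz))]
      rw [intervalIntegral.integral_of_le ht.le, intervalIntegral.integral_of_le ht.le,
        integral_Ioc_eq_integral_Ioo, integral_Ioc_eq_integral_Ioo]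
      refine setIntegral_congr_fun measurableSet_Ioo fun s hs => ?_
      have h1 := resP_add_vconv (lam := lam) hα (sub_pos.2 hs.2)
      rw [vconv_comm] at h1
      linear_combination (z s) * h1
    · have h1 := integrable_tri_bdd_mul (f := fun _ r => z r) (C := C)
        (integrable_tri_left ht.le (intervalIntegrable_comp_sub hp) hω)
        (aestronglyMeasurable_of_intervalIntegrable ht.le hz').comp_snd
        (fun s r h1 h2 h3 => hC r ⟨h1.le, h2.le.trans h3⟩)
      refine (intervalIntegrable_tri_fst ht.le h1).congr fun s _ => ?_
      rw [vconv, ← intervalIntegral.integral_const_mul]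
      exact intervalIntegral.integral_congr fun r _ => by ring
  obtain ⟨hy1, hy2⟩ := hassoc y hy
  obtain ⟨hφ1, hφ2⟩ := hassoc φ hφ
  have hcont : ContinuousOn (vconv (fun _ => 1) χ) (uIcc 0 t) := by
    rw [show vconv (fun _ => 1) χ = _ from funext (vconv_one_left _)]
    have := intervalIntegral.continuousOn_primitive_interval' hχ left_mem_uIcc
    exact this
  have hχ2 : IntervalIntegrable (fun s => resP α lam (t - s) * vconv (fun _ => 1) χ s)
      volume 0 t := intervalIntegrable_vconv_right hp hcont
  have hone : ∀ s, lam * vconv (resP α lam) (fun _ => 1) s = 1 - resE α lam s := by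
    intro s
    rw [vconv_comm, resE_eq_one_sub]
    ring
  have hχ1 : lam * vconv (resP α lam) (vconv (fun _ => 1) χ) t
      = vconv (fun _ => 1) χ t - vconv (resE α lam) χ t := by
    rw [vconv_assoc_one ht.le hp hχ]
    simp only [vconv.eq_1 (vconv (resP α lam) (fun _ => 1)), vconv.eq_1 (fun _ => 1) χ,
      vconv.eq_1 (resE α lam) χ]
    rw [← intervalIntegral.integral_const_mul, ← intervalIntegral.integral_sub
        (by simpa using hχ) (intervalIntegrable_vconv_left (continuous_resE hα) hχ)]
    refine intervalIntegral.integral_congr fun s _ => ?_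
    linear_combination (χ s) * hone (t - s)
  have hpy : IntervalIntegrable (fun s => resP α lam (t - s) * y s) volume 0 t :=
    intervalIntegrable_vconv_right hp (huIcc ▸ hy)
  have hp1 : IntervalIntegrable (fun s => resP α lam (t - s) * (1 : ℝ)) volume 0 t :=
    intervalIntegrable_vconv_right hp continuousOn_const
  have hmain : vconv (resP α lam) y t + lam * vconv (resP α lam) (vconv (omega α) y) t
      = y₀ * vconv (resP α lam) (fun _ => 1) t + vconv (resP α lam) (vconv (omega α) φ) t
        + vconv (resP α lam) (vconv (fun _ => 1) χ) t := by
    simp only [vconv.eq_1 (resP α lam)]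
    rw [← intervalIntegral.integral_const_mul, ← intervalIntegral.integral_const_mul,
      ← intervalIntegral.integral_add hpy (hy2.const_mul _),
      ← intervalIntegral.integral_add (hp1.const_mul _) hφ2,
      ← intervalIntegral.integral_add ((hp1.const_mul _).add hφ2) hχ2]
    rw [intervalIntegral.integral_of_le ht.le, intervalIntegral.integral_of_le ht.le]
    refine setIntegral_congr_fun measurableSet_Ioc fun s hs => ?_
    linear_combination resP α lam (t - s) * heq s hs
  have ht' := heq t ⟨ht, le_rfl⟩
  have h1 := hone t
  linear_combination ht' - lam * hmain + lam * hy1 - y₀ * h1 - hφ1 - hχ1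

end

section

/-! ### Decay of the resolvent kernels -/

section Decay

variable {α lam : ℝ}

theorem mul_resP_eq (hα : 0 < α) {t : ℝ} (ht : 0 < t) :
    t * resP α lam t = vconv (resE α lam) (fun s => α * resP α lam s) t := by
  set y : ℝ → ℝ := fun s => s ^ α * mittagLeffler α (-lam * s ^ α)
  have hy : Continuous y :=
    (Real.continuous_rpow_const hα.le).mul (continuous_mittagLeffler_comp hα)
  have hyp : ∀ s, 0 < s → y s = s * resP α lam s := by
    intro s hs
    simp only [y, resP]
    rw [Real.rpow_sub_one hs.ne']
    field_simp
  have hΓ : Real.Gamma (α + 1) = α * Real.Gamma α := Real.Gamma_add_one hα.ne'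
  have hΓ0 := (Real.Gamma_pos_of_pos hα).ne'
  have hsω : ∀ s, 0 < s → s * omega α s = α * vconv (fun _ => 1) (omega α) s := by
    intro s hs
    rw [vconv_one_omega hα hs, hΓ, omega, Real.rpow_sub_one hs.ne']
    field_simp
  rw [← hyp t ht]
  have h := volterra_solution (α := α) (lam := lam) hα (y₀ := 0) ht (y := y) (φ := fun _ => 0)
    (χ := fun s => α * resP α lam s) hy.continuousOn continuousOn_const
    ((intervalIntegrable_resP hα 0 t).const_mul α) ?_
  · rw [h]
    simp [vconv.eq_1 (resP α lam)]
  · intro s hs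
    have hint := intervalIntegrable_omega_mul_resP (lam := lam) hα hs.1.le
    have hp := intervalIntegrable_resP (lam := lam) hα 0 s
    have hω := intervalIntegrable_omega hα 0 s
    have h1 : s * vconv (omega α) (resP α lam) s
        = α * vconv (vconv (fun _ => 1) (omega α)) (resP α lam) s + vconv (omega α) y s := by
      have hi2 := intervalIntegrable_vconv_right hω hy.continuousOn
      have : vconv (omega α) y s
          = (∫ r in (0 : ℝ)..s, s * (omega α (s - r) * resP α lam r))
            - ∫ r in (0 : ℝ)..s, (s * (omega α (s - r) * resP α lam r) - omega α (s - r) * y r) := by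
        rw [← intervalIntegral.integral_sub (hint.const_mul _) ((hint.const_mul _).sub hi2)]
        exact intervalIntegral.integral_congr fun r _ => by ring
      rw [this, intervalIntegral.integral_const_mul, ← vconv, vconv.eq_1 (vconv _ _),
        ← intervalIntegral.integral_const_mul]
      have h2 : ∫ r in (0 : ℝ)..s, α * (vconv (fun _ => 1) (omega α) (s - r) * resP α lam r)
          = ∫ r in (0 : ℝ)..s, (s * (omega α (s - r) * resP α lam r) - omega α (s - r) * y r) := by
        rw [intervalIntegral.integral_of_le hs.1.le, intervalIntegral.integral_of_le hs.1.le,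
          integral_Ioc_eq_integral_Ioo, integral_Ioc_eq_integral_Ioo]
        refine setIntegral_congr_fun measurableSet_Ioo fun r hr => ?_
        have h3 := hsω (s - r) (sub_pos.2 hr.2)
        have h4 := hyp r hr.1
        linear_combination (-resP α lam r) * h3 + omega α (s - r) * h4
      rw [h2]
      ring
    rw [← vconv_one_assoc hs.1.le hω hp] at h1
    have h2 := vconv_one_omega_eq (lam := lam) hα hs.1.le
    have h3 := resP_add_vconv (lam := lam) hα hs.1
    have h4 := hsω s hs.1
    have h5 : vconv (fun _ => 1) (fun s => α * resP α lam s) s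
        = α * vconv (fun _ => 1) (resP α lam) s := by
      simp only [vconv_one_left]
      exact intervalIntegral.integral_const_mul _ _
    have h6 : vconv (omega α) (fun _ => 0) s = 0 := by simp [vconv]
    rw [h5, h6, hyp s hs.1]
    linear_combination s * h3 - lam * h1 + α * h2 + h4

theorem lam_mul_mul_resP_le (hα : 0 < α) (hα₁ : α < 1) (hlam : 0 ≤ lam) {t : ℝ} (ht : 0 < t) :
    lam * (t * resP α lam t) ≤ α := by
  have h1 : vconv (resE α lam) (fun s => α * resP α lam s) t
      ≤ α * ∫ s in (0 : ℝ)..t, resP α lam s := by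
    rw [vconv, ← intervalIntegral.integral_const_mul]
    refine intervalIntegral.integral_mono_on_of_le_Ioo ht.le
      (intervalIntegrable_vconv_left (continuous_resE hα)
        ((intervalIntegrable_resP hα 0 t).const_mul α))
      ((intervalIntegrable_resP hα 0 t).const_mul α) fun s hs => ?_
    exact mul_le_of_le_one_left (mul_nonneg hα.le (resP_nonneg hα hα₁ hlam hs.1))
      (resE_le_one hα hα₁ hlam (sub_nonneg.2 hs.2.le))
  have h2 := resE_nonneg hα hα₁ hlam ht
  rw [resE] at h2
  rw [mul_resP_eq hα ht]
  have h3 := mul_le_mul_of_nonneg_left h1 hlam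
  nlinarith

theorem sqrt_mul_resE_le (hα : 0 < α) (hα₁ : α < 1) (hlam : 0 ≤ lam) {t : ℝ} (ht : 0 < t) :
    √lam * resE α lam t ≤ √(Real.Gamma (α + 1)) * t ^ (1 - α / 2 - 1) := by
  have he := resE_nonneg hα hα₁ hlam ht
  have he1 := resE_le_one hα hα₁ hlam ht.le
  have hΓ := Real.Gamma_pos_of_pos (show 0 < α + 1 by linarith)
  have h := lam_mul_rpow_mul_resE_le hα hα₁ hlam ht
  refine (sq_le_sq₀ (by positivity) (by positivity)).1 ?_
  rw [mul_pow, mul_pow, Real.sq_sqrt hlam, Real.sq_sqrt hΓ.le, ← Real.rpow_natCast,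
    ← Real.rpow_natCast, ← Real.rpow_mul ht.le,
    show (1 - α / 2 - 1) * ((2 : ℕ) : ℝ) = -α by push_cast; ring, Real.rpow_neg ht.le,
    Real.rpow_natCast]
  have htα := Real.rpow_pos_of_pos ht α
  rw [← div_eq_mul_inv, le_div_iff₀ htα]
  have : lam * resE α lam t ^ 2 ≤ lam * resE α lam t := by
    refine mul_le_mul_of_nonneg_left ?_ hlam
    nlinarith
  nlinarith

theorem sqrt_mul_resP_le (hα : 0 < α) (hα₁ : α < 1) (hlam : 0 ≤ lam) {t : ℝ} (ht : 0 < t) :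
    √lam * resP α lam t ≤ √(α / Real.Gamma α) * t ^ (α / 2 - 1) := by
  have hp := resP_nonneg hα hα₁ hlam ht
  have hp1 := resP_le_omega hα hα₁ hlam ht
  have hΓ := Real.Gamma_pos_of_pos hα
  have h := lam_mul_mul_resP_le hα hα₁ hlam ht
  refine (sq_le_sq₀ (by positivity) (by positivity)).1 ?_
  rw [mul_pow, mul_pow, Real.sq_sqrt hlam, Real.sq_sqrt (by positivity), ← Real.rpow_natCast,
    ← Real.rpow_natCast, ← Real.rpow_mul ht.le,
    show (α / 2 - 1) * ((2 : ℕ) : ℝ) = (α - 1) - 1 by push_cast; ring, Real.rpow_sub_one ht.ne',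
    Real.rpow_natCast]
  have h1 : lam * (t * resP α lam t) * resP α lam t ≤ α * omega α t :=
    mul_le_mul h hp1 hp hα.le
  rw [omega] at h1
  have h2 : α / Real.Gamma α * (t ^ (α - 1) / t) = α * (t ^ (α - 1) / Real.Gamma α) / t := by
    ring
  rw [h2, le_div_iff₀ ht]
  linarith

end Decay

/-! ### Weighted estimates for systems of Volterra equations -/

section System

variable {H : Type*} [NormedAddCommGroup H] [InnerProductSpace ℝ H]

theorem sqrt_sum_sq_integral_le {n : ℕ} {φ : Fin n → H} (hφ : Orthonormal ℝ φ)
    {k : Fin n → ℝ → ℝ} {h : ℝ → H} {m : ℝ → ℝ} {t : ℝ} (ht : 0 ≤ t)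
    (hint : ∀ j, IntervalIntegrable (fun s => k j s * inner ℝ (h s) (φ j)) volume 0 t)
    {b : ℝ → ℝ} (hb : IntervalIntegrable (fun s => m s * b s) volume 0 t)
    (hk : ∀ j, ∀ s ∈ Ioo 0 t, |k j s| ≤ m s) (hm : ∀ s ∈ Ioo 0 t, 0 ≤ m s)
    (hh : ∀ s ∈ Ioo 0 t, ‖h s‖ ≤ b s) :
    √(∑ j, (∫ s in (0 : ℝ)..t, k j s * inner ℝ (h s) (φ j)) ^ 2) ≤ ∫ s in (0 : ℝ)..t, m s * b s := by
  set z : Fin n → ℝ := fun j => ∫ s in (0 : ℝ)..t, k j s * inner ℝ (h s) (φ j)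
  set S : ℝ := √(∑ j, z j ^ 2)
  have hS : 0 ≤ S := Real.sqrt_nonneg _
  have hSS : S * S = ∑ j, z j ^ 2 := Real.mul_self_sqrt (Finset.sum_nonneg fun j _ => sq_nonneg _)
  have h1 : S * S = ∫ s in (0 : ℝ)..t, ∑ j, z j * (k j s * inner ℝ (h s) (φ j)) := by
    rw [hSS, intervalIntegral.integral_finsetSum fun j _ => (hint j).const_mul _]
    refine Finset.sum_congr rfl fun j _ => ?_
    rw [intervalIntegral.integral_const_mul, sq]
  have hsum : IntervalIntegrable (fun s => ∑ j, z j * (k j s * inner ℝ (h s) (φ j))) volume 0 t := by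
    have := IntervalIntegrable.sum Finset.univ fun j _ => (hint j).const_mul (z j)
    exact this.congr fun s _ => by simp
  have h2 : S * S ≤ S * ∫ s in (0 : ℝ)..t, m s * b s := by
    rw [h1, ← intervalIntegral.integral_const_mul]
    refine intervalIntegral.integral_mono_on_of_le_Ioo ht
      hsum (hb.const_mul _) fun s hs => ?_
    have hbes : √(∑ j, inner ℝ (h s) (φ j) ^ 2) ≤ b s := by
      refine (Real.sqrt_le_left (norm_nonneg _)).2 ?_ |>.trans (hh s hs)
      have := hφ.sum_inner_products_le (x := h s) (s := Finset.univ)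
      refine le_trans (le_of_eq ?_) this
      refine Finset.sum_congr rfl fun j _ => ?_
      rw [real_inner_comm, Real.norm_eq_abs, sq_abs]
    calc ∑ j, z j * (k j s * inner ℝ (h s) (φ j))
        ≤ ∑ j, m s * (|z j| * |inner ℝ (h s) (φ j)|) := by
          refine Finset.sum_le_sum fun j _ => ?_
          calc z j * (k j s * inner ℝ (h s) (φ j)) ≤ |z j * (k j s * inner ℝ (h s) (φ j))| :=
                le_abs_self _
            _ = |k j s| * (|z j| * |inner ℝ (h s) (φ j)|) := by
                rw [abs_mul, abs_mul]
                ring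
            _ ≤ _ := mul_le_mul_of_nonneg_right (hk j s hs) (by positivity)
      _ = m s * ∑ j, |z j| * |inner ℝ (h s) (φ j)| := by rw [Finset.mul_sum]
      _ ≤ m s * (S * b s) := by
          refine mul_le_mul_of_nonneg_left ?_ (hm s hs)
          have := Real.sum_mul_le_sqrt_mul_sqrt Finset.univ (fun j => |z j|)
            (fun j => |inner ℝ (h s) (φ j)|)
          simp only [sq_abs] at this
          exact this.trans (mul_le_mul_of_nonneg_left hbes hS)
      _ = S * (m s * b s) := by ring
  rcases hS.eq_or_lt with h0 | h0
  · rw [← h0]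
    rw [intervalIntegral.integral_of_le ht, integral_Ioc_eq_integral_Ioo]
    exact setIntegral_nonneg measurableSet_Ioo fun s hs =>
      mul_nonneg (hm s hs) ((norm_nonneg _).trans (hh s hs))
  · exact le_of_mul_le_mul_left h2 h0

theorem sqrt_sum_add_sq_le {n : ℕ} (a b : Fin n → ℝ) :
    √(∑ j, (a j + b j) ^ 2) ≤ √(∑ j, a j ^ 2) + √(∑ j, b j ^ 2) := by
  have h := norm_add_le (WithLp.toLp 2 a : EuclideanSpace ℝ (Fin n)) (WithLp.toLp 2 b)
  simpa [EuclideanSpace.norm_eq, sq_abs] using h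

theorem exp_neg_le_rpow_neg {x γ : ℝ} (hx : 0 < x) (hγ : 0 ≤ γ) (hγ1 : γ ≤ 1) :
    Real.exp (-x) ≤ x ^ (-γ) := by
  rw [Real.exp_neg, Real.rpow_neg hx.le]
  refine inv_anti₀ (Real.rpow_pos_of_pos hx _) ?_
  rcases le_total x 1 with h | h
  · exact (Real.rpow_le_one hx.le h hγ).trans (Real.one_le_exp hx.le)
  · calc x ^ γ ≤ x ^ (1 : ℝ) := Real.rpow_le_rpow_of_exponent_le h hγ1
      _ = x := Real.rpow_one x
      _ ≤ Real.exp x := by linarith [Real.add_one_le_exp x]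

theorem integral_exp_weight_le {b p γ σ t : ℝ} (hγ : 0 ≤ γ) (hγb : γ < b)
    (hb1 : b ≤ 1) (hp : 0 < p) (hσ : 0 < σ) (ht : 0 < t) :
    ∫ s in (0 : ℝ)..t, (t - s) ^ (b - 1) * (s ^ (p - 1) * Real.exp (σ * s))
      ≤ Real.exp (σ * t) * σ ^ (-γ) * (t ^ (b - γ + p - 1) * ProbabilityTheory.beta (b - γ) p) := by
  have hb : 0 < b := hγ.trans_lt hγb
  rw [← integral_rpow_mul_rpow (sub_pos.2 hγb) hp ht, ← intervalIntegral.integral_const_mul]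
  refine intervalIntegral.integral_mono_on_of_le_Ioo ht.le ?_
    ((intervalIntegrable_rpow_mul_rpow (sub_pos.2 hγb) hp ht.le).const_mul _) fun s hs => ?_
  · have := (intervalIntegrable_rpow_mul_rpow hb hp ht.le).mul_continuousOn
      (g := fun s => Real.exp (σ * s)) (by fun_prop)
    simpa only [mul_assoc] using this
  · have hts : 0 < t - s := sub_pos.2 hs.2
    have h1 : Real.exp (σ * s) ≤ Real.exp (σ * t) * (σ ^ (-γ) * (t - s) ^ (-γ)) := by
      rw [← Real.mul_rpow hσ.le hts.le]
      have := exp_neg_le_rpow_neg (mul_pos hσ hts) hγ (hγb.le.trans hb1)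
      calc Real.exp (σ * s) = Real.exp (σ * t) * Real.exp (-(σ * (t - s))) := by
            rw [← Real.exp_add]
            ring_nf
        _ ≤ _ := mul_le_mul_of_nonneg_left this (Real.exp_pos _).le
    have h2 : (t - s) ^ (b - γ - 1) = (t - s) ^ (b - 1) * (t - s) ^ (-γ) := by
      rw [← Real.rpow_add hts]
      ring_nf
    rw [h2]
    calc (t - s) ^ (b - 1) * (s ^ (p - 1) * Real.exp (σ * s))
        ≤ (t - s) ^ (b - 1) * (s ^ (p - 1) *
          (Real.exp (σ * t) * (σ ^ (-γ) * (t - s) ^ (-γ)))) := by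
          gcongr
          exact Real.rpow_nonneg hs.1.le _
      _ = _ := by ring

end System

end

section System

variable {H : Type*} [NormedAddCommGroup H] [InnerProductSpace ℝ H]

/-- A system of scalar Volterra equations
`yⱼ + λⱼ ω_α * yⱼ = ⟨u₀, φⱼ⟩ + ω_α * ⟨f, φⱼ⟩ + 1 * ⟨g + ψ, φⱼ⟩` on `(0,T]`, where `f` and `ψ` are
controlled by a quantity `N` that is itself controlled by the `yⱼ`. -/
structure VolterraSystem {n : ℕ} (T α η c L M : ℝ) (φ : Fin n → H) (lam : Fin n → ℝ)
    (y : Fin n → ℝ → ℝ) (N : ℝ → ℝ) (u₀ : H) (f ψ g : ℝ → H) : Prop where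
  orthonormal : Orthonormal ℝ φ
  lam_nonneg : ∀ j, 0 ≤ lam j
  continuousOn_y : ∀ j, ContinuousOn (y j) (Icc 0 T)
  continuousOn_N : ContinuousOn N (Icc 0 T)
  N_nonneg : ∀ t ∈ Icc 0 T, 0 ≤ N t
  N_le : ∀ t ∈ Icc 0 T, N t ≤ c * √(∑ j, (√(1 + lam j) * y j t) ^ 2)
  continuousOn_f : ContinuousOn f (Icc 0 T)
  norm_f_le : ∀ s ∈ Ioc 0 T, ‖f s‖ ≤ L * N s
  norm_ψ_le : ∀ s ∈ Ioc 0 T, ‖ψ s‖ ≤ L * (N s + ∫ r in (0 : ℝ)..s, (s - r) ^ (α - 1) * N r)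
  intervalIntegrable_ψ : ∀ j, IntervalIntegrable (fun s => inner ℝ (ψ s) (φ j)) volume 0 T
  norm_g_le : ∀ s ∈ Ioc 0 T, ‖g s‖ ≤ M * s ^ (η - 1)
  intervalIntegrable_g : ∀ j, IntervalIntegrable (fun s => inner ℝ (g s) (φ j)) volume 0 T
  equation : ∀ j, ∀ t ∈ Ioc 0 T, y j t + lam j * vconv (omega α) (y j) t
    = inner ℝ u₀ (φ j) + vconv (omega α) (fun s => inner ℝ (f s) (φ j)) t
      + vconv (fun _ => 1) (fun s => inner ℝ (g s) (φ j) + inner ℝ (ψ s) (φ j)) t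

theorem sqrt_sum_sq_mul_inner_le {n : ℕ} {φ : Fin n → H} (hφ : Orthonormal ℝ φ) {k : Fin n → ℝ}
    {m : ℝ} (hm : 0 ≤ m) (hk : ∀ j, |k j| ≤ m) (x : H) :
    √(∑ j, (k j * inner ℝ x (φ j)) ^ 2) ≤ m * ‖x‖ := by
  refine (Real.sqrt_le_left (by positivity)).2 ?_
  have h := hφ.sum_inner_products_le (x := x) (s := Finset.univ)
  calc ∑ j, (k j * inner ℝ x (φ j)) ^ 2 ≤ ∑ j, m ^ 2 * ‖inner ℝ (φ j) x‖ ^ 2 := by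
        refine Finset.sum_le_sum fun j _ => ?_
        rw [mul_pow, real_inner_comm, Real.norm_eq_abs, sq_abs]
        refine mul_le_mul_of_nonneg_right ?_ (sq_nonneg _)
        rw [← sq_abs]
        exact pow_le_pow_left₀ (abs_nonneg _) (hk j) 2
    _ = m ^ 2 * ∑ j, ‖inner ℝ (φ j) x‖ ^ 2 := by rw [Finset.mul_sum]
    _ ≤ m ^ 2 * ‖x‖ ^ 2 := mul_le_mul_of_nonneg_left h (sq_nonneg _)
    _ = (m * ‖x‖) ^ 2 := by ring

variable {n : ℕ} {T α η c L M : ℝ} {φ : Fin n → H} {lam : Fin n → ℝ}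
    {y : Fin n → ℝ → ℝ} {N : ℝ → ℝ} {u₀ : H} {f ψ g : ℝ → H}

theorem VolterraSystem.norm_ψ_le_weight (hS : VolterraSystem T α η c L M φ lam y N u₀ f ψ g)
    (hα : 0 < α) (hα₁ : α < 1) (hL : 0 ≤ L) {q σ : ℝ} (hq : 0 ≤ q) (hσ : 0 < σ) {s : ℝ}
    (hs : s ∈ Ioc 0 T)
    (hN : ∀ r ∈ Ioc 0 s, N r ≤ q * (r ^ (1 - α / 2 - 1) * Real.exp (σ * r))) :
    ‖ψ s‖ ≤ L * (1 + T ^ α * ProbabilityTheory.beta α (1 - α / 2)) * q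
      * (s ^ (1 - α / 2 - 1) * Real.exp (σ * s)) := by
  refine (hS.norm_ψ_le s hs).trans ?_
  have hb : 0 < 1 - α / 2 := by linarith
  have hint : ∫ r in (0 : ℝ)..s, (s - r) ^ (α - 1) * N r
      ≤ q * Real.exp (σ * s) * (s ^ (α + (1 - α / 2) - 1)
        * ProbabilityTheory.beta α (1 - α / 2)) := by
    rw [← integral_rpow_mul_rpow hα hb hs.1, ← intervalIntegral.integral_const_mul]
    refine intervalIntegral.integral_mono_on_of_le_Ioo hs.1.le ?_
      ((intervalIntegrable_rpow_mul_rpow hα hb hs.1.le).const_mul _) fun r hr => ?_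
    · refine (intervalIntegrable_sub_rpow_sub_one hα s 0 s).mul_continuousOn ?_
      rw [uIcc_of_le hs.1.le]
      exact hS.continuousOn_N.mono (Icc_subset_Icc_right hs.2)
    · calc (s - r) ^ (α - 1) * N r
          ≤ (s - r) ^ (α - 1) * (q * (r ^ (1 - α / 2 - 1) * Real.exp (σ * s))) := by
            refine mul_le_mul_of_nonneg_left ?_ (Real.rpow_nonneg (sub_nonneg.2 hr.2.le) _)
            refine (hN r ⟨hr.1, hr.2.le⟩).trans ?_
            have := Real.rpow_nonneg hr.1.le (1 - α / 2 - 1)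
            gcongr
            exact hr.2.le
        _ = _ := by ring
  have hsα : s ^ (α + (1 - α / 2) - 1) ≤ T ^ α * s ^ (1 - α / 2 - 1) := by
    rw [add_sub_assoc, Real.rpow_add hs.1]
    exact mul_le_mul_of_nonneg_right (Real.rpow_le_rpow hs.1.le hs.2 hα.le)
      (Real.rpow_nonneg hs.1.le _)
  have hB := (ProbabilityTheory.beta_pos hα hb).le
  have h1 := hN s ⟨hs.1, le_rfl⟩
  calc L * (N s + ∫ r in (0 : ℝ)..s, (s - r) ^ (α - 1) * N r)
      ≤ L * (q * (s ^ (1 - α / 2 - 1) * Real.exp (σ * s)) + q * Real.exp (σ * s) *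
        (T ^ α * s ^ (1 - α / 2 - 1) * ProbabilityTheory.beta α (1 - α / 2))) := by
        refine mul_le_mul_of_nonneg_left (add_le_add h1 (hint.trans ?_)) hL
        gcongr
    _ = _ := by ring

theorem VolterraSystem.sqrt_sum_le (hS : VolterraSystem T α η c L M φ lam y N u₀ f ψ g)
    (hα : 0 < α) (hα₁ : α < 1) (hη : 0 < η) (hL : 0 ≤ L)
    {w : Fin n → ℝ} (hw : ∀ j, 0 ≤ w j) {p κ : ℝ} (hp : α / 2 ≤ p) (hκ : 0 ≤ κ)
    (hwE : ∀ j, ∀ x ∈ Ioc 0 T, w j * resE α (lam j) x ≤ κ * x ^ (p - 1))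
    (hwP : ∀ j, ∀ x ∈ Ioc 0 T, w j * resP α (lam j) x ≤ κ * x ^ (α / 2 - 1))
    {q σ γ : ℝ} (hq : 0 ≤ q) (hσ : 0 < σ) (hγ : 0 ≤ γ) (hγα : γ < α / 2)
    {t : ℝ} (ht : t ∈ Ioc 0 T)
    (hN : ∀ s ∈ Ioc 0 t, N s ≤ q * (s ^ (1 - α / 2 - 1) * Real.exp (σ * s))) :
    √(∑ j, (w j * y j t) ^ 2) ≤ κ * t ^ (p - 1) * ‖u₀‖
      + κ * M * (t ^ (p + η - 1) * ProbabilityTheory.beta p η)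
      + κ * (1 + T ^ (p - α / 2)) * (L * (1 + T ^ α * ProbabilityTheory.beta α (1 - α / 2)) * q)
        * (Real.exp (σ * t) * σ ^ (-γ)
          * (t ^ (-γ) * ProbabilityTheory.beta (α / 2 - γ) (1 - α / 2))) := by
  have hb : 0 < 1 - α / 2 := by linarith
  have hα2 : 0 < α / 2 := by linarith
  have hp0 : 0 < p := by linarith
  have hTpos : 0 < T := ht.1.trans_le ht.2
  have hB := (ProbabilityTheory.beta_pos hα hb).le
  set L' : ℝ := L * (1 + T ^ α * ProbabilityTheory.beta α (1 - α / 2)) * q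
  have hL' : 0 ≤ L' := by positivity
  have hLL' : L * q ≤ L' := by
    have : 0 ≤ L * q * (T ^ α * ProbabilityTheory.beta α (1 - α / 2)) := by positivity
    simp only [L']
    linarith
  set W : ℝ → ℝ := fun s => s ^ (1 - α / 2 - 1) * Real.exp (σ * s)
  have hW : ∀ s, 0 < s → 0 ≤ W s := fun s hs =>
    mul_nonneg (Real.rpow_nonneg hs.le _) (Real.exp_pos _).le
  have hfW : ∀ s ∈ Ioo 0 t, ‖f s‖ ≤ L' * W s := by
    intro s hs
    have hs' : s ∈ Ioc 0 T := ⟨hs.1, hs.2.le.trans ht.2⟩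
    calc ‖f s‖ ≤ L * N s := hS.norm_f_le s hs'
      _ ≤ L * (q * W s) := mul_le_mul_of_nonneg_left (hN s ⟨hs.1, hs.2.le⟩) hL
      _ = L * q * W s := by ring
      _ ≤ L' * W s := mul_le_mul_of_nonneg_right hLL' (hW s hs.1)
  have hψW : ∀ s ∈ Ioo 0 t, ‖ψ s‖ ≤ L' * W s := by
    intro s hs
    exact hS.norm_ψ_le_weight hα hα₁ hL hq hσ ⟨hs.1, hs.2.le.trans ht.2⟩
      fun r hr => hN r ⟨hr.1, hr.2.trans hs.2.le⟩
  have hsub : uIcc 0 t ⊆ uIcc 0 T := by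
    rw [uIcc_of_le ht.1.le, uIcc_of_le hTpos.le]
    exact Icc_subset_Icc_right ht.2
  have hsub' : Icc 0 t ⊆ Icc 0 T := Icc_subset_Icc_right ht.2
  have hfj : ∀ j, ContinuousOn (fun s => inner ℝ (f s) (φ j)) (Icc 0 t) := fun j =>
    (hS.continuousOn_f.mono hsub').inner continuousOn_const
  have hgj : ∀ j, IntervalIntegrable (fun s => inner ℝ (g s) (φ j)) volume 0 t := fun j =>
    (hS.intervalIntegrable_g j).mono_set hsub
  have hψj : ∀ j, IntervalIntegrable (fun s => inner ℝ (ψ s) (φ j)) volume 0 t := fun j =>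
    (hS.intervalIntegrable_ψ j).mono_set hsub
  have hEcont : ∀ j, Continuous (resE α (lam j)) := fun j => continuous_resE hα
  have hi2 : ∀ j, IntervalIntegrable
      (fun s => w j * resP α (lam j) (t - s) * inner ℝ (f s) (φ j)) volume 0 t := fun j => by
    have := (intervalIntegrable_vconv_right (intervalIntegrable_resP (lam := lam j) hα 0 t)
      (by rw [uIcc_of_le ht.1.le]; exact hfj j)).const_mul (w j)
    simpa only [mul_assoc] using this
  have hi3 : ∀ j, IntervalIntegrable
      (fun s => w j * resE α (lam j) (t - s) * inner ℝ (g s) (φ j)) volume 0 t := fun j => by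
    have := (intervalIntegrable_vconv_left (hEcont j) (hgj j)).const_mul (w j)
    simpa only [mul_assoc] using this
  have hi4 : ∀ j, IntervalIntegrable
      (fun s => w j * resE α (lam j) (t - s) * inner ℝ (ψ s) (φ j)) volume 0 t := fun j => by
    have := (intervalIntegrable_vconv_left (hEcont j) (hψj j)).const_mul (w j)
    simpa only [mul_assoc] using this
  have hsol : ∀ j, w j * y j t = (w j * resE α (lam j) t * inner ℝ u₀ (φ j)
      + ∫ s in (0 : ℝ)..t, w j * resE α (lam j) (t - s) * inner ℝ (g s) (φ j))
      + ((∫ s in (0 : ℝ)..t, w j * resP α (lam j) (t - s) * inner ℝ (f s) (φ j))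
      + ∫ s in (0 : ℝ)..t, w j * resE α (lam j) (t - s) * inner ℝ (ψ s) (φ j)) := by
    intro j
    have h := volterra_solution (lam := lam j) hα ht.1
      ((hS.continuousOn_y j).mono hsub') (hfj j) ((hgj j).add (hψj j))
      (fun s hs => hS.equation j s ⟨hs.1, hs.2.trans ht.2⟩)
    rw [h]
    simp only [vconv, mul_add, mul_assoc, intervalIntegral.integral_const_mul]
    rw [intervalIntegral.integral_add (intervalIntegrable_vconv_left (hEcont j) (hgj j))
      (intervalIntegrable_vconv_left (hEcont j) (hψj j))]
    ring
  have hrange : ∀ s ∈ Ioo 0 t, t - s ∈ Ioc 0 T := fun s hs =>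
    ⟨sub_pos.2 hs.2, by linarith [hs.1, ht.2]⟩
  have hEabs : ∀ j, ∀ x ∈ Ioc 0 T, |w j * resE α (lam j) x| ≤ κ * x ^ (p - 1) := fun j x hx => by
    rw [abs_of_nonneg (mul_nonneg (hw j) (resE_nonneg hα hα₁ (hS.lam_nonneg j) hx.1))]
    exact hwE j x hx
  have hPabs : ∀ j, ∀ x ∈ Ioc 0 T, |w j * resP α (lam j) x| ≤ κ * x ^ (α / 2 - 1) :=
    fun j x hx => by
    rw [abs_of_nonneg (mul_nonneg (hw j) (resP_nonneg hα hα₁ (hS.lam_nonneg j) hx.1))]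
    exact hwP j x hx
  have hTp : ∀ x ∈ Ioc 0 T, κ * x ^ (p - 1) ≤ κ * T ^ (p - α / 2) * x ^ (α / 2 - 1) := by
    intro x hx
    rw [mul_assoc]
    refine mul_le_mul_of_nonneg_left ?_ hκ
    rw [show p - 1 = (p - α / 2) + (α / 2 - 1) by ring, Real.rpow_add hx.1]
    exact mul_le_mul_of_nonneg_right (Real.rpow_le_rpow hx.1.le hx.2 (by linarith))
      (Real.rpow_nonneg hx.1.le _)
  have hWint : IntervalIntegrable (fun s => (t - s) ^ (α / 2 - 1) * W s) volume 0 t := by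
    have := (intervalIntegrable_rpow_mul_rpow hα2 hb ht.1.le).mul_continuousOn
      (g := fun s => Real.exp (σ * s)) (by fun_prop)
    simpa only [mul_assoc] using this
  set J : ℝ := ∫ s in (0 : ℝ)..t, (t - s) ^ (α / 2 - 1) * W s
  have hJ : J ≤ Real.exp (σ * t) * σ ^ (-γ)
      * (t ^ (-γ) * ProbabilityTheory.beta (α / 2 - γ) (1 - α / 2)) := by
    have := integral_exp_weight_le hγ hγα (by linarith) hb hσ ht.1
    rwa [show α / 2 - γ + (1 - α / 2) - 1 = -γ by ring] at this
  have b1 := sqrt_sum_sq_mul_inner_le hS.orthonormal (m := κ * t ^ (p - 1))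
    (k := fun j => w j * resE α (lam j) t) (mul_nonneg hκ (Real.rpow_nonneg ht.1.le _))
    (fun j => hEabs j t ht) u₀
  have b2 := sqrt_sum_sq_integral_le hS.orthonormal ht.1.le
    (k := fun j s => w j * resP α (lam j) (t - s)) (h := f)
    (m := fun s => κ * (t - s) ^ (α / 2 - 1)) (b := fun s => L' * W s) hi2
    ((hWint.const_mul (κ * L')).congr fun s _ => by ring)
    (fun j s hs => hPabs j _ (hrange s hs))
    (fun s hs => mul_nonneg hκ (Real.rpow_nonneg (sub_nonneg.2 hs.2.le) _)) hfW
  have b3 := sqrt_sum_sq_integral_le hS.orthonormal ht.1.le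
    (k := fun j s => w j * resE α (lam j) (t - s)) (h := g)
    (m := fun s => κ * (t - s) ^ (p - 1)) (b := fun s => M * s ^ (η - 1)) hi3
    (((intervalIntegrable_rpow_mul_rpow hp0 hη ht.1.le).const_mul (κ * M)).congr
      fun s _ => by ring)
    (fun j s hs => hEabs j _ (hrange s hs))
    (fun s hs => mul_nonneg hκ (Real.rpow_nonneg (sub_nonneg.2 hs.2.le) _))
    (fun s hs => hS.norm_g_le s ⟨hs.1, hs.2.le.trans ht.2⟩)
  have b4 := sqrt_sum_sq_integral_le hS.orthonormal ht.1.le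
    (k := fun j s => w j * resE α (lam j) (t - s)) (h := ψ)
    (m := fun s => κ * T ^ (p - α / 2) * (t - s) ^ (α / 2 - 1)) (b := fun s => L' * W s) hi4
    ((hWint.const_mul (κ * T ^ (p - α / 2) * L')).congr fun s _ => by ring)
    (fun j s hs => (hEabs j _ (hrange s hs)).trans (hTp _ (hrange s hs)))
    (fun s hs => mul_nonneg (by positivity) (Real.rpow_nonneg (sub_nonneg.2 hs.2.le) _)) hψW
  have e2 : ∫ s in (0 : ℝ)..t, κ * (t - s) ^ (α / 2 - 1) * (L' * W s) = κ * L' * J := by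
    rw [← intervalIntegral.integral_const_mul]
    exact intervalIntegral.integral_congr fun s _ => by ring
  have e3 : ∫ s in (0 : ℝ)..t, κ * (t - s) ^ (p - 1) * (M * s ^ (η - 1))
      = κ * M * (t ^ (p + η - 1) * ProbabilityTheory.beta p η) := by
    rw [← integral_rpow_mul_rpow hp0 hη ht.1, ← intervalIntegral.integral_const_mul]
    exact intervalIntegral.integral_congr fun s _ => by ring
  have e4 : ∫ s in (0 : ℝ)..t, κ * T ^ (p - α / 2) * (t - s) ^ (α / 2 - 1) * (L' * W s)
      = κ * T ^ (p - α / 2) * L' * J := by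
    rw [← intervalIntegral.integral_const_mul]
    exact intervalIntegral.integral_congr fun s _ => by ring
  rw [e2] at b2
  rw [e3] at b3
  rw [e4] at b4
  simp only [hsol]
  refine (sqrt_sum_add_sq_le _ _).trans ?_
  have a1 := sqrt_sum_add_sq_le (fun j => w j * resE α (lam j) t * inner ℝ u₀ (φ j))
    (fun j => ∫ s in (0 : ℝ)..t, w j * resE α (lam j) (t - s) * inner ℝ (g s) (φ j))
  have a2 := sqrt_sum_add_sq_le
    (fun j => ∫ s in (0 : ℝ)..t, w j * resP α (lam j) (t - s) * inner ℝ (f s) (φ j))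
    (fun j => ∫ s in (0 : ℝ)..t, w j * resE α (lam j) (t - s) * inner ℝ (ψ s) (φ j))
  have hfin : κ * L' * J + κ * T ^ (p - α / 2) * L' * J ≤ κ * (1 + T ^ (p - α / 2)) * L'
      * (Real.exp (σ * t) * σ ^ (-γ)
        * (t ^ (-γ) * ProbabilityTheory.beta (α / 2 - γ) (1 - α / 2))) := by
    have : κ * L' * J + κ * T ^ (p - α / 2) * L' * J = κ * (1 + T ^ (p - α / 2)) * L' * J := by
      ring
    rw [this]
    refine mul_le_mul_of_nonneg_left hJ ?_
    have := Real.rpow_nonneg hTpos.le (p - α / 2)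
    positivity
  linarith

end System

section

/-- The constant in the pointwise bounds for the weighted resolvent kernels. -/
def kernelBound (T α : ℝ) : ℝ :=
  1 + T ^ (α / 2) + √(Real.Gamma (α + 1)) + T ^ (α / 2) / Real.Gamma α + √(α / Real.Gamma α)

section KernelBound

variable {T α lam x : ℝ}

theorem one_le_kernelBound (hT : 0 < T) (hα : 0 < α) : 1 ≤ kernelBound T α := by
  have := Real.Gamma_pos_of_pos hα
  have h : 0 ≤ T ^ (α / 2) + √(Real.Gamma (α + 1)) + T ^ (α / 2) / Real.Gamma α
      + √(α / Real.Gamma α) := by positivity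
  unfold kernelBound
  linarith

theorem sqrt_one_add_le (hlam : 0 ≤ lam) : √(1 + lam) ≤ 1 + √lam := by
  refine (Real.sqrt_le_left (by positivity)).2 ?_
  nlinarith [Real.sq_sqrt hlam, Real.sqrt_nonneg lam]

theorem omega_le_rpow (hα : 0 < α) (hx : x ∈ Ioc 0 T) :
    omega α x ≤ T ^ (α / 2) / Real.Gamma α * x ^ (α / 2 - 1) := by
  have hΓ := Real.Gamma_pos_of_pos hα
  rw [omega, div_mul_eq_mul_div]
  refine div_le_div_of_nonneg_right ?_ hΓ.le
  rw [show α - 1 = α / 2 + (α / 2 - 1) by ring, Real.rpow_add hx.1]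
  exact mul_le_mul_of_nonneg_right (Real.rpow_le_rpow hx.1.le hx.2 (by linarith))
    (Real.rpow_nonneg hx.1.le _)

theorem sqrt_one_add_mul_resE_le (hα : 0 < α) (hα₁ : α < 1) (hlam : 0 ≤ lam)
    (hx : x ∈ Ioc 0 T) :
    √(1 + lam) * resE α lam x ≤ kernelBound T α * x ^ (1 - α / 2 - 1) := by
  have hΓ := Real.Gamma_pos_of_pos hα
  have hTpos : 0 < T := hx.1.trans_le hx.2
  have h0 := resE_nonneg hα hα₁ hlam hx.1
  have h1 := resE_le_one hα hα₁ hlam hx.1.le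
  have h2 := sqrt_mul_resE_le hα hα₁ hlam hx.1
  have hxp := Real.rpow_pos_of_pos hx.1 (1 - α / 2 - 1)
  have h3 : 1 ≤ T ^ (α / 2) * x ^ (1 - α / 2 - 1) := by
    rw [show 1 - α / 2 - 1 = -(α / 2) by ring, Real.rpow_neg hx.1.le, ← div_eq_mul_inv,
      one_le_div (Real.rpow_pos_of_pos hx.1 _)]
    exact Real.rpow_le_rpow hx.1.le hx.2 (by linarith)
  have h4 : 0 ≤ (1 + T ^ (α / 2) / Real.Gamma α + √(α / Real.Gamma α)) * x ^ (1 - α / 2 - 1) := by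
    positivity
  calc √(1 + lam) * resE α lam x ≤ (1 + √lam) * resE α lam x :=
        mul_le_mul_of_nonneg_right (sqrt_one_add_le hlam) h0
    _ ≤ kernelBound T α * x ^ (1 - α / 2 - 1) := by
        unfold kernelBound
        linarith

theorem sqrt_one_add_mul_resP_le (hα : 0 < α) (hα₁ : α < 1) (hlam : 0 ≤ lam)
    (hx : x ∈ Ioc 0 T) :
    √(1 + lam) * resP α lam x ≤ kernelBound T α * x ^ (α / 2 - 1) := by
  have hΓ := Real.Gamma_pos_of_pos hα
  have hTpos : 0 < T := hx.1.trans_le hx.2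
  have h0 := resP_nonneg hα hα₁ hlam hx.1
  have h1 := (resP_le_omega hα hα₁ hlam hx.1).trans (omega_le_rpow hα hx)
  have h2 := sqrt_mul_resP_le hα hα₁ hlam hx.1
  have hxp := Real.rpow_pos_of_pos hx.1 (α / 2 - 1)
  have h4 : 0 ≤ (1 + T ^ (α / 2) + √(Real.Gamma (α + 1))) * x ^ (α / 2 - 1) := by
    positivity
  calc √(1 + lam) * resP α lam x ≤ (1 + √lam) * resP α lam x :=
        mul_le_mul_of_nonneg_right (sqrt_one_add_le hlam) h0
    _ ≤ kernelBound T α * x ^ (α / 2 - 1) := by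
        unfold kernelBound
        linarith

theorem one_mul_resE_le (hα : 0 < α) (hα₁ : α < 1) (hlam : 0 ≤ lam) (hx : x ∈ Ioc 0 T) :
    1 * resE α lam x ≤ kernelBound T α * x ^ ((1 : ℝ) - 1) := by
  rw [sub_self, Real.rpow_zero, one_mul, mul_one]
  exact (resE_le_one hα hα₁ hlam hx.1.le).trans
    (one_le_kernelBound (hx.1.trans_le hx.2) hα)

theorem one_mul_resP_le (hα : 0 < α) (hα₁ : α < 1) (hlam : 0 ≤ lam) (hx : x ∈ Ioc 0 T) :
    1 * resP α lam x ≤ kernelBound T α * x ^ (α / 2 - 1) := by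
  refine le_trans ?_ (sqrt_one_add_mul_resP_le hα hα₁ hlam hx)
  refine mul_le_mul_of_nonneg_right ?_ (resP_nonneg hα hα₁ hlam hx.1)
  exact Real.one_le_sqrt.2 (by linarith)

end KernelBound

/-- Solutions of a Volterra system are bounded in terms of the data, with a constant that does not
depend on the size of the system or on the `λⱼ`. -/
theorem exists_bound_of_volterraSystem {H : Type*} [NormedAddCommGroup H] [InnerProductSpace ℝ H]
    {T α η c L : ℝ} (hT : 0 < T) (hα : 0 < α) (hα₁ : α < 1) (hη : 0 < η) (hc : 0 ≤ c)
    (hL : 0 ≤ L) :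
    ∃ C : ℝ, 0 ≤ C ∧ ∀ (M : ℝ), 0 ≤ M → ∀ {n : ℕ} {φ : Fin n → H} {lam : Fin n → ℝ}
      {y : Fin n → ℝ → ℝ} {N : ℝ → ℝ} {u₀ : H} {f ψ g : ℝ → H},
      VolterraSystem T α η c L M φ lam y N u₀ f ψ g → ∀ t ∈ Ioc 0 T,
        √(∑ j, y j t ^ 2) ≤ C * (‖u₀‖ + M * t ^ η) ∧
        t ^ (α / 2) * N t ≤ C * (‖u₀‖ + M * t ^ η) := by
  have hα2 : 0 < α / 2 := by linarith
  have hα4 : 0 < α / 4 := by linarith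
  have hb : 0 < 1 - α / 2 := by linarith
  set κ := kernelBound T α
  have hκ : 0 ≤ κ := zero_le_one.trans (one_le_kernelBound hT hα)
  set L' : ℝ := L * (1 + T ^ α * ProbabilityTheory.beta α (1 - α / 2))
  have hB := (ProbabilityTheory.beta_pos hα hb).le
  have hL' : 0 ≤ L' := by positivity
  set B₁ := ProbabilityTheory.beta (1 - α / 2) η
  have hB₁ : 0 ≤ B₁ := (ProbabilityTheory.beta_pos hb hη).le
  set B₂ := ProbabilityTheory.beta (α / 2 - α / 4) (1 - α / 2)
  have hB₂ : 0 ≤ B₂ := (ProbabilityTheory.beta_pos (by linarith) hb).le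
  set B₃ := ProbabilityTheory.beta 1 η
  have hB₃ : 0 ≤ B₃ := (ProbabilityTheory.beta_pos one_pos hη).le
  set B₄ := ProbabilityTheory.beta (α / 2) (1 - α / 2)
  have hB₄ : 0 ≤ B₄ := (ProbabilityTheory.beta_pos hα2 hb).le
  set A : ℝ := c * κ * (1 + T ^ (1 - α / 2 - α / 2)) * L' * B₂ * T ^ (α / 4)
  have hA : 0 ≤ A := by positivity
  set σ : ℝ := (2 * A + 1) ^ (α / 4)⁻¹
  have hσ : 0 < σ := Real.rpow_pos_of_pos (by positivity) _
  have hσA : A * σ ^ (-(α / 4)) ≤ 1 / 2 := by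
    have h1 : σ ^ (α / 4) = 2 * A + 1 := by
      rw [← Real.rpow_mul (by positivity), inv_mul_cancel₀ hα4.ne', Real.rpow_one]
    rw [Real.rpow_neg hσ.le, h1, ← div_eq_mul_inv, div_le_div_iff₀ (by positivity) (by norm_num)]
    linarith
  set Q : ℝ := 2 * (c * κ * (1 + B₁))
  have hQ : 0 ≤ Q := by positivity
  set C₁ : ℝ := Real.exp (σ * T) * Q
  set C₂ : ℝ := κ * (1 + B₃) + κ * (1 + T ^ (1 - α / 2)) * (L' * Q) * (Real.exp (σ * T) * B₄)
  have hC₁ : 0 ≤ C₁ := by positivity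
  have hC₂ : 0 ≤ C₂ := by positivity
  refine ⟨C₁ + C₂, by positivity, ?_⟩
  intro M hM n φ lam y N u₀ f ψ g hS t ht
  set D : ℝ := ‖u₀‖ + M * t ^ η
  have hD : 0 ≤ D := add_nonneg (norm_nonneg _) (mul_nonneg hM (Real.rpow_nonneg ht.1.le _))
  have hsub : Icc 0 t ⊆ Icc 0 T := Icc_subset_Icc_right ht.2
  have hcont : ContinuousOn (fun s => s ^ (α / 2) * Real.exp (-(σ * s)) * N s) (Icc 0 t) := by
    refine ContinuousOn.mul ?_ (hS.continuousOn_N.mono hsub)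
    exact ((Real.continuous_rpow_const hα2.le).mul (by fun_prop)).continuousOn
  obtain ⟨tm, htm, hmax⟩ := isCompact_Icc.exists_isMaxOn ⟨0, le_rfl, ht.1.le⟩ hcont
  set q : ℝ := tm ^ (α / 2) * Real.exp (-(σ * tm)) * N tm
  have hq : 0 ≤ q := mul_nonneg (mul_nonneg (Real.rpow_nonneg htm.1 _) (Real.exp_pos _).le)
    (hS.N_nonneg tm (hsub htm))
  have hNq : ∀ s ∈ Ioc 0 t, N s ≤ q * (s ^ (1 - α / 2 - 1) * Real.exp (σ * s)) := by
    intro s hs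
    have h1 : s ^ (α / 2) * Real.exp (-(σ * s)) * N s ≤ q := hmax ⟨hs.1.le, hs.2⟩
    have h2 : N s = s ^ (α / 2) * Real.exp (-(σ * s)) * N s
        * (s ^ (1 - α / 2 - 1) * Real.exp (σ * s)) := by
      rw [show 1 - α / 2 - 1 = -(α / 2) by ring, Real.rpow_neg hs.1.le, Real.exp_neg]
      have := (Real.rpow_pos_of_pos hs.1 (α / 2)).ne'
      have := (Real.exp_pos (σ * s)).ne'
      field_simp
    rw [h2]
    exact mul_le_mul_of_nonneg_right h1
      (mul_nonneg (Real.rpow_nonneg hs.1.le _) (Real.exp_pos _).le)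
  have hqle : q ≤ Q * D := by
    rcases htm.1.eq_or_lt with h0 | h0
    · have : q = 0 := by
        simp only [q, ← h0, Real.zero_rpow hα2.ne', zero_mul]
      rw [this]
      positivity
    · have htmT : tm ∈ Ioc 0 T := ⟨h0, htm.2.trans ht.2⟩
      have h1 := hS.sqrt_sum_le hα hα₁ hη hL (w := fun j => √(1 + lam j))
        (fun j => Real.sqrt_nonneg _) (p := 1 - α / 2) (by linarith) hκ
        (fun j x hx => sqrt_one_add_mul_resE_le hα hα₁ (hS.lam_nonneg j) hx)
        (fun j x hx => sqrt_one_add_mul_resP_le hα hα₁ (hS.lam_nonneg j) hx)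
        hq hσ hα4.le (by linarith) htmT (fun s hs => hNq s ⟨hs.1, hs.2.trans htm.2⟩)
      have h2 := (hS.N_le tm (hsub htm)).trans (mul_le_mul_of_nonneg_left h1 hc)
      have hX : tm ^ (α / 2) * tm ^ (1 - α / 2 - 1) = 1 := by
        rw [← Real.rpow_add h0]
        ring_nf
        exact Real.rpow_zero _
      have hX2 : tm ^ (α / 2) * tm ^ (1 - α / 2 + η - 1) = tm ^ η := by
        rw [← Real.rpow_add h0]
        ring_nf
      have hX3 : tm ^ (α / 2) * tm ^ (-(α / 4)) = tm ^ (α / 4) := by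
        rw [← Real.rpow_add h0]
        ring_nf
      have hE : Real.exp (-(σ * tm)) ≤ 1 := Real.exp_le_one_iff.2 (by
        have := mul_pos hσ h0
        linarith)
      have hEE : Real.exp (-(σ * tm)) * Real.exp (σ * tm) = 1 := by
        rw [← Real.exp_add]
        simp
      have hE0 := (Real.exp_pos (-(σ * tm))).le
      have hDm : ‖u₀‖ + M * tm ^ η * B₁ ≤ (1 + B₁) * D := by
        have h3 : tm ^ η ≤ t ^ η := Real.rpow_le_rpow h0.le htm.2 hη.le
        have h4 : M * tm ^ η ≤ D := by
          have := mul_le_mul_of_nonneg_left h3 hM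
          have := norm_nonneg u₀
          simp only [D]
          linarith
        have h5 : ‖u₀‖ ≤ D := by
          have := mul_nonneg hM (Real.rpow_nonneg ht.1.le η)
          simp only [D]
          linarith
        have := mul_le_mul_of_nonneg_right h4 hB₁
        linarith
      have hT4 : tm ^ (α / 4) ≤ T ^ (α / 4) := Real.rpow_le_rpow h0.le htmT.2 hα4.le
      have hσp : 0 ≤ σ ^ (-(α / 4)) := Real.rpow_nonneg hσ.le _
      have h3 : q ≤ c * κ * ((1 + B₁) * D) + A * σ ^ (-(α / 4)) * q := by
        calc q ≤ tm ^ (α / 2) * Real.exp (-(σ * tm)) * (c * (κ * tm ^ (1 - α / 2 - 1) * ‖u₀‖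
              + κ * M * (tm ^ (1 - α / 2 + η - 1) * B₁)
              + κ * (1 + T ^ (1 - α / 2 - α / 2)) * (L' * q)
                * (Real.exp (σ * tm) * σ ^ (-(α / 4)) * (tm ^ (-(α / 4)) * B₂)))) :=
              mul_le_mul_of_nonneg_left h2 (mul_nonneg (Real.rpow_nonneg h0.le _) hE0)
          _ = Real.exp (-(σ * tm)) * (c * κ * (tm ^ (α / 2) * tm ^ (1 - α / 2 - 1) * ‖u₀‖
                + M * (tm ^ (α / 2) * tm ^ (1 - α / 2 + η - 1)) * B₁))
              + c * κ * (1 + T ^ (1 - α / 2 - α / 2)) * L' * B₂ * σ ^ (-(α / 4)) * q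
                * (Real.exp (-(σ * tm)) * Real.exp (σ * tm))
                * (tm ^ (α / 2) * tm ^ (-(α / 4))) := by ring
          _ = Real.exp (-(σ * tm)) * (c * κ * (‖u₀‖ + M * tm ^ η * B₁))
              + c * κ * (1 + T ^ (1 - α / 2 - α / 2)) * L' * B₂ * σ ^ (-(α / 4)) * q
                * tm ^ (α / 4) := by
              rw [hX, hX2, hX3, hEE]
              ring
          _ ≤ 1 * (c * κ * ((1 + B₁) * D))
              + c * κ * (1 + T ^ (1 - α / 2 - α / 2)) * L' * B₂ * σ ^ (-(α / 4)) * q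
                * T ^ (α / 4) := by
              have hu : 0 ≤ ‖u₀‖ + M * tm ^ η * B₁ := by
                have := Real.rpow_nonneg h0.le η
                positivity
              gcongr
          _ = _ := by
              simp only [A]
              ring
      have h4 : A * σ ^ (-(α / 4)) * q ≤ 1 / 2 * q := mul_le_mul_of_nonneg_right hσA hq
      have h5 : Q * D = 2 * (c * κ * ((1 + B₁) * D)) := by
        simp only [Q]
        ring
      linarith
  have hexp : Real.exp (σ * t) ≤ Real.exp (σ * T) :=
    Real.exp_le_exp.2 (mul_le_mul_of_nonneg_left ht.2 hσ.le)
  have hp1 := mul_nonneg hC₁ hD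
  have hp2 := mul_nonneg hC₂ hD
  constructor
  · have h1 := hS.sqrt_sum_le hα hα₁ hη hL (w := fun _ => 1) (fun _ => zero_le_one) (p := 1)
      (by linarith) hκ (fun j x hx => one_mul_resE_le hα hα₁ (hS.lam_nonneg j) hx)
      (fun j x hx => one_mul_resP_le hα hα₁ (hS.lam_nonneg j) hx) hq hσ le_rfl hα2 ht hNq
    simp only [one_mul, sub_self, neg_zero, Real.rpow_zero, mul_one, sub_zero,
      add_sub_cancel_left] at h1
    have hD1 : ‖u₀‖ ≤ D := by
      have := mul_nonneg hM (Real.rpow_nonneg ht.1.le η)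
      simp only [D]
      linarith
    have hD2 : M * t ^ η ≤ D := by
      have := norm_nonneg u₀
      simp only [D]
      linarith
    have h2 : κ * ‖u₀‖ + κ * M * (t ^ η * B₃) ≤ κ * (1 + B₃) * D := by
      have e1 := mul_le_mul_of_nonneg_left hD1 hκ
      have e2 := mul_le_mul_of_nonneg_left (mul_le_mul_of_nonneg_right hD2 hB₃) hκ
      linarith
    have h3 : κ * (1 + T ^ (1 - α / 2)) * (L' * q) * (Real.exp (σ * t) * B₄)
        ≤ κ * (1 + T ^ (1 - α / 2)) * (L' * (Q * D)) * (Real.exp (σ * T) * B₄) := by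
      have := Real.rpow_nonneg hT.le (1 - α / 2)
      gcongr
    calc √(∑ j, y j t ^ 2) ≤ C₂ * D := by
          refine h1.trans ?_
          simp only [C₂]
          linarith
      _ ≤ (C₁ + C₂) * D := by linarith
  · have h1 := mul_le_mul_of_nonneg_left (hNq t ⟨ht.1, le_rfl⟩) (Real.rpow_nonneg ht.1.le (α / 2))
    have hX : t ^ (α / 2) * t ^ (1 - α / 2 - 1) = 1 := by
      rw [← Real.rpow_add ht.1]
      ring_nf
      exact Real.rpow_zero _
    calc t ^ (α / 2) * N t ≤ t ^ (α / 2) * (q * (t ^ (1 - α / 2 - 1) * Real.exp (σ * t))) := h1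
      _ = t ^ (α / 2) * t ^ (1 - α / 2 - 1) * (Real.exp (σ * t) * q) := by ring
      _ ≤ 1 * (Real.exp (σ * T) * (Q * D)) := by
          rw [hX]
          gcongr
      _ = C₁ * D := by
          simp only [C₁]
          ring
      _ ≤ (C₁ + C₂) * D := by linarith

end

section

variable {d : ℕ} {Ω : TopologicalSpace.Opens (Rd d)}

/-- The trace of a `d × d` matrix. -/
def traceL (d : ℕ) : (Rd d →L[ℝ] Rd d) →L[ℝ] ℝ :=
  ∑ i : Fin d, (EuclideanSpace.proj i : Rd d →L[ℝ] ℝ) ∘L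
    ContinuousLinearMap.apply ℝ (Rd d) (EuclideanSpace.single i (1 : ℝ))

theorem traceL_apply (D : Rd d →L[ℝ] Rd d) :
    traceL d D = ∑ i, D (EuclideanSpace.single i (1 : ℝ)) i := by
  simp [traceL]

/-- The divergence `W¹_∞(Ω)ᵈ → L∞(Ω)`. -/
def divL (Ω : TopologicalSpace.Opens (Rd d)) : W1inf Ω →L[ℝ] Linf Ω :=
  (traceL d).compLpL ∞ (vol Ω) ∘L ContinuousLinearMap.snd ℝ (LinfVec Ω) (LinfMat Ω) ∘L
    (W1infSub Ω).subtypeL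

/-- The pointwise product `(F, ξ) ↦ F · ξ`. -/
def dotL (Ω : TopologicalSpace.Opens (Rd d)) : LinfVec Ω →L[ℝ] L2vec Ω →L[ℝ] L2 Ω :=
  (innerSL ℝ : Rd d →L[ℝ] Rd d →L[ℝ] ℝ).holderL (vol Ω) ∞ 2 2

/-- The pointwise product `(a, v) ↦ a v`. -/
def mulL (Ω : TopologicalSpace.Opens (Rd d)) : Linf Ω →L[ℝ] L2 Ω →L[ℝ] L2 Ω :=
  (ContinuousLinearMap.mul ℝ ℝ).holderL (vol Ω) ∞ 2 2

/-- The operator `v ↦ F · ∇v + (div F) v = div (F v)`, for `F ∈ W¹_∞(Ω)ᵈ`. -/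
def divMul (Ω : TopologicalSpace.Opens (Rd d)) : W1inf Ω →L[ℝ] H10 Ω →L[ℝ] L2 Ω :=
  (ContinuousLinearMap.compL ℝ (H10 Ω) (L2vec Ω) (L2 Ω)).flip (grad Ω) ∘L dotL Ω ∘L toLinf Ω
    + (ContinuousLinearMap.compL ℝ (H10 Ω) (L2 Ω) (L2 Ω)).flip (toL2 Ω) ∘L mulL Ω ∘L divL Ω

theorem divMul_apply (F : W1inf Ω) (v : H10 Ω) :
    divMul Ω F v = dotL Ω (toLinf Ω F) (grad Ω v) + mulL Ω (divL Ω F) (toL2 Ω v) := rfl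

/-- The product of two test functions. -/
def testMul (φ ψ : 𝓓(Ω, ℝ)) : 𝓓(Ω, ℝ) :=
  ⟨fun x => φ x * ψ x, φ.contDiff.mul ψ.contDiff, φ.hasCompactSupport.mul_right,
    (tsupport_mul_subset_left).trans φ.tsupport_subset⟩

theorem testMul_apply (φ ψ : 𝓓(Ω, ℝ)) (x : Rd d) : testMul φ ψ x = φ x * ψ x := rfl

theorem fderiv_testMul (φ ψ : 𝓓(Ω, ℝ)) (x y : Rd d) :
    fderiv ℝ (testMul φ ψ) x y = φ x * fderiv ℝ ψ x y + ψ x * fderiv ℝ φ x y := by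
  have h1 : DifferentiableAt ℝ φ x := φ.contDiff.differentiable (by simp) x
  have h2 : DifferentiableAt ℝ ψ x := ψ.contDiff.differentiable (by simp) x
  have : (testMul φ ψ : Rd d → ℝ) = fun x => φ x * ψ x := rfl
  rw [this, fderiv_fun_mul h1 h2]
  simp

theorem inner_gradient_eq {f : Rd d → ℝ} (x ξ : Rd d) :
    inner ℝ ξ (gradient f x) = ∑ i, ξ i * fderiv ℝ f x (EuclideanSpace.single i (1 : ℝ)) := by
  rw [real_inner_comm, gradient, InnerProductSpace.toDual_symm_apply]
  conv_lhs => rw [← (EuclideanSpace.basisFun (Fin d) ℝ).sum_repr ξ]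
  simp

theorem inner_gradient_testMul (φ ψ : 𝓓(Ω, ℝ)) (x ξ : Rd d) :
    inner ℝ ξ (gradient (testMul φ ψ) x)
      = φ x * inner ℝ ξ (gradient ψ x) + ψ x * inner ℝ ξ (gradient φ x) := by
  simp only [inner_gradient_eq, fderiv_testMul, Finset.mul_sum, ← Finset.sum_add_distrib]
  exact Finset.sum_congr rfl fun i _ => by ring

theorem integral_test_div (F : W1inf Ω) (φ : 𝓓(Ω, ℝ)) :
    ∫ x, (inner ℝ (toLinf Ω F x) (gradient φ x) + φ x * divL Ω F x) ∂(vol Ω) = 0 := by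
  have hF : HasWeakJacobian Ω (toLinf Ω F) (W1infSub Ω |>.subtypeL F).2 := F.2
  set D := ((W1infSub Ω).subtypeL F).2
  set E : Fin d → Rd d := fun i => EuclideanSpace.single i (1 : ℝ)
  have hi1 : ∀ i, Integrable (fun x => fderiv ℝ φ x (E i) • toLinf Ω F x) (vol Ω) := fun i =>
    integrable_fderiv_test_smul φ (E i) le_top (Lp.memLp (toLinf Ω F))
  have hi2 : ∀ i, Integrable (fun x => φ x • D x (E i)) (vol Ω) := fun i =>
    integrable_test_smul φ le_top
      ((ContinuousLinearMap.apply ℝ (Rd d) (E i)).comp_memLp' (Lp.memLp D))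
  have key : ∀ i, ∫ x, (fderiv ℝ φ x (E i) * toLinf Ω F x i + φ x * D x (E i) i) ∂(vol Ω) = 0 := by
    intro i
    have h1 := (EuclideanSpace.proj i : Rd d →L[ℝ] ℝ).integral_comp_comm (hi1 i)
    have h2 := (EuclideanSpace.proj i : Rd d →L[ℝ] ℝ).integral_comp_comm (hi2 i)
    have h3 := congrArg (fun v : Rd d => v i) (hF φ (E i))
    simp only [PiLp.proj_apply, PiLp.smul_apply, smul_eq_mul, PiLp.neg_apply] at h1 h2 h3
    rw [integral_add, h1, h2, h3, neg_add_cancel]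
    · exact ((EuclideanSpace.proj i : Rd d →L[ℝ] ℝ).integrable_comp (hi1 i))
    · exact ((EuclideanSpace.proj i : Rd d →L[ℝ] ℝ).integrable_comp (hi2 i))
  have hdiv : divL Ω F =ᵐ[vol Ω] fun x => traceL d (D x) := (traceL d).coeFn_compLpL D
  have h4 : ∫ x, (inner ℝ (toLinf Ω F x) (gradient φ x) + φ x * divL Ω F x) ∂(vol Ω)
      = ∫ x, ∑ i, (fderiv ℝ φ x (E i) * toLinf Ω F x i + φ x * D x (E i) i) ∂(vol Ω) := by
    refine integral_congr_ae ?_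
    filter_upwards [hdiv] with x hx
    rw [hx, inner_gradient_eq, traceL_apply, Finset.sum_add_distrib, Finset.mul_sum]
    congr 1
    exact Finset.sum_congr rfl fun i _ => mul_comm _ _
  rw [h4, integral_finsetSum]
  · exact Finset.sum_eq_zero fun i _ => key i
  · intro i _
    exact ((EuclideanSpace.proj i : Rd d →L[ℝ] ℝ).integrable_comp (hi1 i)).add
      ((EuclideanSpace.proj i : Rd d →L[ℝ] ℝ).integrable_comp (hi2 i))

theorem mulVec_coeFn (F : LinfVec Ω) (v : L2 Ω) : mulVec F v =ᵐ[vol Ω] fun x => v x • F x :=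
  ContinuousLinearMap.coeFn_holder _ _ _

theorem dotL_coeFn (F : LinfVec Ω) (ξ : L2vec Ω) :
    dotL Ω F ξ =ᵐ[vol Ω] fun x => inner ℝ (F x) (ξ x) :=
  ContinuousLinearMap.coeFn_holder _ _ _

theorem mulL_coeFn (a : Linf Ω) (v : L2 Ω) : mulL Ω a v =ᵐ[vol Ω] fun x => a x * v x :=
  ContinuousLinearMap.coeFn_holder _ _ _

theorem mulMat_coeFn (κ : LinfMat Ω) (ξ : L2vec Ω) : mulMat κ ξ =ᵐ[vol Ω] fun x => κ x (ξ x) :=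
  ContinuousLinearMap.coeFn_holder _ _ _

theorem inner_mulVec_testPairs (F : W1inf Ω) {p q : WithLp 2 (L2 Ω × L2vec Ω)}
    (hp : p ∈ testPairs Ω) (hq : q ∈ testPairs Ω) :
    inner ℝ (mulVec (toLinf Ω F) p.fst) q.snd
      + inner ℝ (dotL Ω (toLinf Ω F) p.snd + mulL Ω (divL Ω F) p.fst) q.fst = 0 := by
  obtain ⟨φ, hφ1, hφ2⟩ := hp
  obtain ⟨ψ, hψ1, hψ2⟩ := hq
  have hpq := integral_test_div F (testMul φ ψ)
  rw [L2.inner_def, L2.inner_def, ← integral_add (L2.integrable_inner _ _)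
    (L2.integrable_inner _ _), ← hpq]
  refine integral_congr_ae ?_
  filter_upwards [hφ1, hφ2, hψ1, hψ2, mulVec_coeFn (toLinf Ω F) p.fst,
    Lp.coeFn_add (dotL Ω (toLinf Ω F) p.snd) (mulL Ω (divL Ω F) p.fst),
    dotL_coeFn (toLinf Ω F) p.snd, mulL_coeFn (divL Ω F) p.fst] with x h1 h2 h3 h4 h5 h6 h7 h8
  rw [h5, h6, Pi.add_apply, h7, h8, h1, h2, h3, h4, inner_smul_left, inner_gradient_testMul,
    testMul_apply]
  have hre : ∀ a b : ℝ, inner ℝ a b = a * b := fun a b => by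
    rw [real_inner_comm]
    simp
  simp only [hre, conj_trivial]
  ring

/-- Integration by parts: `⟨F v, ∇w⟩ = -⟨F · ∇v + (div F) v, w⟩` for `v, w ∈ H¹₀(Ω)`. -/
theorem inner_mulVec_grad (F : W1inf Ω) (v w : H10 Ω) :
    inner ℝ (mulVec (toLinf Ω F) (toL2 Ω v)) (grad Ω w) = -inner ℝ (divMul Ω F v) (toL2 Ω w) := by
  rw [eq_neg_iff_add_eq_zero, divMul_apply]
  set E := WithLp 2 (L2 Ω × L2vec Ω)
  set f₁ := WithLp.fstL 2 ℝ (L2 Ω) (L2vec Ω)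
  set f₂ := WithLp.sndL 2 ℝ (L2 Ω) (L2vec Ω)
  set m : L2 Ω →L[ℝ] L2vec Ω := mulVec (toLinf Ω F)
  set D : E →L[ℝ] L2 Ω := dotL Ω (toLinf Ω F) ∘L f₂ + mulL Ω (divL Ω F) ∘L f₁
  have h1 : ∀ p ∈ testPairs Ω, ∀ q ∈ (Submodule.span ℝ (testPairs Ω)).topologicalClosure,
      inner ℝ (m (f₁ p)) (f₂ q) + inner ℝ (D p) (f₁ q) = 0 := by
    intro p hp
    set ℓ : E →L[ℝ] ℝ := innerSL ℝ (m (f₁ p)) ∘L f₂ + innerSL ℝ (D p) ∘L f₁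
    have : (Submodule.span ℝ (testPairs Ω)).topologicalClosure ≤ LinearMap.ker ℓ.toLinearMap :=
      Submodule.topologicalClosure_minimal _
        (Submodule.span_le.2 fun q hq => inner_mulVec_testPairs F hp hq) ℓ.isClosed_ker
    exact fun q hq => this hq
  have h2 : ∀ q ∈ (Submodule.span ℝ (testPairs Ω)).topologicalClosure,
      ∀ p ∈ (Submodule.span ℝ (testPairs Ω)).topologicalClosure,
      inner ℝ (m (f₁ p)) (f₂ q) + inner ℝ (D p) (f₁ q) = 0 := by
    intro q hq
    set ℓ : E →L[ℝ] ℝ := innerSL ℝ (f₂ q) ∘L m ∘L f₁ + innerSL ℝ (f₁ q) ∘L D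
    have hℓ : ∀ p, ℓ p = inner ℝ (m (f₁ p)) (f₂ q) + inner ℝ (D p) (f₁ q) := fun p => by
      rw [real_inner_comm, real_inner_comm (f₁ q)]
      rfl
    have : (Submodule.span ℝ (testPairs Ω)).topologicalClosure ≤ LinearMap.ker ℓ.toLinearMap :=
      Submodule.topologicalClosure_minimal _
        (Submodule.span_le.2 fun p hp => (hℓ p).trans (h1 p hp q hq)) ℓ.isClosed_ker
    exact fun p hp => (hℓ p).symm.trans (this hp)
  exact h2 _ w.2.2 _ v.2.2

/-! ### The diffusion form -/

theorem inner_mulMat_comm {κ : LinfMat Ω}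
    (hκ : ∀ᵐ x ∂(vol Ω), (κ x : Rd d →ₗ[ℝ] Rd d).IsSymmetric) (ξ ζ : L2vec Ω) :
    inner ℝ (mulMat κ ξ) ζ = inner ℝ (mulMat κ ζ) ξ := by
  rw [L2.inner_def, L2.inner_def]
  refine integral_congr_ae ?_
  filter_upwards [hκ, mulMat_coeFn κ ξ, mulMat_coeFn κ ζ] with x h1 h2 h3
  rw [h2, h3, real_inner_comm (ξ x)]
  exact h1 (ξ x) (ζ x)

theorem mul_norm_sq_le_inner_of_eigenvalues {A : Rd d →ₗ[ℝ] Rd d} (hA : A.IsSymmetric) {c₀ : ℝ}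
    (h : ∀ lam : ℝ, Module.End.HasEigenvalue A lam → c₀ ≤ lam) (ξ : Rd d) :
    c₀ * ‖ξ‖ ^ 2 ≤ inner ℝ (A ξ) ξ := by
  have hn : Module.finrank ℝ (Rd d) = d := by simp
  set b := hA.eigenvectorBasis hn
  have h1 : inner ℝ (A ξ) ξ = ∑ i, hA.eigenvalues hn i * inner ℝ ξ (b i) ^ 2 := by
    rw [← b.sum_inner_mul_inner (A ξ) ξ]
    refine Finset.sum_congr rfl fun i _ => ?_
    rw [hA ξ (b i), hA.apply_eigenvectorBasis hn i, inner_smul_right, real_inner_comm ξ (b i)]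
    simp only [RCLike.ofReal_real_eq_id, id]
    ring
  have h2 : ‖ξ‖ ^ 2 = ∑ i, inner ℝ ξ (b i) ^ 2 := by
    rw [← real_inner_self_eq_norm_sq, ← b.sum_inner_mul_inner ξ ξ]
    refine Finset.sum_congr rfl fun i _ => ?_
    rw [real_inner_comm ξ (b i)]
    ring
  rw [h1, h2, Finset.mul_sum]
  refine Finset.sum_le_sum fun i _ => mul_le_mul_of_nonneg_right ?_ (sq_nonneg _)
  exact h _ (hA.hasEigenvalue_eigenvalues hn i)

theorem mul_norm_sq_le_inner_mulMat {κ : LinfMat Ω} {c₀ : ℝ}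
    (hκ : ∀ᵐ x ∂(vol Ω), (κ x : Rd d →ₗ[ℝ] Rd d).IsSymmetric ∧
      ∀ lam : ℝ, Module.End.HasEigenvalue (κ x : Rd d →ₗ[ℝ] Rd d) lam → c₀ ≤ lam)
    (ξ : L2vec Ω) : c₀ * ‖ξ‖ ^ 2 ≤ inner ℝ (mulMat κ ξ) ξ := by
  rw [← real_inner_self_eq_norm_sq, L2.inner_def, L2.inner_def, ← integral_const_mul]
  refine integral_mono_ae ((L2.integrable_inner _ _).const_mul _) (L2.integrable_inner _ _) ?_
  filter_upwards [hκ, mulMat_coeFn κ ξ] with x h1 h2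
  rw [h2, real_inner_self_eq_norm_sq]
  exact mul_norm_sq_le_inner_of_eigenvalues h1.1 h1.2 (ξ x)

/-! ### Simultaneous diagonalization -/

/-- A symmetric form on a finite-dimensional space is diagonal in some basis that is orthonormal for
the inner product pulled back by an injective map `ι`. -/
theorem exists_orthonormal_diagonalizing {V H : Type*} [AddCommGroup V] [Module ℝ V]
    [FiniteDimensional ℝ V] [NormedAddCommGroup H] [InnerProductSpace ℝ H] (ι : V →ₗ[ℝ] H)
    (hι : Function.Injective ι) (a : V →ₗ[ℝ] V →ₗ[ℝ] ℝ) (ha : ∀ v w, a v w = a w v) :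
    ∃ (n : ℕ) (e : Fin n → V) (lam : Fin n → ℝ), Orthonormal ℝ (fun j => ι (e j)) ∧
      (∀ j w, a (e j) w = lam j * inner ℝ (ι (e j)) (ι w)) ∧
      ∀ v, v = ∑ j, inner ℝ (ι v) (ι (e j)) • e j := by
  set Y := LinearMap.range ι
  set ε : V ≃ₗ[ℝ] Y := LinearEquiv.ofInjective ι hι
  have hε : ∀ v, ((ε v : Y) : H) = ι v := fun v => rfl
  have : FiniteDimensional ℝ Y := LinearMap.finiteDimensional_range ι
  set a' : Y →ₗ[ℝ] Y →ₗ[ℝ] ℝ := a.compl₁₂ ε.symm.toLinearMap ε.symm.toLinearMap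
  set A : Y →ₗ[ℝ] Y :=
    { toFun := fun v => (InnerProductSpace.toDual ℝ Y).symm (LinearMap.toContinuousLinearMap (a' v))
      map_add' := fun v w => by simp
      map_smul' := fun r v => by simp }
  have hA : ∀ v w, inner ℝ (A v) w = a (ε.symm v) (ε.symm w) := fun v w => by
    simp [A, a', InnerProductSpace.toDual_symm_apply]
  have hsymm : A.IsSymmetric := fun v w => by
    rw [hA, real_inner_comm, hA, ha]
  set b := hsymm.eigenvectorBasis (n := Module.finrank ℝ Y) rfl
  refine ⟨Module.finrank ℝ Y, fun j => ε.symm (b j), hsymm.eigenvalues rfl, ?_, ?_, ?_⟩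
  · have h1 : (fun j => ι (ε.symm (b j))) = fun j => ((b j : Y) : H) := by
      ext j
      rw [← hε, LinearEquiv.apply_symm_apply]
    rw [h1]
    exact b.orthonormal.comp_linearIsometry Y.subtypeₗᵢ
  · intro j w
    have h1 := hA (b j) (ε w)
    rw [hsymm.apply_eigenvectorBasis rfl j, inner_smul_left, LinearEquiv.symm_apply_apply] at h1
    rw [← h1, ← hε, ← hε, LinearEquiv.apply_symm_apply, Submodule.coe_inner, conj_trivial]
    rfl
  · intro v
    apply ε.injective
    rw [map_sum]
    conv_lhs => rw [← b.sum_repr' (ε v)]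
    refine Finset.sum_congr rfl fun j _ => ?_
    rw [map_smul, ← hε, ← hε, LinearEquiv.apply_symm_apply, real_inner_comm, Submodule.coe_inner]

end

section

/-! ### Integration by parts in time -/

/-- The derivative `ω_α'(t) = (α-1) t^{α-2} / Γ(α)`. -/
def domega (α t : ℝ) : ℝ := (α - 1) * t ^ (α - 2) / Real.Gamma α

variable {α : ℝ}

theorem hasDerivAt_omega {x : ℝ} (hx : 0 < x) : HasDerivAt (omega α) (domega α x) x := by
  have h := (Real.hasDerivAt_rpow_const (p := α - 1) (Or.inl hx.ne')).div_const (Real.Gamma α)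
  have h2 : domega α x = (α - 1) * x ^ (α - 1 - 1) / Real.Gamma α := by
    rw [domega, show α - 1 - 1 = α - 2 by ring]
  rw [h2]
  exact h

theorem abs_domega_mul_le (hα : 0 < α) (hα₁ : α < 1) {x b K : ℝ} (hx : 0 < x)
    (hb : |b| ≤ K * x) : |domega α x * b| ≤ (1 - α) / Real.Gamma α * K * x ^ (α - 1) := by
  have hΓ := Real.Gamma_pos_of_pos hα
  have h1 : |domega α x| = (1 - α) / Real.Gamma α * x ^ (α - 2) := by
    rw [domega, abs_div, abs_mul, abs_of_pos hΓ, abs_of_neg (by linarith),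
      abs_of_pos (Real.rpow_pos_of_pos hx _)]
    ring
  have h2 : x ^ (α - 1) = x ^ (α - 2) * x := by
    rw [← Real.rpow_add_one hx.ne']
    ring_nf
  have h3 : 0 ≤ (1 - α) / Real.Gamma α * x ^ (α - 2) :=
    mul_nonneg (div_nonneg (by linarith) hΓ.le) (Real.rpow_nonneg hx.le _)
  rw [abs_mul, h1, h2]
  calc _ ≤ (1 - α) / Real.Gamma α * x ^ (α - 2) * (K * x) := mul_le_mul_of_nonneg_left hb h3
    _ = _ := by ring

theorem continuousOn_domega : ContinuousOn (domega α) (Ioi 0) := fun x hx =>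
  ((continuousAt_const.mul (Real.continuousAt_rpow_const x _ (Or.inl (ne_of_gt hx)))).div_const
    _).continuousWithinAt

open Filter Topology in
theorem omega_mul_sub_integral (hα : 0 < α) (hα₁ : α < 1) {β β' : ℝ → ℝ} {s t : ℝ} (hst : s < t)
    (hβ : ∀ z ∈ Icc s t, HasDerivWithinAt β (β' z) (Icc s t) z) (hβ' : ContinuousOn β' (Icc s t)) :
    omega α (t - s) * β t - ∫ z in s..t, omega α (z - s) * β' z
      = omega α (t - s) * β s + ∫ z in s..t, domega α (z - s) * (β z - β s) := by
  obtain ⟨K, hK⟩ := isCompact_Icc.exists_bound_of_continuousOn hβ'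
  have hs : s ∈ Icc s t := ⟨le_rfl, hst.le⟩
  have hLip : ∀ z ∈ Icc s t, |β z - β s| ≤ K * (z - s) := fun z hz => by
    have := Convex.norm_image_sub_le_of_norm_hasDerivWithin_le hβ hK (convex_Icc s t) hs hz
    rwa [Real.norm_eq_abs, Real.norm_eq_abs, abs_of_nonneg (sub_nonneg.2 hz.1)] at this
  have hβc : ContinuousOn β (Icc s t) := fun z hz => (hβ z hz).continuousWithinAt
  have hΓ := Real.Gamma_pos_of_pos hα
  set g : ℝ → ℝ := fun z => omega α (z - s) * (β z - β s)
  have hcont : ContinuousOn g (Icc s t) := by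
    intro z hz
    rcases hz.1.eq_or_lt with rfl | hsz
    · have hg0 : g s = 0 := by simp [g]
      rw [ContinuousWithinAt, hg0]
      have hlim : Tendsto (fun z => K / Real.Gamma α * (z - s) ^ α) (𝓝[Icc s t] s) (𝓝 0) := by
        have : Continuous fun z : ℝ => K / Real.Gamma α * (z - s) ^ α :=
          continuous_const.mul
            ((Real.continuous_rpow_const hα.le).comp (continuous_id.sub continuous_const))
        have h := this.tendsto s
        rw [sub_self, Real.zero_rpow hα.ne', mul_zero] at h
        exact h.mono_left nhdsWithin_le_nhds
      refine squeeze_zero_norm' ?_ hlim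
      filter_upwards [self_mem_nhdsWithin] with z hz
      rcases hz.1.eq_or_lt with rfl | hsz
      · simp [g, Real.zero_rpow hα.ne']
      · have hzs : 0 < z - s := sub_pos.2 hsz
        simp only [g]
        rw [norm_mul, Real.norm_eq_abs, Real.norm_eq_abs, abs_of_pos (omega_pos hα hzs)]
        calc omega α (z - s) * |β z - β s| ≤ omega α (z - s) * (K * (z - s)) :=
              mul_le_mul_of_nonneg_left (hLip z hz) (omega_pos hα hzs).le
          _ = K / Real.Gamma α * (z - s) ^ α := by
              rw [omega, Real.rpow_sub_one hzs.ne']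
              field_simp
    · have h1 : ContinuousAt (fun z => omega α (z - s)) z :=
        ((hasDerivAt_omega (sub_pos.2 hsz)).comp_sub_const z s).continuousAt
      exact h1.continuousWithinAt.mul ((hβc z hz).sub continuousWithinAt_const)
  have hderiv : ∀ z ∈ Ioo s t, HasDerivAt g
      (domega α (z - s) * (β z - β s) + omega α (z - s) * β' z) z := by
    intro z hz
    have h1 : HasDerivAt (fun z => omega α (z - s)) (domega α (z - s)) z :=
      (hasDerivAt_omega (sub_pos.2 hz.1)).comp_sub_const z s
    have h2 := (hβ z ⟨hz.1.le, hz.2.le⟩).hasDerivAt (Icc_mem_nhds hz.1 hz.2)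
    exact h1.mul (h2.sub_const (β s))
  have hi1 : IntervalIntegrable (fun z => domega α (z - s) * (β z - β s)) volume s t := by
    rw [intervalIntegrable_iff_integrableOn_Ioo_of_le hst.le]
    have hdom : IntegrableOn (fun z => (1 - α) / Real.Gamma α * K * (z - s) ^ (α - 1))
        (Ioo s t) := by
      rw [← intervalIntegrable_iff_integrableOn_Ioo_of_le hst.le]
      have := (intervalIntegrable_rpow_sub_one hα 0 (t - s)).comp_sub_right s
      simp only [zero_add, sub_add_cancel] at this
      exact this.const_mul _
    refine Integrable.mono' hdom (ContinuousOn.aestronglyMeasurable ?_ measurableSet_Ioo) ?_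
    · refine ContinuousOn.mul ?_ ((hβc.mono Ioo_subset_Icc_self).sub continuousOn_const)
      exact continuousOn_domega.comp (by fun_prop) fun z hz => sub_pos.2 hz.1
    · filter_upwards [ae_restrict_mem measurableSet_Ioo] with z hz
      exact abs_domega_mul_le hα hα₁ (sub_pos.2 hz.1) (hLip z ⟨hz.1.le, hz.2.le⟩)
  have hi2 : IntervalIntegrable (fun z => omega α (z - s) * β' z) volume s t := by
    have := (intervalIntegrable_omega hα 0 (t - s)).comp_sub_right s
    simp only [zero_add, sub_add_cancel] at this
    exact this.mul_continuousOn (by rwa [uIcc_of_le hst.le])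
  have h := intervalIntegral.integral_eq_sub_of_hasDerivAt_of_le hst.le hcont hderiv (hi1.add hi2)
  rw [intervalIntegral.integral_add hi1 hi2] at h
  simp only [g, sub_self, mul_zero, sub_zero] at h
  linarith

/-! ### The memory term -/

section Memory

variable {V H : Type*} [NormedAddCommGroup V] [NormedSpace ℝ V] [NormedAddCommGroup H]
  [InnerProductSpace ℝ H]

theorem integrable_tri_of_norm_le (hα : 0 < α) {F : ℝ → ℝ → ℝ} {t C : ℝ} (ht : 0 ≤ t)
    (hF : ContinuousOn (Function.uncurry F) (tri ∩ Ioc 0 t ×ˢ Ioc 0 t))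
    (hC : ∀ s r, 0 < r → r < s → s ≤ t → |F s r| ≤ C * (s - r) ^ (α - 1)) :
    Integrable (tri.indicator (Function.uncurry F)) (sqMeasure t) := by
  have hdom := (integrable_tri_left ht (intervalIntegrable_const (c := C))
    (intervalIntegrable_rpow_sub_one hα 0 t))
  have hset : MeasurableSet (Ioc 0 t ×ˢ Ioc 0 t : Set (ℝ × ℝ)) :=
    measurableSet_Ioc.prod measurableSet_Ioc
  refine hdom.mono' ?_ ?_
  · rw [sqMeasure, Measure.prod_restrict, aestronglyMeasurable_indicator_iff measurableSet_tri,
      Measure.restrict_restrict measurableSet_tri]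
    exact hF.aestronglyMeasurable (measurableSet_tri.inter hset)
  · rw [sqMeasure, Measure.prod_restrict]
    filter_upwards [ae_restrict_mem hset] with x hx
    by_cases hxt : x ∈ tri
    · rw [indicator_of_mem hxt, indicator_of_mem hxt]
      exact hC x.1 x.2 hx.2.1 hxt hx.1.2
    · simp [indicator_of_notMem hxt]

/-- The memory term `∫₀ᶻ ω_α'(z-s) (B(z) - B(s)) u(s) ds`. -/
def memTerm (α : ℝ) (B : ℝ → V →L[ℝ] H) (u : ℝ → V) (z : ℝ) : H :=
  ∫ s in (0 : ℝ)..z, domega α (z - s) • (B z - B s) (u s)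

variable {B : ℝ → V →L[ℝ] H} {u : ℝ → V} {T K : ℝ}

theorem norm_memTerm_integrand_le (hα : 0 < α) (hα₁ : α < 1)
    (hLip : ∀ z ∈ Icc 0 T, ∀ s ∈ Icc 0 T, ‖B z - B s‖ ≤ K * |z - s|) {z s : ℝ} (hs : 0 < s)
    (hsz : s < z) (hz : z ≤ T) :
    ‖domega α (z - s) • (B z - B s) (u s)‖
      ≤ (1 - α) / Real.Gamma α * K * ((z - s) ^ (α - 1) * ‖u s‖) := by
  have hzs : 0 < z - s := sub_pos.2 hsz
  have h1 : ‖(B z - B s) (u s)‖ ≤ K * ‖u s‖ * (z - s) := by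
    have h2 := hLip z ⟨(hs.trans hsz).le, hz⟩ s ⟨hs.le, hsz.le.trans hz⟩
    rw [abs_of_pos hzs] at h2
    calc ‖(B z - B s) (u s)‖ ≤ K * (z - s) * ‖u s‖ := (B z - B s).le_of_opNorm_le h2 _
      _ = _ := by ring
  have h3 := abs_domega_mul_le hα hα₁ hzs (b := ‖(B z - B s) (u s)‖) (K := K * ‖u s‖)
    (by rwa [abs_of_nonneg (norm_nonneg _)])
  rw [norm_smul, Real.norm_eq_abs]
  rw [abs_mul, abs_of_nonneg (norm_nonneg _)] at h3
  exact h3.trans_eq (by ring)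

theorem intervalIntegrable_memTerm (hα : 0 < α) (hα₁ : α < 1) (hB : ContinuousOn B (Icc 0 T))
    (hLip : ∀ z ∈ Icc 0 T, ∀ s ∈ Icc 0 T, ‖B z - B s‖ ≤ K * |z - s|)
    (hu : ContinuousOn u (Icc 0 T)) {z : ℝ} (hz : z ∈ Ioc 0 T) :
    IntervalIntegrable (fun s => domega α (z - s) • (B z - B s) (u s)) volume 0 z := by
  have hsub : Ioo 0 z ⊆ Icc 0 T := fun s hs => ⟨hs.1.le, hs.2.le.trans hz.2⟩
  rw [intervalIntegrable_iff_integrableOn_Ioo_of_le hz.1.le]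
  have hdom : IntegrableOn (fun s => (1 - α) / Real.Gamma α * K * ((z - s) ^ (α - 1) * ‖u s‖))
      (Ioo 0 z) := by
    rw [← intervalIntegrable_iff_integrableOn_Ioo_of_le hz.1.le]
    refine ((intervalIntegrable_sub_rpow_sub_one hα z 0 z).mul_continuousOn ?_).const_mul _
    rw [uIcc_of_le hz.1.le]
    exact (hu.mono (Icc_subset_Icc_right hz.2)).norm
  refine Integrable.mono' hdom (ContinuousOn.aestronglyMeasurable ?_ measurableSet_Ioo) ?_
  · refine ContinuousOn.smul ?_ ?_
    · exact continuousOn_domega.comp (by fun_prop) fun s hs => sub_pos.2 hs.2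
    · exact (continuousOn_const.sub (hB.mono hsub)).clm_apply (hu.mono hsub)
  · filter_upwards [ae_restrict_mem measurableSet_Ioo] with s hs
    exact norm_memTerm_integrand_le hα hα₁ hLip hs.1 hs.2 hz.2

theorem norm_memTerm_le (hα : 0 < α) (hα₁ : α < 1)
    (hLip : ∀ z ∈ Icc 0 T, ∀ s ∈ Icc 0 T, ‖B z - B s‖ ≤ K * |z - s|)
    (hu : ContinuousOn u (Icc 0 T)) {z : ℝ} (hz : z ∈ Ioc 0 T) :
    ‖memTerm α B u z‖
      ≤ (1 - α) / Real.Gamma α * K * ∫ s in (0 : ℝ)..z, (z - s) ^ (α - 1) * ‖u s‖ := by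
  rw [memTerm, ← intervalIntegral.integral_const_mul, intervalIntegral.integral_of_le hz.1.le,
    intervalIntegral.integral_of_le hz.1.le, integral_Ioc_eq_integral_Ioo,
    integral_Ioc_eq_integral_Ioo]
  refine norm_integral_le_of_norm_le ?_ ?_
  · change IntegrableOn _ _ _
    rw [← intervalIntegrable_iff_integrableOn_Ioo_of_le hz.1.le]
    refine ((intervalIntegrable_sub_rpow_sub_one hα z 0 z).mul_continuousOn ?_).const_mul _
    rw [uIcc_of_le hz.1.le]
    exact (hu.mono (Icc_subset_Icc_right hz.2)).norm
  · filter_upwards [ae_restrict_mem measurableSet_Ioo] with s hs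
    exact norm_memTerm_integrand_le hα hα₁ hLip hs.1 hs.2 hz.2

theorem inner_memTerm [CompleteSpace H] (hα : 0 < α) (hα₁ : α < 1) (hB : ContinuousOn B (Icc 0 T))
    (hLip : ∀ z ∈ Icc 0 T, ∀ s ∈ Icc 0 T, ‖B z - B s‖ ≤ K * |z - s|)
    (hu : ContinuousOn u (Icc 0 T)) {z : ℝ} (hz : z ∈ Ioc 0 T) (w : H) :
    inner ℝ (memTerm α B u z) w
      = ∫ s in (0 : ℝ)..z, domega α (z - s) * inner ℝ ((B z - B s) (u s)) w := by
  have h := (innerSL ℝ w).intervalIntegral_comp_comm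
    (intervalIntegrable_memTerm hα hα₁ hB hLip hu hz)
  rw [memTerm, real_inner_comm]
  refine h.symm.trans (intervalIntegral.integral_congr fun s _ => ?_)
  simp only [innerSL_apply_apply, inner_smul_right]
  rw [real_inner_comm]

theorem integrable_tri_memTerm (hα : 0 < α) (hα₁ : α < 1) (hB : ContinuousOn B (Icc 0 T))
    (hLip : ∀ z ∈ Icc 0 T, ∀ s ∈ Icc 0 T, ‖B z - B s‖ ≤ K * |z - s|) (hK : 0 ≤ K)
    (hu : ContinuousOn u (Icc 0 T)) {t : ℝ} (ht : t ∈ Ioc 0 T) (w : H) :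
    Integrable (tri.indicator (Function.uncurry fun z s =>
      domega α (z - s) * inner ℝ ((B z - B s) (u s)) w)) (sqMeasure t) := by
  obtain ⟨C, hC⟩ := isCompact_Icc.exists_bound_of_continuousOn hu
  have hΓ := Real.Gamma_pos_of_pos hα
  have hα' : 0 ≤ 1 - α := by linarith
  refine integrable_tri_of_norm_le hα (C := (1 - α) / Real.Gamma α * K * C * ‖w‖) ht.1.le ?_ ?_
  · have hfst : MapsTo Prod.fst (tri ∩ Ioc 0 t ×ˢ Ioc 0 t) (Icc 0 T) := fun x hx =>
      ⟨hx.2.1.1.le, hx.2.1.2.trans ht.2⟩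
    have hsnd : MapsTo Prod.snd (tri ∩ Ioc 0 t ×ˢ Ioc 0 t) (Icc 0 T) := fun x hx =>
      ⟨hx.2.2.1.le, hx.2.2.2.trans ht.2⟩
    refine ContinuousOn.mul ?_ (ContinuousOn.inner ?_ continuousOn_const)
    · exact continuousOn_domega.comp (by fun_prop) fun x hx =>
        sub_pos.2 (show x.2 < x.1 from hx.1)
    · exact ((hB.comp continuousOn_fst hfst).sub (hB.comp continuousOn_snd hsnd)).clm_apply
        (hu.comp continuousOn_snd hsnd)
  · intro z s hs hsz hzt
    have hzs : 0 ≤ (z - s) ^ (α - 1) := Real.rpow_nonneg (sub_pos.2 hsz).le _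
    have h1 := norm_memTerm_integrand_le (u := u) hα hα₁ hLip hs hsz (hzt.trans ht.2)
    have h2 := hC s ⟨hs.le, hsz.le.trans (hzt.trans ht.2)⟩
    rw [← real_inner_smul_left]
    calc |inner ℝ (domega α (z - s) • (B z - B s) (u s)) w|
        ≤ ‖domega α (z - s) • (B z - B s) (u s)‖ * ‖w‖ := abs_real_inner_le_norm _ _
      _ ≤ (1 - α) / Real.Gamma α * K * ((z - s) ^ (α - 1) * C) * ‖w‖ := by
          refine mul_le_mul_of_nonneg_right (h1.trans ?_) (norm_nonneg _)
          gcongr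
      _ = _ := by ring

end Memory

end

section

variable {d : ℕ} {Ω : TopologicalSpace.Opens (Rd d)}

/-! ### The lower-order operators -/

theorem integral_smul_apply_apply {V : Type*} [NormedAddCommGroup V] [NormedSpace ℝ V]
    {A : ℝ → V →L[ℝ] StrongDual ℝ V} {k : ℝ → ℝ} {s t : ℝ} (hst : s ≤ t)
    (hk : IntervalIntegrable k volume s t) (hA : ContinuousOn A (Icc s t)) (v w : V) :
    (∫ z in s..t, k z • A z) v w = ∫ z in s..t, k z * A z v w := by
  rw [← uIcc_of_le hst] at hA
  have hA' : ContinuousOn (fun z => A z v) (uIcc s t) := hA.clm_apply continuousOn_const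
  rw [ContinuousLinearMap.intervalIntegral_apply (hk.smul_continuousOn hA)]
  simp only [smul_apply]
  rw [ContinuousLinearMap.intervalIntegral_apply (hk.smul_continuousOn hA')]
  rfl

/-- The operator `v ↦ a v` from `H¹₀(Ω)` to `L₂(Ω)`. -/
def mulH10 (Ω : TopologicalSpace.Opens (Rd d)) : Linf Ω →L[ℝ] H10 Ω →L[ℝ] L2 Ω :=
  (ContinuousLinearMap.compL ℝ (H10 Ω) (L2 Ω) (L2 Ω)).flip (toL2 Ω) ∘L mulL Ω

/-- The lower-order part `v ↦ div (F v) + a v` of the operators in the equation. -/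
def lowerOrder (F : W1inf Ω) (a : Linf Ω) : H10 Ω →L[ℝ] L2 Ω := divMul Ω F + mulH10 Ω a

theorem pairL2_apply (v : L2 Ω) (w : H10 Ω) : pairL2 Ω v w = inner ℝ v (toL2 Ω w) := rfl

theorem pairL2_lowerOrder (F : W1inf Ω) (a : Linf Ω) :
    pairL2 Ω ∘L lowerOrder F a = -(pairGrad Ω ∘L mulVec (toLinf Ω F) ∘L toL2 Ω)
      + pairL2 Ω ∘L mulScal a ∘L toL2 Ω := by
  ext v w
  have h := inner_mulVec_grad F v w
  change inner ℝ (divMul Ω F v + mulL Ω a (toL2 Ω v)) (toL2 Ω w)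
    = -inner ℝ (mulVec (toLinf Ω F) (toL2 Ω v)) (grad Ω w)
      + inner ℝ (mulL Ω a (toL2 Ω v)) (toL2 Ω w)
  rw [inner_add_left, h, neg_neg]

namespace Coefficients

variable (c : Coefficients Ω) {T α : ℝ}

/-- The form `⟨κ∇v, ∇w⟩`. -/
def diffForm : H10 Ω →ₗ[ℝ] H10 Ω →ₗ[ℝ] ℝ :=
  (innerₗ (L2vec Ω)).compl₁₂ ((mulMat c.κ).toLinearMap ∘ₗ (grad Ω).toLinearMap)
    (grad Ω).toLinearMap

theorem diffForm_apply (v w : H10 Ω) :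
    c.diffForm v w = inner ℝ (mulMat c.κ (grad Ω v)) (grad Ω w) := rfl

/-- The lower-order part of `K₁(t)`. -/
def lower₁ (t : ℝ) : H10 Ω →L[ℝ] L2 Ω := lowerOrder (c.F t) (c.a t)

/-- The time derivative of the lower-order part of `K₁(t)`. -/
def lower₁' (T t : ℝ) : H10 Ω →L[ℝ] L2 Ω :=
  lowerOrder (derivWithin c.F (Icc 0 T) t) (derivWithin c.a (Icc 0 T) t)

/-- The operator `K₂(t)`, with values in `L₂(Ω)`. -/
def lower₂ (t : ℝ) : H10 Ω →L[ℝ] L2 Ω := lowerOrder (c.G t) (c.b t)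

theorem K₁_apply (t : ℝ) (v w : H10 Ω) :
    c.K₁ t v w = c.diffForm v w + inner ℝ (c.lower₁ t v) (toL2 Ω w) := by
  have h := congrArg (fun A : H10 Ω →L[ℝ] Hneg1 Ω => A v w) (pairL2_lowerOrder (c.F t) (c.a t))
  change inner ℝ (c.lower₁ t v) (toL2 Ω w)
    = -inner ℝ (mulVec (toLinf Ω (c.F t)) (toL2 Ω v)) (grad Ω w)
      + inner ℝ (mulScal (c.a t) (toL2 Ω v)) (toL2 Ω w) at h
  rw [h]
  change inner ℝ (mulMat c.κ (grad Ω v)) (grad Ω w)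
    - inner ℝ (mulVec (toLinf Ω (c.F t)) (toL2 Ω v)) (grad Ω w)
      + inner ℝ (mulScal (c.a t) (toL2 Ω v)) (toL2 Ω w) = _
  rw [diffForm_apply]
  ring

theorem K₂_apply (t : ℝ) (v w : H10 Ω) :
    c.K₂ t (toL2 Ω v) w = inner ℝ (c.lower₂ t v) (toL2 Ω w) := by
  have h := congrArg (fun A : H10 Ω →L[ℝ] Hneg1 Ω => A v w) (pairL2_lowerOrder (c.G t) (c.b t))
  change inner ℝ (c.lower₂ t v) (toL2 Ω w)
    = -inner ℝ (mulVec (toLinf Ω (c.G t)) (toL2 Ω v)) (grad Ω w)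
      + inner ℝ (mulScal (c.b t) (toL2 Ω v)) (toL2 Ω w) at h
  rw [h]
  change inner ℝ (mulScal (c.b t) (toL2 Ω v)) (toL2 Ω w)
    - inner ℝ (mulVec (toLinf Ω (c.G t)) (toL2 Ω v)) (grad Ω w) = _
  ring

theorem K₁'_eq (t : ℝ) : c.K₁' T t = pairL2 Ω ∘L c.lower₁' T t :=
  (pairL2_lowerOrder _ _).symm

variable {c}

theorem Regular.hasDerivWithinAt_lower₁ (hc : c.Regular T) {t : ℝ} (ht : t ∈ Icc 0 T) :
    HasDerivWithinAt c.lower₁ (c.lower₁' T t) (Icc 0 T) t := by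
  have h1 := ((hc.F_mem.differentiableOn (by norm_num)) t ht).hasDerivWithinAt
  have h2 := ((hc.a_mem.differentiableOn (by norm_num)) t ht).hasDerivWithinAt
  exact ((divMul Ω).hasFDerivAt.comp_hasDerivWithinAt t h1).add
    ((mulH10 Ω).hasFDerivAt.comp_hasDerivWithinAt t h2)

theorem Regular.continuousOn_lower₁' (hT : 0 < T) (hc : c.Regular T) :
    ContinuousOn (c.lower₁' T) (Icc 0 T) := by
  have h1 := hc.F_mem.continuousOn_derivWithin (uniqueDiffOn_Icc hT) (by norm_num)
  have h2 := hc.a_mem.continuousOn_derivWithin (uniqueDiffOn_Icc hT) le_rfl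
  exact ((divMul Ω).continuous.comp_continuousOn h1).add
    ((mulH10 Ω).continuous.comp_continuousOn h2)

theorem Regular.continuousOn_lower₁ (hc : c.Regular T) : ContinuousOn c.lower₁ (Icc 0 T) :=
  fun _ ht => (hc.hasDerivWithinAt_lower₁ ht).continuousWithinAt

theorem Regular.continuousOn_lower₂ (hc : c.Regular T) : ContinuousOn c.lower₂ (Icc 0 T) :=
  ((divMul Ω).continuous.comp_continuousOn hc.G_mem.continuousOn).add
    ((mulH10 Ω).continuous.comp_continuousOn hc.b_mem.continuousOn)

theorem Regular.exists_lipschitz_lower₁ (hT : 0 < T) (hc : c.Regular T) :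
    ∃ K, 0 ≤ K ∧ ∀ z ∈ Icc 0 T, ∀ s ∈ Icc 0 T, ‖c.lower₁ z - c.lower₁ s‖ ≤ K * |z - s| := by
  obtain ⟨K, hK⟩ := isCompact_Icc.exists_bound_of_continuousOn (hc.continuousOn_lower₁' hT)
  refine ⟨K, (norm_nonneg _).trans (hK 0 ⟨le_rfl, hT.le⟩), fun z hz s hs => ?_⟩
  exact Convex.norm_image_sub_le_of_norm_hasDerivWithin_le
    (fun t ht => hc.hasDerivWithinAt_lower₁ ht) hK (convex_Icc 0 T) hs hz

/-- The kernel in the form obtained by integration by parts in space and in time. -/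
theorem Regular.K_apply (hα : 0 < α) (hα₁ : α < 1) (hc : c.Regular T) {s t : ℝ} (hs : 0 ≤ s)
    (hst : s < t) (ht : t ≤ T) (v w : H10 Ω) :
    c.K T α t s v w = omega α (t - s) * (c.diffForm v w + inner ℝ (c.lower₁ s v) (toL2 Ω w))
      + inner ℝ (c.lower₂ s v) (toL2 Ω w)
      + ∫ z in s..t, domega α (z - s) * inner ℝ ((c.lower₁ z - c.lower₁ s) v) (toL2 Ω w) := by
  have hT : 0 < T := (hs.trans_lt hst).trans_le ht
  have hsub : Icc s t ⊆ Icc 0 T := Icc_subset_Icc hs ht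
  have hK₁' : ContinuousOn (c.K₁' T) (Icc s t) := by
    rw [show c.K₁' T = _ from funext fun z => c.K₁'_eq z]
    exact continuousOn_const.clm_comp ((hc.continuousOn_lower₁' hT).mono hsub)
  have hω : IntervalIntegrable (fun z => omega α (z - s)) volume s t := by
    have h1 := (intervalIntegrable_omega hα 0 (t - s)).comp_sub_right s
    simpa only [zero_add, sub_add_cancel] using h1
  have hI : (∫ z in s..t, omega α (z - s) • c.K₁' T z) v w
      = ∫ z in s..t, omega α (z - s) * inner ℝ (c.lower₁' T z v) (toL2 Ω w) := by
    rw [integral_smul_apply_apply hst.le hω hK₁']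
    refine intervalIntegral.integral_congr fun z _ => ?_
    simp only [K₁'_eq]
    rfl
  set ℓ : (H10 Ω →L[ℝ] L2 Ω) →L[ℝ] ℝ :=
    innerSL ℝ (toL2 Ω w) ∘L ContinuousLinearMap.apply ℝ (L2 Ω) v
  have hℓ : ∀ A, ℓ A = inner ℝ (A v) (toL2 Ω w) := fun A => by
    rw [real_inner_comm]
    rfl
  have hparts := omega_mul_sub_integral hα hα₁ (β := fun z => ℓ (c.lower₁ z))
    (β' := fun z => ℓ (c.lower₁' T z)) hst
    (fun z hz => (ℓ.hasFDerivAt.comp_hasDerivWithinAt z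
      (hc.hasDerivWithinAt_lower₁ (hsub hz))).mono hsub)
    (ℓ.continuous.comp_continuousOn ((hc.continuousOn_lower₁' hT).mono hsub))
  simp only [hℓ] at hparts
  have hsubz : ∀ z, inner ℝ ((c.lower₁ z - c.lower₁ s) v) (toL2 Ω w)
      = inner ℝ (c.lower₁ z v) (toL2 Ω w) - inner ℝ (c.lower₁ s v) (toL2 Ω w) := fun z =>
    inner_sub_left _ _ _
  have hK : c.K T α t s v w = omega α (t - s) * c.K₁ t v w + c.K₂ s (toL2 Ω v) w
      - (∫ z in s..t, omega α (z - s) • c.K₁' T z) v w := rfl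
  rw [hK, K₁_apply, K₂_apply, hI]
  simp only [hsubz]
  linear_combination hparts

end Coefficients

theorem norm_sq_eq (v : H10 Ω) : ‖v‖ ^ 2 = ‖toL2 Ω v‖ ^ 2 + ‖grad Ω v‖ ^ 2 :=
  WithLp.prod_norm_sq_eq_of_L2 (H10incl Ω v)

theorem toL2_injective : Function.Injective (toL2 Ω) :=
  (injective_iff_map_eq_zero _).2 eq_zero_of_toL2_eq_zero

end

section

variable {d : ℕ} {Ω : TopologicalSpace.Opens (Rd d)}

/-! ### The Galerkin solution in an eigenbasis -/

theorem intervalIntegrable_source {T η M : ℝ} (hT : 0 < T) (hη : 0 < η) {g : ℝ → L2 Ω}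
    (hg : AEStronglyMeasurable g (volume.restrict (Ioc 0 T)))
    (hgM : ∀ t ∈ Ioc 0 T, ‖g t‖ ≤ M * t ^ (η - 1)) : IntervalIntegrable g volume 0 T := by
  rw [intervalIntegrable_iff_integrableOn_Ioc_of_le hT.le]
  have h : IntegrableOn (fun t : ℝ => M * t ^ (η - 1)) (Ioc 0 T) :=
    (intervalIntegrable_iff_integrableOn_Ioc_of_le hT.le).1
      ((intervalIntegrable_rpow_sub_one hη 0 T).const_mul M)
  refine Integrable.mono' h hg ?_
  filter_upwards [ae_restrict_mem measurableSet_Ioc] with t ht using hgM t ht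

theorem intervalIntegrable_inner_memTerm {V H : Type*} [NormedAddCommGroup V] [NormedSpace ℝ V]
    [NormedAddCommGroup H] [InnerProductSpace ℝ H] [CompleteSpace H] {T α K : ℝ}
    {B : ℝ → V →L[ℝ] H} {u : ℝ → V} (hα : 0 < α) (hα₁ : α < 1) (hB : ContinuousOn B (Icc 0 T))
    (hLip : ∀ z ∈ Icc 0 T, ∀ s ∈ Icc 0 T, ‖B z - B s‖ ≤ K * |z - s|) (hK : 0 ≤ K)
    (hu : ContinuousOn u (Icc 0 T)) {t : ℝ} (ht : t ∈ Ioc 0 T) (w : H) :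
    IntervalIntegrable (fun z => inner ℝ (memTerm α B u z) w) volume 0 t := by
  refine (intervalIntegrable_tri_fst ht.1.le
    (integrable_tri_memTerm hα hα₁ hB hLip hK hu ht w)).congr fun z hz => ?_
  rw [uIoc_of_le ht.1.le] at hz
  exact (inner_memTerm hα hα₁ hB hLip hu ⟨hz.1, hz.2.trans ht.2⟩ w).symm

theorem IsGalerkinSolution.coordinate_equation {T α : ℝ} (hα : 0 < α) (hα₁ : α < 1)
    {c : Coefficients Ω} (hc : c.Regular T) {K : ℝ} (hK : 0 ≤ K)
    (hLip : ∀ z ∈ Icc 0 T, ∀ s ∈ Icc 0 T, ‖c.lower₁ z - c.lower₁ s‖ ≤ K * |z - s|)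
    {u₀ : L2 Ω} {g : ℝ → L2 Ω} (hg : IntervalIntegrable g volume 0 T)
    {X : Submodule ℝ (H10 Ω)} [FiniteDimensional ℝ X] {u : ℝ → X}
    (hu : IsGalerkinSolution c T α u₀ g X u) {n : ℕ} {e : Fin n → X} {lam : Fin n → ℝ}
    (he : Orthonormal ℝ fun j => toL2 Ω (e j))
    (hlam : ∀ j (w : X), c.diffForm w (e j) = lam j * inner ℝ (toL2 Ω w) (toL2 Ω (e j)))
    (hexp : ∀ v : X, v = ∑ j, inner ℝ (toL2 Ω v) (toL2 Ω (e j)) • e j)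
    {t : ℝ} (ht : t ∈ Ioc 0 T) (j : Fin n) :
    inner ℝ (toL2 Ω (u t)) (toL2 Ω (e j))
        + lam j * vconv (omega α) (fun s => inner ℝ (toL2 Ω (u s)) (toL2 Ω (e j))) t
      = inner ℝ u₀ (toL2 Ω (e j))
        + vconv (omega α) (fun s => inner ℝ (-c.lower₁ s (u s)) (toL2 Ω (e j))) t
        + vconv (fun _ => 1) (fun s => inner ℝ (g s) (toL2 Ω (e j))
          + inner ℝ (-(c.lower₂ s (u s) + memTerm α c.lower₁ (fun s => (u s : H10 Ω)) s))
            (toL2 Ω (e j))) t := by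
  have hsub : uIcc 0 t ⊆ Icc 0 T := by
    rw [uIcc_of_le ht.1.le]
    exact Icc_subset_Icc_right ht.2
  have huc : ContinuousOn (fun s => (u s : H10 Ω)) (Icc 0 T) :=
    continuous_subtype_val.comp_continuousOn hu.continuousOn
  set w : Fin n → L2 Ω := fun j => toL2 Ω (e j)
  set y : Fin n → ℝ → ℝ := fun j s => inner ℝ (toL2 Ω (u s)) (w j)
  set f₁ : Fin n → ℝ → ℝ := fun j s => inner ℝ (c.lower₁ s (u s)) (w j)
  set f₂ : Fin n → ℝ → ℝ := fun j s => inner ℝ (c.lower₂ s (u s)) (w j)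
  set m : Fin n → ℝ → ℝ → ℝ := fun j z s =>
    domega α (z - s) * inner ℝ ((c.lower₁ z - c.lower₁ s) (u s)) (w j)
  have hy : ∀ j, ContinuousOn (y j) (uIcc 0 t) := fun j =>
    (((toL2 Ω).continuous.comp_continuousOn huc).inner continuousOn_const).mono hsub
  have hf₁ : ∀ j, ContinuousOn (f₁ j) (uIcc 0 t) := fun j =>
    ((hc.continuousOn_lower₁.clm_apply huc).inner continuousOn_const).mono hsub
  have hf₂ : ∀ j, ContinuousOn (f₂ j) (uIcc 0 t) := fun j =>
    ((hc.continuousOn_lower₂.clm_apply huc).inner continuousOn_const).mono hsub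
  have hω := intervalIntegrable_omega hα 0 t
  have htri : ∀ j, Integrable (tri.indicator (Function.uncurry (m j))) (sqMeasure t) := fun j =>
    integrable_tri_memTerm hα hα₁ hc.continuousOn_lower₁ hLip hK huc ht (w j)
  set k : Fin n → ℝ → ℝ := fun j s => lam j * (omega α (t - s) * y j s)
    + omega α (t - s) * f₁ j s + f₂ j s + ∫ z in s..t, m j z s
  have hi1 : ∀ j, IntervalIntegrable (fun s => lam j * (omega α (t - s) * y j s)) volume 0 t :=
    fun j => (intervalIntegrable_vconv_right hω (hy j)).const_mul _
  have hi2 : ∀ j, IntervalIntegrable (fun s => omega α (t - s) * f₁ j s) volume 0 t :=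
    fun j => intervalIntegrable_vconv_right hω (hf₁ j)
  have hi3 : ∀ j, IntervalIntegrable (f₂ j) volume 0 t := fun j => (hf₂ j).intervalIntegrable
  have hi4 : ∀ j, IntervalIntegrable (fun s => ∫ z in s..t, m j z s) volume 0 t := fun j =>
    intervalIntegrable_tri_snd ht.1.le (htri j)
  have hk : ∀ j, IntervalIntegrable (k j) volume 0 t := fun j =>
    (((hi1 j).add (hi2 j)).add (hi3 j)).add (hi4 j)
  have hKX : ∀ s ∈ Ioo 0 t, KX c T α X t s (u s) = ∑ j, k j s • e j := by
    intro s hs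
    rw [hexp (KX c T α X t s (u s))]
    refine Finset.sum_congr rfl fun j _ => ?_
    congr 1
    refine (inner_proj X (c.K T α t s (u s)) (e j)).trans ?_
    rw [hc.K_apply hα hα₁ hs.1.le hs.2 ht.2, hlam]
    simp only [k, y, f₁, f₂, m, w]
    ring
  have hsum : ∫ s in (0 : ℝ)..t, KX c T α X t s (u s) = ∑ j, (∫ s in (0 : ℝ)..t, k j s) • e j := by
    have h1 : ∫ s in (0 : ℝ)..t, KX c T α X t s (u s) = ∫ s in (0 : ℝ)..t, ∑ j, k j s • e j := by
      rw [intervalIntegral.integral_of_le ht.1.le, intervalIntegral.integral_of_le ht.1.le,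
        integral_Ioc_eq_integral_Ioo, integral_Ioc_eq_integral_Ioo]
      exact setIntegral_congr_fun measurableSet_Ioo hKX
    rw [h1, intervalIntegral.integral_finsetSum fun j _ => (hk j).smul_continuousOn continuousOn_const]
    exact Finset.sum_congr rfl fun j _ => intervalIntegral.integral_smul_const _ _
  have hI : ∀ j, inner ℝ (toL2 Ω (∫ s in (0 : ℝ)..t, KX c T α X t s (u s) : X)) (w j)
      = ∫ s in (0 : ℝ)..t, k j s := by
    intro j
    rw [hsum, Submodule.coe_sum, map_sum, sum_inner, Finset.sum_eq_single j]
    · rw [Submodule.coe_smul, map_smul, real_inner_smul_left, real_inner_self_eq_norm_sq]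
      simp only [w, he.1 j]
      ring
    · intro i _ hij
      rw [Submodule.coe_smul, map_smul, real_inner_smul_left]
      simp only [w, he.2 hij, mul_zero]
    · simp
  have hgt : IntervalIntegrable g volume 0 t :=
    hg.mono_set (by rwa [uIcc_of_le (ht.1.le.trans ht.2)])
  have hgj : IntervalIntegrable (fun s => inner ℝ (g s) (w j)) volume 0 t := by
    rw [intervalIntegrable_iff_integrableOn_Ioc_of_le ht.1.le] at hgt ⊢
    exact hgt.inner_const (w j)
  have hsrc : inner ℝ (toL2 Ω (fX u₀ g X t)) (w j)
      = inner ℝ u₀ (w j) + ∫ s in (0 : ℝ)..t, inner ℝ (g s) (w j) := by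
    refine (inner_proj X (pairL2 Ω (source u₀ g t)) (e j)).trans ?_
    rw [pairL2_apply, source, inner_add_left]
    congr 1
    have h := (innerSL ℝ (w j)).intervalIntegral_comp_comm hgt
    rw [real_inner_comm]
    refine h.symm.trans (intervalIntegral.integral_congr fun s _ => ?_)
    exact real_inner_comm (g s) (w j)
  have heq := congrArg (fun v : X => inner ℝ (toL2 Ω v) (w j)) (hu.equation t ⟨ht.1.le, ht.2⟩)
  simp only [Submodule.coe_add, map_add, inner_add_left] at heq
  rw [hI, hsrc] at heq
  have hmem := intervalIntegrable_inner_memTerm hα hα₁ hc.continuousOn_lower₁ hLip hK huc ht (w j)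
  have hswap : ∫ s in (0 : ℝ)..t, ∫ z in s..t, m j z s
      = ∫ z in (0 : ℝ)..t, inner ℝ (memTerm α c.lower₁ (fun s => (u s : H10 Ω)) z) (w j) := by
    rw [← integral_tri_swap ht.1.le (htri j), intervalIntegral.integral_of_le ht.1.le,
      intervalIntegral.integral_of_le ht.1.le]
    refine setIntegral_congr_fun measurableSet_Ioc fun z hz => ?_
    exact (inner_memTerm hα hα₁ hc.continuousOn_lower₁ hLip huc ⟨hz.1, hz.2.trans ht.2⟩
      (w j)).symm
  have hksplit : ∫ s in (0 : ℝ)..t, k j s = lam j * vconv (omega α) (y j) t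
      + vconv (omega α) (f₁ j) t + (∫ s in (0 : ℝ)..t, f₂ j s)
      + ∫ z in (0 : ℝ)..t, inner ℝ (memTerm α c.lower₁ (fun s => (u s : H10 Ω)) z) (w j) := by
    simp only [k]
    rw [intervalIntegral.integral_add (((hi1 j).add (hi2 j)).add (hi3 j)) (hi4 j),
      intervalIntegral.integral_add ((hi1 j).add (hi2 j)) (hi3 j),
      intervalIntegral.integral_add (hi1 j) (hi2 j), intervalIntegral.integral_const_mul, hswap]
    rfl
  have hneg : vconv (omega α) (fun s => inner ℝ (-c.lower₁ s (u s)) (w j)) t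
      = -vconv (omega α) (f₁ j) t := by
    simp only [vconv, inner_neg_left, mul_neg, intervalIntegral.integral_neg, f₁]
  have hone : vconv (fun _ => 1) (fun s => inner ℝ (g s) (w j)
        + inner ℝ (-(c.lower₂ s (u s) + memTerm α c.lower₁ (fun s => (u s : H10 Ω)) s)) (w j)) t
      = (∫ s in (0 : ℝ)..t, inner ℝ (g s) (w j)) - ((∫ s in (0 : ℝ)..t, f₂ j s)
        + ∫ z in (0 : ℝ)..t, inner ℝ (memTerm α c.lower₁ (fun s => (u s : H10 Ω)) z) (w j)) := by
    rw [vconv_one_left, ← intervalIntegral.integral_add (hi3 j) hmem,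
      ← intervalIntegral.integral_sub hgj ((hi3 j).add hmem)]
    refine intervalIntegral.integral_congr fun s _ => ?_
    simp only [inner_neg_left, inner_add_left, f₂]
    ring
  rw [hneg, hone]
  rw [hksplit] at heq
  linear_combination heq

/-- A Galerkin solution, expanded in an eigenbasis of the diffusion form, solves a Volterra
system. -/
theorem IsGalerkinSolution.volterraSystem {T α η M : ℝ} (hT : 0 < T) (hα : 0 < α) (hα₁ : α < 1)
    (hη : 0 < η) {c : Coefficients Ω} (hc : c.Regular T) {c₀ : ℝ} (hc₀ : 0 < c₀)
    (hκ : ∀ᵐ x ∂(vol Ω), (c.κ x : Rd d →ₗ[ℝ] Rd d).IsSymmetric ∧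
      ∀ lam : ℝ, Module.End.HasEigenvalue (c.κ x : Rd d →ₗ[ℝ] Rd d) lam → c₀ ≤ lam)
    {K L₁ L₂ : ℝ} (hK : 0 ≤ K)
    (hLip : ∀ z ∈ Icc 0 T, ∀ s ∈ Icc 0 T, ‖c.lower₁ z - c.lower₁ s‖ ≤ K * |z - s|)
    (hL₁ : ∀ s ∈ Icc 0 T, ‖c.lower₁ s‖ ≤ L₁) (hL₂ : ∀ s ∈ Icc 0 T, ‖c.lower₂ s‖ ≤ L₂)
    {u₀ : L2 Ω} {g : ℝ → L2 Ω} (hg : AEStronglyMeasurable g (volume.restrict (Ioc 0 T)))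
    (hgM : ∀ t ∈ Ioc 0 T, ‖g t‖ ≤ M * t ^ (η - 1))
    {X : Submodule ℝ (H10 Ω)} [FiniteDimensional ℝ X] {u : ℝ → X}
    (hu : IsGalerkinSolution c T α u₀ g X u) :
    ∃ (n : ℕ) (φ : Fin n → L2 Ω) (lam : Fin n → ℝ) (y : Fin n → ℝ → ℝ) (f ψ : ℝ → L2 Ω),
      VolterraSystem T α η (1 + c₀⁻¹) (L₁ + L₂ + (1 - α) / Real.Gamma α * K) M φ lam y
        (fun t => ‖u t‖) u₀ f ψ g ∧ ∀ t, ‖toL2 Ω (u t)‖ = √(∑ j, y j t ^ 2) := by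
  have hsymm : ∀ v w, c.diffForm v w = c.diffForm w v := fun v w =>
    inner_mulMat_comm (hκ.mono fun x hx => hx.1) _ _
  obtain ⟨n, e, lam, he, hdiag, hexp⟩ := exists_orthonormal_diagonalizing
    ((toL2 Ω).toLinearMap ∘ₗ X.subtype) (toL2_injective.comp Subtype.val_injective)
    (c.diffForm.compl₁₂ X.subtype X.subtype) (fun v w => hsymm v w)
  have he : Orthonormal ℝ fun j => toL2 Ω (e j) := he
  have hdiag : ∀ j (w : X), c.diffForm (e j) w = lam j * inner ℝ (toL2 Ω (e j)) (toL2 Ω w) := hdiag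
  have hexp : ∀ v : X, v = ∑ j, inner ℝ (toL2 Ω v) (toL2 Ω (e j)) • e j := hexp
  have hdiag' : ∀ j (w : X), c.diffForm w (e j) = lam j * inner ℝ (toL2 Ω w) (toL2 Ω (e j)) :=
    fun j w => by rw [hsymm, hdiag, real_inner_comm]
  have hcoer : ∀ v, c₀ * ‖grad Ω v‖ ^ 2 ≤ c.diffForm v v := fun v =>
    mul_norm_sq_le_inner_mulMat hκ _
  have hlam : ∀ j, 0 ≤ lam j := fun j => by
    have h1 := hcoer (e j)
    rw [hdiag, real_inner_self_eq_norm_sq, he.1 j] at h1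
    have : 0 ≤ c₀ * ‖grad Ω (e j)‖ ^ 2 := by positivity
    linarith
  have hnorm : ∀ v : X, ‖toL2 Ω v‖ ^ 2 = ∑ j, inner ℝ (toL2 Ω v) (toL2 Ω (e j)) ^ 2 := by
    intro v
    have h1 : toL2 Ω v = ∑ j, inner ℝ (toL2 Ω v) (toL2 Ω (e j)) • toL2 Ω (e j) := by
      conv_lhs => rw [hexp v, Submodule.coe_sum, map_sum]
      exact Finset.sum_congr rfl fun j _ => by rw [Submodule.coe_smul, map_smul]
    rw [← real_inner_self_eq_norm_sq]
    conv_lhs => rw [h1]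
    rw [sum_inner]
    refine Finset.sum_congr rfl fun j _ => ?_
    rw [real_inner_smul_left, ← h1, real_inner_comm (toL2 Ω v)]
    ring
  have hform : ∀ v : X, c.diffForm v v
      = ∑ j, lam j * inner ℝ (toL2 Ω v) (toL2 Ω (e j)) ^ 2 := by
    intro v
    have h1 : c.diffForm v v = ∑ j, inner ℝ (toL2 Ω v) (toL2 Ω (e j)) * c.diffForm v (e j) := by
      conv_lhs => enter [2]; rw [hexp v, Submodule.coe_sum]
      rw [map_sum]
      exact Finset.sum_congr rfl fun j _ => by rw [Submodule.coe_smul, map_smul, smul_eq_mul]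
    rw [h1]
    exact Finset.sum_congr rfl fun j _ => by rw [hdiag']; ring
  have huc : ContinuousOn (fun s => (u s : H10 Ω)) (Icc 0 T) :=
    continuous_subtype_val.comp_continuousOn hu.continuousOn
  have hgi := intervalIntegrable_source hT hη hg hgM
  have hΓ := Real.Gamma_pos_of_pos hα
  have hK' : 0 ≤ (1 - α) / Real.Gamma α * K := mul_nonneg (div_nonneg (by linarith) hΓ.le) hK
  have hL₁0 : 0 ≤ L₁ := (norm_nonneg _).trans (hL₁ 0 ⟨le_rfl, hT.le⟩)
  have hL₂0 : 0 ≤ L₂ := (norm_nonneg _).trans (hL₂ 0 ⟨le_rfl, hT.le⟩)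
  refine ⟨n, fun j => toL2 Ω (e j), lam, fun j s => inner ℝ (toL2 Ω (u s)) (toL2 Ω (e j)),
    fun s => -c.lower₁ s (u s),
    fun s => -(c.lower₂ s (u s) + memTerm α c.lower₁ (fun s => (u s : H10 Ω)) s), ?_, ?_⟩
  · refine ⟨he, hlam, fun j => ?_, hu.continuousOn.norm, fun _ _ => norm_nonneg _, fun t _ => ?_,
      (hc.continuousOn_lower₁.clm_apply huc).neg, fun s hs => ?_, fun s hs => ?_, fun j => ?_, hgM,
      fun j => ?_, fun j t ht => ?_⟩
    · exact ((toL2 Ω).continuous.comp_continuousOn huc).inner continuousOn_const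
    · have hsum : ∑ j, (√(1 + lam j) * inner ℝ (toL2 Ω (u t)) (toL2 Ω (e j))) ^ 2
          = ‖toL2 Ω (u t)‖ ^ 2 + c.diffForm (u t) (u t) := by
        rw [hnorm, hform, ← Finset.sum_add_distrib]
        refine Finset.sum_congr rfl fun j _ => ?_
        rw [mul_pow, Real.sq_sqrt (by linarith [hlam j])]
        ring
      rw [hsum]
      have h1 := hcoer (u t)
      have h2 : ‖u t‖ ^ 2 = ‖toL2 Ω (u t)‖ ^ 2 + ‖grad Ω (u t)‖ ^ 2 := norm_sq_eq (u t : H10 Ω)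
      have h3 : ‖grad Ω (u t)‖ ^ 2 ≤ c₀⁻¹ * c.diffForm (u t) (u t) := by
        rw [inv_mul_eq_div, le_div_iff₀ hc₀]
        linarith
      have hform0 : 0 ≤ c.diffForm (u t) (u t) := le_trans (by positivity) h1
      have hi := (inv_pos.2 hc₀).le
      refine (sq_le_sq₀ (norm_nonneg _) (by positivity)).1 ?_
      rw [h2, mul_pow, Real.sq_sqrt (by positivity)]
      set a := ‖toL2 Ω (u t)‖ ^ 2
      set b := c.diffForm (u t) (u t)
      have ha : 0 ≤ a := sq_nonneg _
      nlinarith [mul_nonneg hi ha, mul_nonneg hi hform0, mul_nonneg (mul_nonneg hi hi) ha,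
        mul_nonneg (mul_nonneg hi hi) hform0]
    · rw [norm_neg]
      refine ((c.lower₁ s).le_of_opNorm_le (hL₁ s ⟨hs.1.le, hs.2⟩) _).trans ?_
      refine mul_le_mul_of_nonneg_right ?_ (norm_nonneg _)
      linarith
    · rw [norm_neg]
      have h1 := (c.lower₂ s).le_of_opNorm_le (hL₂ s ⟨hs.1.le, hs.2⟩) (u s)
      have h2 := norm_memTerm_le hα hα₁ hLip huc hs
      have h3 : 0 ≤ ∫ r in (0 : ℝ)..s, (s - r) ^ (α - 1) * ‖u r‖ := by
        rw [intervalIntegral.integral_of_le hs.1.le]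
        exact setIntegral_nonneg measurableSet_Ioc fun r hr =>
          mul_nonneg (Real.rpow_nonneg (sub_nonneg.2 hr.2) _) (norm_nonneg _)
      have h1 : ‖c.lower₂ s (u s)‖ ≤ L₂ * ‖u s‖ := h1
      have h2 : ‖memTerm α c.lower₁ (fun s => (u s : H10 Ω)) s‖
        ≤ (1 - α) / Real.Gamma α * K * ∫ r in (0 : ℝ)..s, (s - r) ^ (α - 1) * ‖u r‖ := h2
      refine (norm_add_le _ _).trans ((add_le_add h1 h2).trans ?_)
      have hn := norm_nonneg (u s)
      set I := ∫ r in (0 : ℝ)..s, (s - r) ^ (α - 1) * ‖u r‖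
      nlinarith [mul_nonneg hL₁0 hn, mul_nonneg hL₁0 h3, mul_nonneg hL₂0 h3, mul_nonneg hK' hn]
    · have h1 : IntervalIntegrable (fun s => inner ℝ (c.lower₂ s (u s)) (toL2 Ω (e j)))
          volume 0 T := by
        apply ContinuousOn.intervalIntegrable
        rw [uIcc_of_le hT.le]
        exact (hc.continuousOn_lower₂.clm_apply huc).inner continuousOn_const
      have h2 := intervalIntegrable_inner_memTerm hα hα₁ hc.continuousOn_lower₁ hLip hK huc
        ⟨hT, le_rfl⟩ (toL2 Ω (e j))
      refine (h1.add h2).neg.congr fun s _ => ?_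
      simp only [Pi.neg_apply, inner_neg_left, inner_add_left]
    · rw [intervalIntegrable_iff_integrableOn_Ioc_of_le hT.le] at hgi ⊢
      exact hgi.inner_const _
    · exact hu.coordinate_equation hα hα₁ hc hK hLip hgi he hdiag' hexp ht j
  · intro t
    rw [← hnorm, Real.sqrt_sq (norm_nonneg _)]

end

end FracADR

end

open FracADR in
theorem theorem3p3 {d : ℕ} (hd : 1 ≤ d) (Ω : TopologicalSpace.Opens (FracADR.Rd d))
    (hΩ : Bornology.IsBounded (Ω : Set (FracADR.Rd d)))
    (T α η : ℝ) (hT : 0 < T) (hα₀ : 0 < α) (hα₁ : α < 1) (hη : 0 < η)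
    (c : FracADR.Coefficients Ω) (hc : c.Regular T) (hκ : c.Elliptic) :
    ∃ C : ℝ, ∀ (M : ℝ), 0 < M → ∀ (u₀ : FracADR.L2 Ω) (g : ℝ → FracADR.L2 Ω),
      AEStronglyMeasurable g (volume.restrict (Ioc 0 T)) →
      (∀ t ∈ Ioc 0 T, ‖g t‖ ≤ M * t ^ (η - 1)) →
      ∀ (X : Submodule ℝ (FracADR.H10 Ω)) [FiniteDimensional ℝ X] (u : ℝ → X),
        FracADR.IsGalerkinSolution c T α u₀ g X u →
        ∀ t ∈ Icc 0 T,
          ‖FracADR.toL2 Ω (u t)‖ ^ 2 + t ^ α * ‖FracADR.grad Ω (u t)‖ ^ 2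
            ≤ C * (‖u₀‖ ^ 2 + M ^ 2 * t ^ (2 * η)) := by
  obtain ⟨c₀, hc₀, hκ⟩ := hκ
  obtain ⟨K, hK, hLip⟩ := hc.exists_lipschitz_lower₁ hT
  obtain ⟨L₁, hL₁⟩ := isCompact_Icc.exists_bound_of_continuousOn hc.continuousOn_lower₁
  obtain ⟨L₂, hL₂⟩ := isCompact_Icc.exists_bound_of_continuousOn hc.continuousOn_lower₂
  have hL₁0 : 0 ≤ L₁ := (norm_nonneg _).trans (hL₁ 0 ⟨le_rfl, hT.le⟩)
  have hL₂0 : 0 ≤ L₂ := (norm_nonneg _).trans (hL₂ 0 ⟨le_rfl, hT.le⟩)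
  have hΓ := Real.Gamma_pos_of_pos hα₀
  have hK' : 0 ≤ (1 - α) / Real.Gamma α * K := mul_nonneg (div_nonneg (by linarith) hΓ.le) hK
  obtain ⟨C, hC, hbound⟩ := exists_bound_of_volterraSystem (H := L2 Ω) (c := 1 + c₀⁻¹)
    (L := L₁ + L₂ + (1 - α) / Real.Gamma α * K) hT hα₀ hα₁ hη (by positivity) (by positivity)
  refine ⟨1 + 4 * C ^ 2, ?_⟩
  intro M hM u₀ g hg hgM X _ u hu t ht
  have hR : 0 ≤ ‖u₀‖ ^ 2 + M ^ 2 * t ^ (2 * η) := by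
    have := Real.rpow_nonneg ht.1 (2 * η)
    positivity
  rcases ht.1.eq_or_lt with rfl | ht0
  · rw [Real.zero_rpow hα₀.ne', zero_mul, add_zero]
    have h0 := hu.equation 0 ⟨le_rfl, hT.le⟩
    rw [intervalIntegral.integral_same, add_zero] at h0
    have h1 : inner ℝ (toL2 Ω (u 0)) (toL2 Ω (u 0)) = inner ℝ u₀ (toL2 Ω (u 0)) := by
      have := inner_proj X (pairL2 Ω (source u₀ g 0)) (u 0)
      rw [← fX, ← h0, pairL2_apply, source, intervalIntegral.integral_same, add_zero] at this
      exact this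
    have h2 : ‖toL2 Ω (u 0)‖ ≤ ‖u₀‖ := by
      rw [real_inner_self_eq_norm_sq] at h1
      have h3 := real_inner_le_norm u₀ (toL2 Ω (u 0))
      rcases (norm_nonneg (toL2 Ω (u 0))).eq_or_lt with h4 | h4
      · rw [← h4]
        exact norm_nonneg _
      · refine le_of_mul_le_mul_right ?_ h4
        nlinarith
    have h3 : ‖toL2 Ω (u 0)‖ ^ 2 ≤ ‖u₀‖ ^ 2 := pow_le_pow_left₀ (norm_nonneg _) h2 2
    have h4 : 0 ≤ M ^ 2 * (0 : ℝ) ^ (2 * η) :=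
      mul_nonneg (sq_nonneg _) (Real.rpow_nonneg le_rfl _)
    nlinarith [mul_nonneg (sq_nonneg C) hR]
  · obtain ⟨n, φ, lam, y, f, ψ, hS, hy⟩ := hu.volterraSystem hT hα₀ hα₁ hη hc hc₀ hκ hK hLip hL₁ hL₂
      hg hgM
    obtain ⟨h1, h2⟩ := hbound M hM.le hS t ⟨ht0, ht.2⟩
    rw [← hy] at h1
    have h3 : ‖u t‖ ^ 2 = ‖toL2 Ω (u t)‖ ^ 2 + ‖grad Ω (u t)‖ ^ 2 := norm_sq_eq (u t : H10 Ω)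
    have htη := Real.rpow_nonneg ht0.le η
    have h4 : ‖toL2 Ω (u t)‖ ^ 2 ≤ (C * (‖u₀‖ + M * t ^ η)) ^ 2 :=
      pow_le_pow_left₀ (norm_nonneg _) h1 2
    have h5 : (t ^ (α / 2) * ‖u t‖) ^ 2 ≤ (C * (‖u₀‖ + M * t ^ η)) ^ 2 :=
      pow_le_pow_left₀ (mul_nonneg (Real.rpow_nonneg ht0.le _) (norm_nonneg _)) h2 2
    have h6 : (t ^ (α / 2)) ^ 2 = t ^ α := by
      rw [← Real.rpow_natCast, ← Real.rpow_mul ht0.le]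
      congr 1
      push_cast
      ring
    have h7 : t ^ (2 * η) = (t ^ η) ^ 2 := by
      rw [← Real.rpow_natCast, ← Real.rpow_mul ht0.le]
      congr 1
      push_cast
      ring
    rw [mul_pow, h6, h3, mul_add] at h5
    rw [h7] at hR ⊢
    have h8 : 0 ≤ t ^ α * ‖toL2 Ω (u t)‖ ^ 2 :=
      mul_nonneg (Real.rpow_nonneg ht0.le _) (sq_nonneg _)
    have h9 : (‖u₀‖ + M * t ^ η) ^ 2 ≤ 2 * (‖u₀‖ ^ 2 + M ^ 2 * (t ^ η) ^ 2) := by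
      nlinarith [sq_nonneg (‖u₀‖ - M * t ^ η)]
    have h10 := mul_le_mul_of_nonneg_left h9 (sq_nonneg C)
    rw [mul_pow] at h4 h5
    linarith
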